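/- Let $T>0$, $d,m\in\mathbb N$, let $H\in(\tfrac12,1)$, and let $W^H=(W^{H,1},\dots,W^{H,m})$ be independent fractional Brownian motions with Hurst parameter $H$ on a probability space $(\Omega,\mathcal F,P)$, that is, independent centered Gaussian processes indexed by $t\ge 0$ with covariance $\tfrac12(s^{2H}+t^{2H}-|t-s|^{2H})$ and almost surely continuous paths. Let $x(0)\in\mathbb R^d$ with $x^i(0)>0$ for $i=1,\dots,d$. Assume: (H1) $\sigma:[0,T]\times\mathbb R^d\to\mathbb R^{d\times m}$ is bounded and there are constants $K_0$ and $\nu\ge H$ such that $|\sigma(t,x)-\sigma(t,y)|\le K_0|x-y|$ and $|\sigma(t,x)-\sigma(s,x)|\le K_0|t-s|^{\nu}$ for all $x,y\in\mathbb R^d$ and $s,t\in[0,T]$; (H2) $b:[0,T]\times\mathbb R^d\to\mathbb R^d$ is bounded, measurable in $t$, and there is a constant $K_0$ such that $|b(t,x)-b(t,y)|\le K_0|x-y|$ for all $x,y\in\mathbb R^d$ and $t\in[0,T]$. Let $\lambda_0\in(\tfrac12,H)$, and let $C^{\lambda_0}(0,T;\mathbb R^d)$ be the space of $\lambda_0$-Hölder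 continuous functions $[0,T]\to\mathbb R^d$ with the norm $\|f\|_\infty+\sup_{0\le u<v\le T}\frac{|f(v)-f(u)|}{(v-u)^{\lambda_0}}$. Then there is $X\in L^0(\Omega,\mathcal F,P;C^{\lambda_0}(0,T;\mathbb R^d))$ (the space of almost-everywhere classes of strongly measurable maps) such that, almost surely, for all $t\in[0,T]$, $$X(t)=Z(t)+Y(t),\qquad Z(t)=x(0)+\int_0^t b(s,X(s))\,ds+\int_0^t\sigma(s,X(s))\,dW^H_s,$$ $$Y^i(t)=\max_{s\in[0,t]}\bigl(Z^i(s)\bigr)^-,\qquad i=1,\dots,d,$$ and $(X,Y)$ solves the Skorokhod problem for $Z$ on $[0,T]$: $X,Y,Z$ are continuous, $X^i\ge0$, $Y^i(0)=0$, $Y^i$ is non-decreasing and $\int_0^t X^i\,dY^i=0$ for all $t\in[0,T]$ and all $i$. Here $\int\sigma(s,X(s))\,dW^H_s$ is the pathwise Young integral: if $f$ is $\kappa$-Hölder and $g$ is $\gamma$-Hölder on $[0,T]$ with $\kappa+\gamma>1$, then $\int_s^t f\,dg=f_s(g_t-g_s)+R_{st}$, where $R$ is the unique continuous function on $[0,T]^2$,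 zero on the diagonal, with $|R_{st}|\le C|t-s|^{\mu}$ for some $C$ and some $\mu>1$ and $R_{st}-R_{su}-R_{ut}=(f_u-f_s)(g_t-g_u)$ for all $s,u,t\in[0,T]$. -/

import Mathlib

open MeasureTheory ProbabilityTheory Set
open scoped NNReal ENNReal

/-! ### The Hölder space `C^r(0,T;E)` -/

section HolderSpace

variable (r : ℝ≥0) (T : ℝ) (E : Type*) [NormedAddCommGroup E]

/-- The additive group of continuous functions `[0,T] → E` with finite `r`-Hölder seminorm. -/
def holderAddSubgroup : AddSubgroup C(Icc (0 : ℝ) T, E) where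
  carrier := {f | MemHolder r f}
  zero_mem' := memHolder_zero
  add_mem' := fun hf hg => hf.add hg
  neg_mem' := fun {f} hf => by
    obtain ⟨C, hC⟩ := hf
    refine ⟨C, fun s t => ?_⟩
    have h := hC s t
    simpa [edist_neg_neg] using h

/-- The space `C^r(0,T;E)` of `r`-Hölder continuous functions on `[0,T]`. -/
def HolderSpace : Type _ := holderAddSubgroup r T E

namespace HolderSpace

variable {r T E}

noncomputable instance : AddCommGroup (HolderSpace r T E) :=
  inferInstanceAs (AddCommGroup (holderAddSubgroup r T E))

instance : CoeFun (HolderSpace r T E) (fun _ => Icc (0 : ℝ) T → E) := ⟨fun f => f.1⟩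

/-- The Hölder norm `‖f‖_∞ + sup_{u < v} |f v - f u| / (v - u)^r`. -/
noncomputable def holderGroupNorm : AddGroupNorm (HolderSpace r T E) where
  toFun f := ‖f.1‖ + (nnHolderNorm r (f : Icc (0 : ℝ) T → E) : ℝ)
  map_zero' := by
    have h : ((0 : HolderSpace r T E) : Icc (0 : ℝ) T → E) = 0 := rfl
    have h1 : (0 : HolderSpace r T E).1 = 0 := rfl
    rw [h, h1]
    simp
  add_le' f g := by
    have h1 : ‖(f + g).1‖ ≤ ‖f.1‖ + ‖g.1‖ := norm_add_le f.1 g.1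
    have h2 : nnHolderNorm r ((f + g : HolderSpace r T E) : Icc (0 : ℝ) T → E)
        ≤ nnHolderNorm r (f : Icc (0 : ℝ) T → E) + nnHolderNorm r (g : Icc (0 : ℝ) T → E) :=
      MemHolder.nnHolderNorm_add_le f.2 g.2
    have h3 : (nnHolderNorm r ((f + g : HolderSpace r T E) : Icc (0 : ℝ) T → E) : ℝ)
        ≤ nnHolderNorm r (f : Icc (0 : ℝ) T → E) + nnHolderNorm r (g : Icc (0 : ℝ) T → E) :=
      mod_cast h2
    linarith
  neg' f := by
    have h1 : ‖(-f).1‖ = ‖f.1‖ := norm_neg f.1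
    have h2 : ∀ g : HolderSpace r T E, nnHolderNorm r ((-g : HolderSpace r T E) :
        Icc (0 : ℝ) T → E) ≤ nnHolderNorm r (g : Icc (0 : ℝ) T → E) := fun g => by
      refine HolderWith.nnholderNorm_le fun s t => ?_
      have h := (MemHolder.holderWith g.2) s t
      have e : edist ((-g : HolderSpace r T E) s) ((-g : HolderSpace r T E) t)
          = edist (g s) (g t) := edist_neg_neg _ _
      rw [e]
      exact h
    have h3 := h2 (-f)
    rw [neg_neg] at h3
    rw [h1, le_antisymm (h2 f) h3]
  eq_zero_of_map_eq_zero' f hf := by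
    have hf' : ‖f.1‖ + (nnHolderNorm r (f : Icc (0 : ℝ) T → E) : ℝ) = 0 := hf
    have h1 : (0 : ℝ) ≤ nnHolderNorm r (f : Icc (0 : ℝ) T → E) := NNReal.coe_nonneg _
    have h0 : ‖f.1‖ = 0 := le_antisymm (by linarith) (norm_nonneg _)
    exact Subtype.ext (norm_eq_zero.1 h0)

noncomputable instance : NormedAddCommGroup (HolderSpace r T E) :=
  holderGroupNorm.toNormedAddCommGroup

end HolderSpace

end HolderSpace

/-! ### Fractional Brownian motion -/

/-- A fractional Brownian motion with Hurst parameter `H`: a centered Gaussian process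
`(B_t)_{t ≥ 0}` with covariance `(s^{2H} + t^{2H} - |t - s|^{2H}) / 2` and almost surely
continuous paths. -/
structure IsFractionalBrownianMotion {Ω : Type*} [MeasurableSpace Ω]
    (H : ℝ) (B : ℝ≥0 → Ω → ℝ) (P : Measure Ω) : Prop where
  gaussian : IsGaussianProcess B P
  centered : ∀ t, ∫ ω, B t ω ∂P = 0
  covariance_eq : ∀ s t : ℝ≥0, cov[B s, B t; P] =
    ((s : ℝ) ^ (2 * H) + (t : ℝ) ^ (2 * H) - |(t : ℝ) - s| ^ (2 * H)) / 2
  continuous_paths : ∀ᵐ ω ∂P, Continuous fun t => B t ω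

/-- The path `t ↦ (W^1_t(ω), …, W^m_t(ω))`, as a function of a real time `t`; only times
`t ≥ 0` matter. -/
noncomputable def drivingPath {Ω : Type*} {m : ℕ} (W : Fin m → ℝ≥0 → Ω → ℝ) (ω : Ω) (t : ℝ) :
    EuclideanSpace ℝ (Fin m) :=
  WithLp.toLp 2 fun j => W j t.toNNReal ω

/-! ### The Young integral (algebraic integration) and the coefficients -/

/-- `R = Λ h` on `[0,T]`: `R` is a continuous increment vanishing on the diagonal, with
`|R_{st}| ≤ C |t - s|^μ` for some `μ > 1`, and `(δR)_{sut} = R_{st} - R_{su} - R_{ut} = h_{sut}`.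
There is at most one such `R` on `[0,T]²`. -/
structure IsSewing {V : Type*} [NormedAddCommGroup V] (T : ℝ) (h : ℝ → ℝ → ℝ → V)
    (R : ℝ → ℝ → V) : Prop where
  continuousOn : ContinuousOn (fun p : ℝ × ℝ => R p.1 p.2) (Icc 0 T ×ˢ Icc 0 T)
  diag : ∀ t ∈ Icc 0 T, R t t = 0
  bound : ∃ C μ : ℝ, 1 < μ ∧ ∀ s ∈ Icc 0 T, ∀ t ∈ Icc 0 T, ‖R s t‖ ≤ C * |t - s| ^ μ
  delta_eq : ∀ s ∈ Icc 0 T, ∀ u ∈ Icc 0 T, ∀ t ∈ Icc 0 T, R s t - R s u - R u t = h s u t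

section Coefficients

open scoped Matrix.Norms.Frobenius

/-- `J s t = ∫_s^t f dg` for `s, t ∈ [0,T]` in the Young sense: `f` is `κ`-Hölder and `g` is
`γ`-Hölder on `[0,T]` with `κ + γ > 1`, and `∫_s^t f dg = f_s (δg)_{st} + Λ_{st}(δf δg)`. -/
def IsYoungIntegral {d m : ℕ} (T : ℝ) (f : ℝ → Matrix (Fin d) (Fin m) ℝ)
    (g : ℝ → EuclideanSpace ℝ (Fin m)) (J : ℝ → ℝ → EuclideanSpace ℝ (Fin d)) : Prop :=
  (∃ κ γ C D : ℝ≥0, 0 < κ ∧ 0 < γ ∧ 1 < κ + γ ∧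
    HolderOnWith C κ f (Icc 0 T) ∧ HolderOnWith D γ g (Icc 0 T)) ∧
  ∃ R : ℝ → ℝ → EuclideanSpace ℝ (Fin d),
    IsSewing T (fun s u t => Matrix.toEuclideanLin (f u - f s) (g t - g u)) R ∧
    ∀ s ∈ Icc 0 T, ∀ t ∈ Icc 0 T, J s t = Matrix.toEuclideanLin (f s) (g t - g s) + R s t

/-- Hypothesis (H1) on the diffusion coefficient, with time-Hölder exponent `ν`. -/
structure DiffusionHypothesis {d m : ℕ} (T ν : ℝ)
    (σ : ℝ → EuclideanSpace ℝ (Fin d) → Matrix (Fin d) (Fin m) ℝ) : Prop where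
  bounded : ∃ M : ℝ, ∀ t ∈ Icc 0 T, ∀ x, ‖σ t x‖ ≤ M
  regular : ∃ K₀ : ℝ,
    (∀ t ∈ Icc 0 T, ∀ x y, ‖σ t x - σ t y‖ ≤ K₀ * ‖x - y‖) ∧
    (∀ x, ∀ t ∈ Icc 0 T, ∀ s ∈ Icc 0 T, ‖σ t x - σ s x‖ ≤ K₀ * |t - s| ^ ν)

end Coefficients

/-- Hypothesis (H2) on the drift coefficient (with the measurability in time which the
Lebesgue integral of the drift presupposes). -/
structure DriftHypothesis {d : ℕ} (T : ℝ)
    (b : ℝ → EuclideanSpace ℝ (Fin d) → EuclideanSpace ℝ (Fin d)) : Prop where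
  measurable : ∀ x, AEStronglyMeasurable (fun t => b t x) (volume.restrict (Icc 0 T))
  bounded : ∃ M : ℝ, ∀ t ∈ Icc 0 T, ∀ x, ‖b t x‖ ≤ M
  lipschitz : ∃ K₀ : ℝ, ∀ t ∈ Icc 0 T, ∀ x y, ‖b t x - b t y‖ ≤ K₀ * ‖x - y‖

/-! ### The Skorokhod problem and the reflected equation -/

/-- `(x, y)` solves the Skorokhod problem for `z` on `[0,T]`, with reflection at the boundary of
the non-negative orthant. In `complementary` the integral `∫_0^t x^i dy^i` (of the non-negative
function `x^i`) is the Lebesgue–Stieltjes one. -/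
structure IsSkorokhodSolution {d : ℕ} (T : ℝ) (z x y : ℝ → EuclideanSpace ℝ (Fin d)) : Prop where
  continuousOn_z : ContinuousOn z (Icc 0 T)
  continuousOn_x : ContinuousOn x (Icc 0 T)
  continuousOn_y : ContinuousOn y (Icc 0 T)
  start_nonneg : ∀ i, 0 ≤ z 0 i
  eq_add : ∀ t ∈ Icc 0 T, x t = z t + y t
  nonneg : ∀ t ∈ Icc 0 T, ∀ i, 0 ≤ x t i
  regulator_zero : ∀ i, y 0 i = 0
  regulator_mono : ∀ i, MonotoneOn (fun t => y t i) (Icc 0 T)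
  complementary : ∀ i, ∃ F : StieltjesFunction ℝ, (∀ t ∈ Icc 0 T, F t = y t i) ∧
    ∀ t ∈ Icc 0 T, ∫⁻ s in Ioc 0 t, ENNReal.ofReal (x s i) ∂F.measure = 0

/-- `x` solves the reflected equation
`x(t) = x₀ + ∫_0^t b(s,x(s)) ds + ∫_0^t σ(s,x(s)) dg_s + y(t)` on `[0,T]`, where `y` is the
regulator of `z(t) = x₀ + ∫_0^t b(s,x(s)) ds + ∫_0^t σ(s,x(s)) dg_s`, that is,
`y^i(t) = max_{s ∈ [0,t]} (z^i(s))^-`. -/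
def IsReflectedSolution {d m : ℕ} (T : ℝ)
    (b : ℝ → EuclideanSpace ℝ (Fin d) → EuclideanSpace ℝ (Fin d))
    (σ : ℝ → EuclideanSpace ℝ (Fin d) → Matrix (Fin d) (Fin m) ℝ)
    (x₀ : EuclideanSpace ℝ (Fin d)) (g : ℝ → EuclideanSpace ℝ (Fin m))
    (x : ℝ → EuclideanSpace ℝ (Fin d)) : Prop :=
  IntervalIntegrable (fun s => b s (x s)) volume 0 T ∧
  ∃ (J : ℝ → ℝ → EuclideanSpace ℝ (Fin d)) (z y : ℝ → EuclideanSpace ℝ (Fin d)),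
    IsYoungIntegral T (fun s => σ s (x s)) g J ∧
    (∀ t ∈ Icc 0 T, z t = x₀ + (∫ s in (0 : ℝ)..t, b s (x s)) + J 0 t) ∧
    (∀ t ∈ Icc 0 T, ∀ i, IsGreatest ((fun s => (z s i)⁻) '' Icc 0 t) (y t i)) ∧
    IsSkorokhodSolution T z x y

/-! ### Discrete Young estimates -/

/-! The Skorokhod map is Lipschitz for the supremum norm, whereas a contraction argument for a Young
equation would need such a bound in a Hölder norm. Existence is therefore obtained path by path from
compactness: reflected Euler schemes satisfy a Hölder bound independent of the mesh, and every
uniform cluster point of them solves the equation. Fix `γ` strictly between `lam₀` and `H`; almost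
every driving path is `γ`-Hölder by moment bounds and dyadic chaining
(`IsFractionalBrownianMotion.ae_holder`).

The uniform bound rests on two facts. Since `2 * γ > 1`, Riemann sums of `γ`-Hölder sequences differ
from their leading term by a quantity of order `2 * γ` (`norm_sum_Ico_sub_le`). Moreover the
oscillation of the regulator on an interval is at most that of the unreflected path on the same
interval, so a Hölder bound for the latter controls the coefficient. On short intervals the
remainder gains a small factor and the estimate closes on itself; chaining extends it to `[0,T]`
(`exists_holder_bound_of_isGridSolution`).

In the limit the remainder estimate survives: the increments of `z` minus drift differ from
`σ(s,x(s)) (g t - g s)` by `O((t - s) ^ (2 * γ))`, and this identifies them as the Young integral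
(`exists_young_remainder_bound`, `isYoungIntegral_of_remainder_bound`). Reflection passes to the
limit by its supremum-norm continuity, and complementarity holds because the regulator is constant
wherever the reflected path is positive.

No uniqueness is used, so the convergent subsequence may depend on `ω`. A cluster point is selected
measurably in the separable space of continuous paths (`exists_aemeasurable_mapClusterPt`). Strong
measurability in the smaller Hölder space then follows because piecewise linear interpolations of a
`γ`-Hölder path converge to it in the `lam₀`-norm (`HolderSpace.aestronglyMeasurable_of_holder`). -/

/-- Passes from a bound valid at one scale to arbitrary increments, at the cost of the number of
blocks. -/
lemma norm_sub_le_of_chain {V : Type*} [SeminormedAddCommGroup V] {z : ℕ → V} {N q : ℕ} {D : ℝ}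
    (hD : 0 ≤ D) (hz : ∀ k l, k ≤ l → l ≤ N → l - k ≤ q → ‖z l - z k‖ ≤ D) (r : ℕ) :
    ∀ k l, k ≤ l → l ≤ N → l - k ≤ r * q → ‖z l - z k‖ ≤ r * D := by
  induction r with
  | zero =>
    intro k l h1 h2 h3
    obtain rfl : l = k := by omega
    simp
  | succ r ih =>
    intro k l h1 h2 h3
    rw [add_mul, one_mul] at h3
    push_cast
    rcases le_total (l - k) q with h4 | h4
    · calc ‖z l - z k‖ ≤ D := hz k l h1 h2 h4
        _ ≤ _ := by nlinarith [(Nat.cast_nonneg r : (0 : ℝ) ≤ r)]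
    · calc ‖z l - z k‖ ≤ ‖z l - z (l - q)‖ + ‖z (l - q) - z k‖ := 
            norm_sub_le_norm_sub_add_norm_sub _ _ _
        _ ≤ D + r * D := add_le_add (hz _ _ (by omega) h2 (by omega))
            (ih _ _ (by omega) (by omega) (by omega))
        _ = _ := by ring

section DiscreteYoung

variable {U V : Type*} [NormedAddCommGroup U] [NormedSpace ℝ U]
  [NormedAddCommGroup V] [NormedSpace ℝ V]

/-- The constant of the discrete Young estimate with exponent `γ`. -/
noncomputable def youngConst (γ : ℝ) : ℝ := (1 - (2 / 3 : ℝ) ^ (2 * γ - 1))⁻¹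

lemma rpow_two_thirds_lt_one {γ : ℝ} (hγ : 1 / 2 < γ) : (2 / 3 : ℝ) ^ (2 * γ - 1) < 1 :=
  Real.rpow_lt_one (by norm_num) (by norm_num) (by linarith)

lemma youngConst_pos {γ : ℝ} (hγ : 1 / 2 < γ) : 0 < youngConst γ :=
  inv_pos.2 (sub_pos.2 (rpow_two_thirds_lt_one hγ))

/-- One factor of each power is kept linear and the remaining exponent `μ - 1` is applied to at most
two thirds of the total. The ratio `2 / 3` is the worst case of halving an integer length `n ≥ 2`,
reached at `3 = 1 + 2`. -/
lemma rpow_add_rpow_le_of_le_two_thirds {p q μ : ℝ} (hp : 0 < p) (hq : 0 < q) (hμ : 1 < μ)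
    (hp' : p ≤ 2 / 3 * (p + q)) (hq' : q ≤ 2 / 3 * (p + q)) :
    p ^ μ + q ^ μ ≤ (2 / 3 : ℝ) ^ (μ - 1) * (p + q) ^ μ := by
  have key : ∀ r : ℝ, 0 < r → r ≤ 2 / 3 * (p + q) →
      r ^ μ ≤ (2 / 3 * (p + q)) ^ (μ - 1) * r := fun r hr hr' => by
    calc r ^ μ = r ^ (μ - 1) * r := by
          rw [← Real.rpow_add_one hr.ne']; congr 1; ring
      _ ≤ _ := by gcongr
  have h3 : (p + q) ^ μ = (p + q) ^ (μ - 1) * (p + q) := by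
    rw [← Real.rpow_add_one (by positivity)]; congr 1; ring
  calc p ^ μ + q ^ μ
      ≤ (2 / 3 * (p + q)) ^ (μ - 1) * p + (2 / 3 * (p + q)) ^ (μ - 1) * q :=
        add_le_add (key p hp hp') (key q hq hq')
    _ = _ := by rw [h3, Real.mul_rpow (by norm_num) (by positivity)]; ring

/-- Discrete Young estimate: Riemann sums of Hölder sequences on a uniform grid of mesh `h`. -/
lemma norm_sum_Ico_sub_le {f : ℕ → U →L[ℝ] V} {w : ℕ → U} {F G h γ : ℝ} (hγ : 1 / 2 < γ)
    (hh : 0 ≤ h) (hF : 0 ≤ F) (hG : 0 ≤ G) {a b : ℕ} (hab : a ≤ b)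
    (hf : ∀ i j : ℕ, a ≤ i → i ≤ j → j < b → ‖f j - f i‖ ≤ F * (h * (j - i)) ^ γ)
    (hw : ∀ i j : ℕ, a ≤ i → i ≤ j → j ≤ b → ‖w j - w i‖ ≤ G * (h * (j - i)) ^ γ) :
    ‖∑ i ∈ Finset.Ico a b, f i (w (i + 1) - w i) - f a (w b - w a)‖
      ≤ youngConst γ * (F * G) * (h * (b - a)) ^ (2 * γ) := by
  induction hn : b - a using Nat.strong_induction_on generalizing a b with
  | _ n ih =>
  have hC := youngConst_pos hγ
  have hba : (0 : ℝ) ≤ (b : ℝ) - a := sub_nonneg.2 (by exact_mod_cast hab)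
  rcases Nat.lt_or_ge n 2 with hn2 | hn2
  · have h0 : ∑ i ∈ Finset.Ico a b, f i (w (i + 1) - w i) - f a (w b - w a) = 0 := by
      rcases (by omega : b = a ∨ b = a + 1) with rfl | rfl <;> simp
    rw [h0, norm_zero]; positivity
  -- Cut near the middle: the defect of the left-point approximation is additive up to the single
  -- cross term `(f c - f a) (w b - w c)`, which is of order `2 * γ`.
  obtain ⟨c, hc⟩ : ∃ c, c = a + n / 2 := ⟨_, rfl⟩
  have hac : a < c := by omega
  have hcb : c < b := by omega
  have i1 := ih (c - a) (by omega) hac.le (fun i j h1 h2 h3 => hf i j h1 h2 (by omega))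
    (fun i j h1 h2 h3 => hw i j h1 h2 (by omega)) rfl
  have i2 := ih (b - c) (by omega) hcb.le (fun i j h1 h2 h3 => hf i j (by omega) h2 h3)
    (fun i j h1 h2 h3 => hw i j (by omega) h2 h3) rfl
  have hsplit : ∑ i ∈ Finset.Ico a b, f i (w (i + 1) - w i) - f a (w b - w a)
      = (∑ i ∈ Finset.Ico a c, f i (w (i + 1) - w i) - f a (w c - w a))
      + (∑ i ∈ Finset.Ico c b, f i (w (i + 1) - w i) - f c (w b - w c))
      + (f c - f a) (w b - w c) := by
    rw [← Finset.sum_Ico_consecutive _ hac.le hcb.le]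
    simp only [map_sub, sub_apply]; abel
  have hac' : (0 : ℝ) < (c : ℝ) - a := sub_pos.2 (by exact_mod_cast hac)
  have hcb' : (0 : ℝ) < (b : ℝ) - c := sub_pos.2 (by exact_mod_cast hcb)
  have hb2 : ‖(f c - f a) (w b - w c)‖ ≤ F * G * (h * (b - a)) ^ (2 * γ) := by
    calc ‖(f c - f a) (w b - w c)‖ ≤ ‖f c - f a‖ * ‖w b - w c‖ :=
          ContinuousLinearMap.le_opNorm _ _
      _ ≤ (F * (h * (c - a)) ^ γ) * (G * (h * (b - c)) ^ γ) := by
          gcongr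
          · exact hf a c le_rfl hac.le hcb
          · exact hw c b hac.le hcb.le le_rfl
      _ ≤ (F * (h * (b - a)) ^ γ) * (G * (h * (b - a)) ^ γ) := by
          gcongr
      _ = _ := by
          rw [two_mul γ, Real.rpow_add_of_nonneg (by positivity) (by linarith) (by linarith)]
          ring
  have hpow : (h * (c - a)) ^ (2 * γ) + (h * (b - c)) ^ (2 * γ)
      ≤ (2 / 3 : ℝ) ^ (2 * γ - 1) * (h * (b - a)) ^ (2 * γ) := by
    have h1 : (c : ℝ) - a ≤ 2 / 3 * ((c - a) + (b - c)) := by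
      have : 3 * (c - a) ≤ 2 * (b - a) := by omega
      have : (3 : ℝ) * (c - a) ≤ 2 * (b - a) := by
        rw [← Nat.cast_sub hac.le, ← Nat.cast_sub hab]; exact_mod_cast this
      linarith
    have h2 : (b : ℝ) - c ≤ 2 / 3 * ((c - a) + (b - c)) := by
      have : 3 * (b - c) ≤ 2 * (b - a) := by omega
      have : (3 : ℝ) * (b - c) ≤ 2 * (b - a) := by
        rw [← Nat.cast_sub hcb.le, ← Nat.cast_sub hab]; exact_mod_cast this
      linarith
    have := rpow_add_rpow_le_of_le_two_thirds hac' hcb' (by linarith : 1 < 2 * γ) h1 h2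
    rw [Real.mul_rpow hh hac'.le, Real.mul_rpow hh hcb'.le, Real.mul_rpow hh hba, ← mul_add,
      mul_left_comm]
    refine mul_le_mul_of_nonneg_left (this.trans_eq ?_) (by positivity)
    congr 2; ring
  -- `youngConst γ` is the fixed point of `C ↦ C * (2 / 3) ^ (2 * γ - 1) + 1`, so the two halves
  -- plus the cross term reproduce the same constant.
  have hCe : youngConst γ * (2 / 3 : ℝ) ^ (2 * γ - 1) + 1 = youngConst γ := by
    have := sub_pos.2 (rpow_two_thirds_lt_one hγ)
    rw [youngConst]; field_simp; ring
  rw [hsplit]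
  calc _ ≤ youngConst γ * (F * G) * (h * (c - a)) ^ (2 * γ)
        + youngConst γ * (F * G) * (h * (b - c)) ^ (2 * γ)
        + F * G * (h * (b - a)) ^ (2 * γ) :=
        norm_add₃_le.trans (add_le_add (add_le_add i1 i2) hb2)
    _ = youngConst γ * (F * G) * ((h * (c - a)) ^ (2 * γ) + (h * (b - c)) ^ (2 * γ))
        + F * G * (h * (b - a)) ^ (2 * γ) := by ring
    _ ≤ youngConst γ * (F * G) * ((2 / 3 : ℝ) ^ (2 * γ - 1) * (h * (b - a)) ^ (2 * γ))
        + F * G * (h * (b - a)) ^ (2 * γ) := by gcongr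
    _ = (youngConst γ * (2 / 3 : ℝ) ^ (2 * γ - 1) + 1) * (F * G) * (h * (b - a)) ^ (2 * γ) := by
        ring
    _ = _ := by rw [hCe]

/-- A sequence `z` on the grid of mesh `h` solving `z (k + 1) = z k + β k + f k (w (k + 1) - w k)`
for `k < N`, with bounded coefficients, `f` controlled by an auxiliary sequence `x`, and the
oscillation of `x` controlled by that of `z`. -/
structure IsGridSolution (M K G c γ h : ℝ) (N : ℕ) (z x : ℕ → V) (f : ℕ → U →L[ℝ] V)
    (w : ℕ → U) (β : ℕ → V) : Prop where
  step : ∀ k < N, z (k + 1) = z k + β k + f k (w (k + 1) - w k)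
  drift_le : ∀ k < N, ‖β k‖ ≤ M * h
  coeff_le : ∀ k < N, ‖f k‖ ≤ M
  coeff_sub_le : ∀ k l : ℕ, k ≤ l → l < N →
    ‖f l - f k‖ ≤ K * (h * (l - k)) ^ γ + K * ‖x l - x k‖
  driver_sub_le : ∀ k l : ℕ, k ≤ l → l ≤ N → ‖w l - w k‖ ≤ G * (h * (l - k)) ^ γ
  osc_le : ∀ k l : ℕ, k ≤ l → l ≤ N → ∀ B : ℝ, (∀ j, k ≤ j → j ≤ l → ‖z j - z k‖ ≤ B) →
    ‖x l - x k‖ ≤ c * B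

namespace IsGridSolution

variable {M K G c γ h : ℝ} {N : ℕ} {z x : ℕ → V} {f : ℕ → U →L[ℝ] V} {w : ℕ → U} {β : ℕ → V}

lemma sub_eq (hz : IsGridSolution M K G c γ h N z x f w β) {k l : ℕ} (hkl : k ≤ l) (hl : l ≤ N) :
    z l - z k = ∑ j ∈ Finset.Ico k l, β j + ∑ j ∈ Finset.Ico k l, f j (w (j + 1) - w j) := by
  induction l, hkl using Nat.le_induction with
  | base => simp
  | succ l hkl ih =>
    rw [Finset.sum_Ico_succ_top hkl, Finset.sum_Ico_succ_top hkl, hz.step l (by omega)]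
    have := ih (by omega)
    rw [sub_eq_iff_eq_add] at this
    rw [this]; abel

lemma coeff_holder (hz : IsGridSolution M K G c γ h N z x f w β) (hh : 0 < h) (hK : 0 ≤ K)
    (hγ : 0 < γ) {B : ℝ} (hB : 0 ≤ B) {k l : ℕ} (hkl : k ≤ l) (hl : l < N)
    (hzB : ∀ j, k ≤ j → j ≤ l → ‖z j - z k‖ ≤ B * (h * (j - k)) ^ γ) :
    ‖f l - f k‖ ≤ K * (1 + c * B) * (h * (l - k)) ^ γ := by
  have h1 : ‖x l - x k‖ ≤ c * (B * (h * (l - k)) ^ γ) := by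
    refine hz.osc_le k l hkl hl.le _ fun j hj hjl => (hzB j hj hjl).trans ?_
    have : (k : ℝ) ≤ j := by exact_mod_cast hj
    have : (j : ℝ) ≤ l := by exact_mod_cast hjl
    have : 0 ≤ (j : ℝ) - k := by linarith
    gcongr
  calc ‖f l - f k‖ ≤ K * (h * (l - k)) ^ γ + K * ‖x l - x k‖ := hz.coeff_sub_le k l hkl hl
    _ ≤ K * (h * (l - k)) ^ γ + K * (c * (B * (h * (l - k)) ^ γ)) := by gcongr
    _ = _ := by ring

/-- The Young remainder of a grid solution with a known Hölder bound. -/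
lemma norm_sum_sub_le (hz : IsGridSolution M K G c γ h N z x f w β) (hh : 0 < h) (hK : 0 ≤ K)
    (hG : 0 ≤ G) (hc : 0 ≤ c) (hγ : 1 / 2 < γ) {B : ℝ} (hB : 0 ≤ B) {k l : ℕ} (hkl : k ≤ l)
    (hl : l ≤ N) (hzB : ∀ i j, k ≤ i → i ≤ j → j < l → ‖z j - z i‖ ≤ B * (h * (j - i)) ^ γ) :
    ‖∑ j ∈ Finset.Ico k l, f j (w (j + 1) - w j) - f k (w l - w k)‖
      ≤ youngConst γ * (K * (1 + c * B) * G) * (h * (l - k)) ^ (2 * γ) :=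
  norm_sum_Ico_sub_le hγ hh.le (by positivity) hG hkl
    (fun i j h1 h2 h3 => hz.coeff_holder hh hK (by linarith) hB h2 (by omega)
      fun a ha ha' => hzB i a h1 ha (by omega))
    (fun i j h1 h2 h3 => hz.driver_sub_le i j h2 (by omega))

/-- Bootstrap by strong induction on the number of steps. In `B ≥ M + M * G + 1` the three terms pay
for the drift, the leading term and the Young remainder. The remainder constant grows with `B`, but
its spare factor `ε ^ γ` brings it below one. -/
lemma norm_sub_le_of_small (hz : IsGridSolution M K G c γ h N z x f w β) (hh : 0 < h)
    (hM : 0 ≤ M) (hK : 0 ≤ K) (hG : 0 ≤ G) (hc : 0 ≤ c) (hγ : 1 / 2 < γ) (hγ1 : γ ≤ 1)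
    {ε B : ℝ} (hε1 : ε ≤ 1) (hB : M + M * G + 1 ≤ B)
    (hεB : youngConst γ * (K * (1 + c * B) * G) * ε ^ γ ≤ 1) {k l : ℕ} (hkl : k ≤ l) (hl : l ≤ N)
    (hlε : h * (l - k) ≤ ε) : ‖z l - z k‖ ≤ B * (h * (l - k)) ^ γ := by
  have hB0 : 0 ≤ B := le_trans (by positivity) hB
  induction hp : l - k using Nat.strong_induction_on generalizing k l with
  | _ p ih =>
  have hY := youngConst_pos hγ
  have hd : (0 : ℝ) ≤ (l : ℝ) - k := sub_nonneg.2 (by exact_mod_cast hkl)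
  have hhd : 0 ≤ h * ((l : ℝ) - k) := by positivity
  -- The remainder never involves the coefficient at the right endpoint `l`, so only increments with
  -- `j < l` occur; these are strictly shorter and covered by the induction hypothesis.
  have hrem := hz.norm_sum_sub_le hh hK hG hc hγ hB0 hkl hl fun i j h1 h2 h3 => by
    refine ih (j - i) (by omega) h2 (by omega) (le_trans ?_ hlε) rfl
    have : (k : ℝ) ≤ i := by exact_mod_cast h1
    have : (j : ℝ) ≤ l := by exact_mod_cast h3.le
    gcongr
  have hdr : ‖∑ j ∈ Finset.Ico k l, β j‖ ≤ M * (h * (l - k)) ^ γ := by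
    calc ‖∑ j ∈ Finset.Ico k l, β j‖ ≤ ∑ j ∈ Finset.Ico k l, M * h :=
          norm_sum_le_of_le _ fun j hj => hz.drift_le j (by
            have := Finset.mem_Ico.1 hj; omega)
      _ = M * (h * (l - k)) := by
          rw [Finset.sum_const, Nat.card_Ico, nsmul_eq_mul, Nat.cast_sub hkl]; ring
      _ ≤ M * (h * (l - k)) ^ γ := by
          gcongr
          exact Real.self_le_rpow_of_le_one hhd (hlε.trans hε1) hγ1
  have hlead : ‖f k (w l - w k)‖ ≤ M * G * (h * (l - k)) ^ γ := by
    rcases hkl.eq_or_lt with rfl | hlt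
    · simp; positivity
    calc ‖f k (w l - w k)‖ ≤ ‖f k‖ * ‖w l - w k‖ := ContinuousLinearMap.le_opNorm _ _
      _ ≤ M * (G * (h * (l - k)) ^ γ) := by
          gcongr
          · exact hz.coeff_le k (by omega)
          · exact hz.driver_sub_le k l hkl hl
      _ = _ := by ring
  have hrem' : youngConst γ * (K * (1 + c * B) * G) * (h * (l - k)) ^ (2 * γ)
      ≤ (h * (l - k)) ^ γ := by
    rw [two_mul, Real.rpow_add_of_nonneg hhd (by linarith) (by linarith), ← mul_assoc]
    refine mul_le_of_le_one_left (by positivity) (le_trans ?_ hεB)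
    gcongr
  rw [hz.sub_eq hkl hl]
  calc _ = ‖∑ j ∈ Finset.Ico k l, β j + (∑ j ∈ Finset.Ico k l, f j (w (j + 1) - w j)
          - f k (w l - w k)) + f k (w l - w k)‖ := by congr 1; abel
    _ ≤ M * (h * (l - k)) ^ γ + (h * (l - k)) ^ γ + M * G * (h * (l - k)) ^ γ :=
        norm_add₃_le.trans (add_le_add (add_le_add hdr (hrem.trans hrem')) hlead)
    _ = (M + M * G + 1) * (h * (l - k)) ^ γ := by ring
    _ ≤ _ := by gcongr

end IsGridSolution

/-- A priori Hölder estimate for grid solutions, uniform in the mesh. -/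
theorem exists_holder_bound_of_isGridSolution {M K G c γ T : ℝ} (hM : 0 ≤ M) (hK : 0 ≤ K)
    (hG : 0 ≤ G) (hc : 0 ≤ c) (hγ : 1 / 2 < γ) (hγ1 : γ ≤ 1) (hT : 0 < T) :
    ∃ C ε : ℝ, 0 ≤ C ∧ 0 < ε ∧ ∀ (h : ℝ) (N : ℕ) (z x : ℕ → V) (f : ℕ → U →L[ℝ] V) (w : ℕ → U)
      (β : ℕ → V), IsGridSolution M K G c γ h N z x f w β → 0 < h → h ≤ ε → h * N ≤ T →
      ∀ k l : ℕ, k ≤ l → l ≤ N → ‖z l - z k‖ ≤ C * (h * (l - k)) ^ γ := by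
  obtain ⟨B, hB⟩ : ∃ B, B = M + M * G + 1 := ⟨_, rfl⟩
  have hB0 : 0 ≤ B := by rw [hB]; positivity
  obtain ⟨A, hA⟩ : ∃ A, A = youngConst γ * (K * (1 + c * B) * G) := ⟨_, rfl⟩
  have hY := youngConst_pos hγ
  have hA0 : 0 ≤ A := by rw [hA]; positivity
  -- Solves `(1 + A) * ε ^ γ = 1`, which gives both `ε ≤ 1` and `A * ε ^ γ ≤ 1`.
  obtain ⟨ε, hε⟩ : ∃ ε : ℝ, ε = ((1 + A)⁻¹) ^ γ⁻¹ := ⟨_, rfl⟩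
  have hε0 : 0 < ε := by rw [hε]; positivity
  have hε1 : ε ≤ 1 := by
    rw [hε]
    exact Real.rpow_le_one (by positivity) (inv_le_one_of_one_le₀ (by linarith))
      (by rw [inv_nonneg]; linarith)
  have hεA : A * ε ^ γ ≤ 1 := by
    rw [hε, Real.rpow_inv_rpow (by positivity) (by linarith), ← div_eq_mul_inv,
      div_le_one (by positivity)]
    linarith
  refine ⟨(2 * T / ε + 1) * B, ε, by positivity, hε0, ?_⟩
  intro h N z x f w β hz hh hhε hN k l hkl hl
  have hd : (0 : ℝ) ≤ (l : ℝ) - k := sub_nonneg.2 (by exact_mod_cast hkl)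
  have hsmall : ∀ k l : ℕ, k ≤ l → l ≤ N → h * (l - k) ≤ ε →
      ‖z l - z k‖ ≤ B * (h * (l - k)) ^ γ := fun k l h1 h2 h3 =>
    hz.norm_sub_le_of_small hh hM hK hG hc hγ hγ1 hε1 hB.ge (hA ▸ hεA) h1 h2 h3
  have hTε : 0 ≤ 2 * T / ε := by positivity
  by_cases hle : h * (l - k) ≤ ε
  · refine (hsmall k l hkl hl hle).trans ?_
    gcongr
    nlinarith
  push Not at hle
  -- Long increments are cut into blocks of `q` steps, of length between `ε / 2` and `ε`; hence at
  -- most `2 * T / ε + 1` blocks. The condition `h ≤ ε` ensures that a block contains at least one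
  -- step.
  obtain ⟨q, hq⟩ : ∃ q, q = ⌊ε / h⌋₊ := ⟨_, rfl⟩
  have hq1 : 1 ≤ q := by rw [hq, Nat.one_le_floor_iff, one_le_div hh]; exact hhε
  have hqε : h * q ≤ ε := by
    have := Nat.floor_le (show 0 ≤ ε / h by positivity)
    rw [← hq, le_div_iff₀ hh] at this; linarith
  have hqε2 : ε ≤ 2 * (h * q) := by
    have := Nat.lt_floor_add_one (ε / h)
    rw [← hq, div_lt_iff₀ hh] at this
    have : (1 : ℝ) ≤ q := by exact_mod_cast hq1
    nlinarith
  have hq0 : (0 : ℝ) < q := by exact_mod_cast hq1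
  have hch := norm_sub_le_of_chain (z := z) (N := N) (q := q) (D := B * (h * q) ^ γ)
    (by positivity) (fun k l h1 h2 h3 => by
      have h4 : (l : ℝ) - k ≤ q := by rw [← Nat.cast_sub h1]; exact_mod_cast h3
      have h5 : (0 : ℝ) ≤ (l : ℝ) - k := sub_nonneg.2 (by exact_mod_cast h1)
      refine (hsmall k l h1 h2 (le_trans (by gcongr) hqε)).trans ?_
      gcongr) ((l - k) / q + 1) k l hkl hl (by
        have := Nat.lt_div_mul_add (a := l - k) hq1
        rw [add_mul, one_mul]; omega)
  refine hch.trans ?_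
  have hr : (((l - k) / q + 1 : ℕ) : ℝ) ≤ 2 * T / ε + 1 := by
    push_cast
    gcongr
    refine Nat.cast_div_le.trans ?_
    rw [Nat.cast_sub hkl, div_le_div_iff₀ hq0 hε0]
    have h1 : h * ((l : ℝ) - k) ≤ T := by
      refine le_trans ?_ hN
      have : (l : ℝ) ≤ N := by exact_mod_cast hl
      have : (0 : ℝ) ≤ k := Nat.cast_nonneg k
      gcongr; linarith
    calc ((l : ℝ) - k) * ε ≤ ((l : ℝ) - k) * (2 * (h * q)) := by gcongr
      _ = 2 * (h * (l - k)) * q := by ring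
      _ ≤ 2 * T * q := by gcongr
  calc (((l - k) / q + 1 : ℕ) : ℝ) * (B * (h * q) ^ γ)
      ≤ (2 * T / ε + 1) * (B * (h * (l - k)) ^ γ) := by
        gcongr
        exact le_of_mul_le_mul_left (hqε.trans hle.le) hh
    _ = _ := by ring

end DiscreteYoung

/-! ### The regulator of the Skorokhod problem -/

section Regulator

/-- The running maximum `sup_{s ∈ [0,t]} (z s)⁻` of the negative part of `z`. -/
noncomputable def regulator (z : ℝ → ℝ) (t : ℝ) : ℝ := sSup ((fun s => (z s)⁻) '' Icc 0 t)

lemma negPart_le_negPart_add_abs_sub (a b : ℝ) : a⁻ ≤ b⁻ + |a - b| := by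
  simp only [negPart_def]
  refine sup_le ?_ (by positivity)
  have h1 := neg_abs_le (a - b)
  have h2 : -b ≤ -b ⊔ 0 := le_sup_left
  linarith

variable {T : ℝ} {z z' : ℝ → ℝ}

lemma isGreatest_regulator (hz : ContinuousOn z (Icc 0 T)) {t : ℝ} (ht : t ∈ Icc 0 T) :
    IsGreatest ((fun s => (z s)⁻) '' Icc 0 t) (regulator z t) := by
  have hc : ContinuousOn (fun s => (z s)⁻) (Icc 0 t) := by
    simp only [negPart_def]
    exact ((hz.mono (Icc_subset_Icc_right ht.2)).neg).sup continuousOn_const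
  exact (isCompact_Icc.image_of_continuousOn hc).isGreatest_sSup
    ((nonempty_Icc.2 ht.1).image _)

lemma negPart_le_regulator (hz : ContinuousOn z (Icc 0 T)) {s t : ℝ} (ht : t ∈ Icc 0 T)
    (hs : s ∈ Icc 0 t) : (z s)⁻ ≤ regulator z t :=
  (isGreatest_regulator hz ht).2 (mem_image_of_mem _ hs)

lemma regulator_le (hz : ContinuousOn z (Icc 0 T)) {t B : ℝ} (ht : t ∈ Icc 0 T)
    (hB : ∀ s ∈ Icc 0 t, (z s)⁻ ≤ B) : regulator z t ≤ B := by
  obtain ⟨s, hs, h⟩ := (isGreatest_regulator hz ht).1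
  exact h ▸ hB s hs

lemma regulator_mono (hz : ContinuousOn z (Icc 0 T)) : MonotoneOn (regulator z) (Icc 0 T) :=
  fun _ hs _ ht hst => regulator_le hz hs fun _ hu =>
    negPart_le_regulator hz ht ⟨hu.1, hu.2.trans hst⟩

lemma regulator_nonneg (hz : ContinuousOn z (Icc 0 T)) {t : ℝ} (ht : t ∈ Icc 0 T) :
    0 ≤ regulator z t :=
  (negPart_nonneg _).trans (negPart_le_regulator hz ht ⟨le_rfl, ht.1⟩)

lemma add_regulator_nonneg (hz : ContinuousOn z (Icc 0 T)) {t : ℝ} (ht : t ∈ Icc 0 T) :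
    0 ≤ z t + regulator z t := by
  have h1 := negPart_le_regulator hz ht ⟨ht.1, le_rfl⟩
  have h2 := neg_le_negPart (z t)
  linarith

lemma regulator_zero (z : ℝ → ℝ) : regulator z 0 = (z 0)⁻ := by
  simp [regulator]

/-- If the maximum up to `t` is attained before `s`, the regulator has not moved; if it is attained
at `u` in `[s,t]`, then `(z u)⁻ ≤ (z s)⁻ + |z u - z s|`. This localisation lets the regulator
inherit Hölder bounds. -/
lemma abs_regulator_sub_le (hz : ContinuousOn z (Icc 0 T)) {s t B : ℝ} (hs : 0 ≤ s) (hst : s ≤ t)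
    (ht : t ≤ T) (hB : ∀ u ∈ Icc s t, |z u - z s| ≤ B) :
    |regulator z t - regulator z s| ≤ B := by
  have hs' : s ∈ Icc 0 T := ⟨hs, hst.trans ht⟩
  have ht' : t ∈ Icc 0 T := ⟨hs.trans hst, ht⟩
  have hB0 : 0 ≤ B := (abs_nonneg _).trans (hB s ⟨le_rfl, hst⟩)
  rw [abs_of_nonneg (sub_nonneg.2 (regulator_mono hz hs' ht' hst)), sub_le_iff_le_add]
  refine regulator_le hz ht' fun u hu => ?_
  rcases le_total u s with h | h
  · have := negPart_le_regulator hz hs' ⟨hu.1, h⟩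
    linarith
  · have h1 := negPart_le_negPart_add_abs_sub (z u) (z s)
    have h2 := hB u ⟨h, hu.2⟩
    have h3 := negPart_le_regulator hz hs' ⟨hs, le_rfl⟩
    linarith

/-- The stability of reflection used for passing to the limit in the scheme: running maxima are
1-Lipschitz for the supremum norm. -/
lemma abs_regulator_sub_regulator_le (hz : ContinuousOn z (Icc 0 T))
    (hz' : ContinuousOn z' (Icc 0 T)) {t B : ℝ} (ht : t ∈ Icc 0 T)
    (hB : ∀ u ∈ Icc 0 t, |z u - z' u| ≤ B) : |regulator z t - regulator z' t| ≤ B := by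
  rw [abs_sub_le_iff]
  constructor
  · rw [sub_le_iff_le_add]
    refine regulator_le hz ht fun u hu => ?_
    have h1 := negPart_le_negPart_add_abs_sub (z u) (z' u)
    have h2 := hB u hu
    have h3 := negPart_le_regulator hz' ht hu
    linarith
  · rw [sub_le_iff_le_add]
    refine regulator_le hz' ht fun u hu => ?_
    have h1 := negPart_le_negPart_add_abs_sub (z' u) (z u)
    have h2 := hB u hu
    rw [abs_sub_comm] at h2
    have h3 := negPart_le_regulator hz ht hu
    linarith

lemma continuousOn_regulator (hz : ContinuousOn z (Icc 0 T)) :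
    ContinuousOn (regulator z) (Icc 0 T) := by
  have huc := isCompact_Icc.uniformContinuousOn_of_continuous hz
  rw [Metric.uniformContinuousOn_iff] at huc
  rw [Metric.continuousOn_iff]
  intro s hs ε hε
  obtain ⟨δ, hδ, H⟩ := huc (ε / 2) (half_pos hε)
  have key : ∀ a ∈ Icc 0 T, ∀ b ∈ Icc 0 T, a ≤ b → b - a < δ →
      |regulator z b - regulator z a| ≤ ε / 2 := fun a ha b hb hab hd =>
    abs_regulator_sub_le hz ha.1 hab hb.2 fun u hu =>
      (H u ⟨ha.1.trans hu.1, hu.2.trans hb.2⟩ a ha (by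
        rw [Real.dist_eq, abs_of_nonneg (by linarith [hu.1])]; linarith [hu.2])).le
  refine ⟨δ, hδ, fun t ht hd => ?_⟩
  rw [Real.dist_eq] at hd ⊢
  rcases le_total s t with h | h
  · rw [abs_of_nonneg (by linarith)] at hd
    linarith [key s hs t ht h hd]
  · rw [abs_sub_comm, abs_of_nonneg (by linarith)] at hd
    rw [abs_sub_comm]
    linarith [key t ht s hs h hd]

/-- A maximiser `u > a` of the negative part on `[0,c]` would satisfy `-z u < (z u)⁻` by positivity
of the reflected path, which forces `(z u)⁻ = 0`; the regulator then vanishes throughout `[0,c]`.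
Otherwise the maximum is already attained before `a`. -/
lemma regulator_eq_of_pos (hz : ContinuousOn z (Icc 0 T)) {a c : ℝ} (ha : 0 ≤ a) (hac : a ≤ c)
    (hc : c ≤ T) (hpos : ∀ u ∈ Ioc a c, 0 < z u + regulator z u) :
    regulator z c = regulator z a := by
  have ha' : a ∈ Icc 0 T := ⟨ha, hac.trans hc⟩
  have hc' : c ∈ Icc 0 T := ⟨ha.trans hac, hc⟩
  refine le_antisymm ?_ (regulator_mono hz ha' hc' hac)
  obtain ⟨u, hu, hmax⟩ := (isGreatest_regulator hz hc').1
  have hmax' : (z u)⁻ = regulator z c := hmax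
  rcases le_or_gt u a with hua | hua
  · rw [← hmax']
    exact negPart_le_regulator hz ha' ⟨hu.1, hua⟩
  · have hu' : u ∈ Icc 0 T := ⟨hu.1, hu.2.trans hc⟩
    have h1 := regulator_mono hz hu' hc' hu.2
    have h2 := hpos u ⟨hua, hu.2⟩
    have h3 : -z u < (z u)⁻ := by rw [hmax']; linarith
    have h4 : (z u)⁻ = 0 := by
      rw [negPart_def] at h3 ⊢
      rcases max_choice (-z u) 0 with h | h
      · exact absurd h3 (by rw [h]; exact lt_irrefl _)
      · exact h
    rw [← hmax', h4]
    exact regulator_nonneg hz ha'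

/-- The regulator only increases when the reflected path `z + regulator z` vanishes. -/
lemma exists_stieltjes_regulator (hT : 0 ≤ T) (hz : ContinuousOn z (Icc 0 T)) :
    ∃ F : StieltjesFunction ℝ, (∀ t ∈ Icc 0 T, F t = regulator z t) ∧
      ∀ t ∈ Icc 0 T, ∫⁻ s in Ioc 0 t, ENNReal.ofReal (z s + regulator z s) ∂F.measure = 0 := by
  have hy := continuousOn_regulator hz
  -- Extending the regulator by constants outside `[0,T]` gives a Stieltjes function without mass
  -- there.
  have hcont : Continuous (IccExtend hT (fun t : Icc 0 T => regulator z t)) :=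
    (continuousOn_iff_continuous_domRestrict.1 hy).Icc_extend'
  have hmono : Monotone (IccExtend hT (fun t : Icc 0 T => regulator z t)) :=
    Monotone.IccExtend hT fun a b hab => regulator_mono hz a.2 b.2 hab
  let F : StieltjesFunction ℝ :=
    { toFun := IccExtend hT (fun t : Icc 0 T => regulator z t)
      mono' := hmono
      right_continuous' := fun t => hcont.continuousWithinAt }
  have hF : ∀ t ∈ Icc 0 T, F t = regulator z t := fun t ht =>
    IccExtend_of_mem hT (fun t : Icc 0 T => regulator z t) ht
  have hFconst : ∀ c, T ≤ c → F c = F T := fun c hc => by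
    change IccExtend hT (fun t : Icc 0 T => regulator z t) c =
      IccExtend hT (fun t : Icc 0 T => regulator z t) T
    rw [IccExtend_of_right_le hT _ hc, IccExtend_of_right_le hT _ le_rfl]
  refine ⟨F, hF, fun t ht => ?_⟩
  -- It suffices to find, around each time where the reflected path is positive, a neighbourhood on
  -- which `F` is constant: locally null sets are null.
  have hnull : F.measure {s | s ∈ Ioc 0 T ∧ 0 < z s + regulator z s} = 0 := by
    refine measure_null_of_locally_null _ fun s hs => ?_
    obtain ⟨⟨hs0, hsT⟩, hpos⟩ := hs
    have hev : ∀ᶠ u in nhdsWithin s (Icc 0 T), 0 < z u + regulator z u :=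
      ((hz.add hy) s ⟨hs0.le, hsT⟩).eventually_const_lt hpos
    obtain ⟨δ, hδ, H⟩ := Metric.mem_nhdsWithin_iff.1 hev
    -- The interval is truncated at `0` here and at `T` in `hmin`, since positivity is known only
    -- inside `[0,T]`.
    obtain ⟨a, ha⟩ : ∃ a, a = max 0 (s - δ / 2) := ⟨_, rfl⟩
    have has : a < s := by rw [ha]; exact max_lt hs0 (by linarith)
    have ha0 : 0 ≤ a := by rw [ha]; exact le_max_left _ _
    have hasδ : s - δ / 2 ≤ a := by rw [ha]; exact le_max_right _ _
    refine ⟨Ioc a (s + δ / 2), mem_nhdsWithin_of_mem_nhds (Ioc_mem_nhds has (by linarith)), ?_⟩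
    rw [F.measure_Ioc, ENNReal.ofReal_eq_zero, sub_nonpos]
    have hmin : F (s + δ / 2) = F (min (s + δ / 2) T) := by
      rcases le_total (s + δ / 2) T with h | h
      · rw [min_eq_left h]
      · rw [min_eq_right h, hFconst _ h]
    have hsm : s ≤ min (s + δ / 2) T := le_min (by linarith) hsT
    rw [hmin, hF _ ⟨by linarith, min_le_right _ _⟩, hF a ⟨ha0, by linarith⟩]
    refine (regulator_eq_of_pos hz ha0 (by linarith) (min_le_right _ _) fun u hu => H ⟨?_, ?_⟩).le
    · have h1 := hu.2.trans (min_le_left _ _)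
      rw [Metric.mem_ball, Real.dist_eq, abs_lt]
      constructor <;> linarith [hu.1]
    · exact ⟨by linarith [hu.1], hu.2.trans (min_le_right _ _)⟩
  rw [← nonpos_iff_eq_zero]
  calc ∫⁻ s in Ioc 0 t, ENNReal.ofReal (z s + regulator z s) ∂F.measure
      ≤ ∫⁻ s in Ioc 0 t, 0 ∂F.measure := by
        refine lintegral_mono_ae ?_
        rw [ae_restrict_iff' measurableSet_Ioc, ae_iff]
        refine measure_mono_null (fun s hs => ?_) hnull
        simp only [mem_ofPred_eq, Classical.not_imp, nonpos_iff_eq_zero, ENNReal.ofReal_eq_zero,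
          not_le] at hs
        exact ⟨⟨hs.1.1, hs.1.2.trans ht.2⟩, hs.2⟩
    _ = 0 := by simp

/-! ### The coordinatewise regulator of paths in `ℝ^d`. -/

variable {d : ℕ}

/-- The coordinatewise regulator of a path in `ℝ^d`. -/
noncomputable def regulatorVec (z : ℝ → EuclideanSpace ℝ (Fin d)) (t : ℝ) :
    EuclideanSpace ℝ (Fin d) :=
  WithLp.toLp 2 fun i => regulator (fun s => z s i) t

lemma EuclideanSpace.abs_apply_le_norm (v : EuclideanSpace ℝ (Fin d)) (i : Fin d) :
    |v i| ≤ ‖v‖ := by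
  simpa using PiLp.norm_apply_le v i

lemma EuclideanSpace.norm_le_sum_abs (v : EuclideanSpace ℝ (Fin d)) : ‖v‖ ≤ ∑ i, |v i| := by
  have h : v = ∑ i, v i • EuclideanSpace.basisFun (Fin d) ℝ i := by
    simpa using ((EuclideanSpace.basisFun (Fin d) ℝ).sum_repr v).symm
  calc ‖v‖ = ‖∑ i, v i • EuclideanSpace.basisFun (Fin d) ℝ i‖ := by rw [← h]
    _ ≤ ∑ i, |v i| := norm_sum_le_of_le _ fun i _ => by
        rw [norm_smul, OrthonormalBasis.norm_eq_one, mul_one, Real.norm_eq_abs]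

lemma EuclideanSpace.norm_le_of_abs_apply_le {v : EuclideanSpace ℝ (Fin d)} {B : ℝ}
    (h : ∀ i, |v i| ≤ B) : ‖v‖ ≤ d * B :=
  (EuclideanSpace.norm_le_sum_abs v).trans
    ((Finset.sum_le_sum fun i _ => h i).trans_eq (by simp))

variable {ζ ζ' : ℝ → EuclideanSpace ℝ (Fin d)}

lemma ContinuousOn.euclidean_apply {s : Set ℝ} (hζ : ContinuousOn ζ s) (i : Fin d) :
    ContinuousOn (fun t => ζ t i) s :=
  (EuclideanSpace.proj (𝕜 := ℝ) i).continuous.comp_continuousOn hζ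

lemma norm_regulatorVec_sub_le (hζ : ContinuousOn ζ (Icc 0 T)) {s t B : ℝ} (hs : 0 ≤ s)
    (hst : s ≤ t) (ht : t ≤ T) (hB : ∀ u ∈ Icc s t, ‖ζ u - ζ s‖ ≤ B) :
    ‖regulatorVec ζ t - regulatorVec ζ s‖ ≤ d * B :=
  EuclideanSpace.norm_le_of_abs_apply_le fun i =>
    abs_regulator_sub_le (hζ.euclidean_apply i) hs hst ht fun u hu =>
      (EuclideanSpace.abs_apply_le_norm (ζ u - ζ s) i).trans (hB u hu)

lemma norm_regulatorVec_sub_regulatorVec_le (hζ : ContinuousOn ζ (Icc 0 T))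
    (hζ' : ContinuousOn ζ' (Icc 0 T)) {t B : ℝ} (ht : t ∈ Icc 0 T)
    (hB : ∀ u ∈ Icc 0 t, ‖ζ u - ζ' u‖ ≤ B) : ‖regulatorVec ζ t - regulatorVec ζ' t‖ ≤ d * B :=
  EuclideanSpace.norm_le_of_abs_apply_le fun i =>
    abs_regulator_sub_regulator_le (hζ.euclidean_apply i) (hζ'.euclidean_apply i) ht fun u hu =>
      (EuclideanSpace.abs_apply_le_norm (ζ u - ζ' u) i).trans (hB u hu)

lemma continuousOn_regulatorVec (hζ : ContinuousOn ζ (Icc 0 T)) :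
    ContinuousOn (regulatorVec ζ) (Icc 0 T) :=
  (PiLp.continuous_toLp 2 _).comp_continuousOn
    (continuousOn_pi.2 fun i => continuousOn_regulator (hζ.euclidean_apply i))

lemma isSkorokhodSolution_regulatorVec (hT : 0 ≤ T) (hζ : ContinuousOn ζ (Icc 0 T))
    (h0 : ∀ i, 0 ≤ ζ 0 i) {x : ℝ → EuclideanSpace ℝ (Fin d)}
    (hx : ∀ t ∈ Icc 0 T, x t = ζ t + regulatorVec ζ t) :
    IsSkorokhodSolution T ζ x (regulatorVec ζ) where
  continuousOn_z := hζ
  continuousOn_x := (hζ.add (continuousOn_regulatorVec hζ)).congr hx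
  continuousOn_y := continuousOn_regulatorVec hζ
  start_nonneg := h0
  eq_add := hx
  nonneg t ht i := by
    rw [hx t ht]
    exact add_regulator_nonneg (hζ.euclidean_apply i) ht
  regulator_zero i := by
    change regulator (fun s => ζ s i) 0 = 0
    rw [_root_.regulator_zero, negPart_eq_zero]
    exact h0 i
  regulator_mono i := _root_.regulator_mono (hζ.euclidean_apply i)
  complementary i := by
    obtain ⟨F, hF, hFint⟩ := exists_stieltjes_regulator hT (hζ.euclidean_apply i)
    refine ⟨F, hF, fun t ht => ?_⟩
    rw [← hFint t ht]
    refine setLIntegral_congr_fun measurableSet_Ioc fun s hs => ?_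
    have := hx s ⟨hs.1.le, hs.2.trans ht.2⟩
    simp only [this]
    rfl

end Regulator

/-! ### Linear interpolation and measurability in Hölder spaces -/

section Interpolation

variable {E : Type*} [NormedAddCommGroup E]

lemma continuousOn_of_holder {f : ℝ → E} {C γ T : ℝ} (hγ : 0 < γ)
    (hf : ∀ s t, 0 ≤ s → s ≤ t → t ≤ T → ‖f t - f s‖ ≤ C * (t - s) ^ γ) :
    ContinuousOn f (Icc 0 T) := by
  intro s hs
  rw [ContinuousWithinAt, tendsto_iff_norm_sub_tendsto_zero]
  have hlim : Filter.Tendsto (fun t : ℝ => C * |t - s| ^ γ) (nhdsWithin s (Icc 0 T)) (nhds 0) := by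
    have : Continuous fun t : ℝ => C * |t - s| ^ γ :=
      continuous_const.mul ((continuous_id.sub continuous_const).abs.rpow_const
        fun _ => Or.inr hγ.le)
    have h := this.tendsto s
    simp only [sub_self, abs_zero, Real.zero_rpow hγ.ne', mul_zero] at h
    exact h.mono_left nhdsWithin_le_nhds
  refine squeeze_zero' (Filter.Eventually.of_forall fun _ => norm_nonneg _) ?_ hlim
  filter_upwards [self_mem_nhdsWithin] with t ht
  rcases le_total s t with h | h
  · rw [abs_of_nonneg (by linarith)]; exact hf s t hs.1 h ht.2
  · rw [norm_sub_rev, abs_sub_comm, abs_of_nonneg (by linarith)]; exact hf t s ht.1 h hs.2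

lemma holderOnWith_of_norm_sub_le {F : Type*} [SeminormedAddCommGroup F] {f : ℝ → F} {C T : ℝ}
    {γ : ℝ≥0} (hf : ∀ s t, 0 ≤ s → s ≤ t → t ≤ T → ‖f t - f s‖ ≤ C * (t - s) ^ (γ : ℝ)) :
    HolderOnWith C.toNNReal γ f (Icc 0 T) := by
  have key : ∀ s ∈ Icc 0 T, ∀ t ∈ Icc 0 T, s ≤ t →
      edist (f s) (f t) ≤ C.toNNReal * edist s t ^ (γ : ℝ) := fun s hs t ht hst => by
    rw [edist_comm, edist_comm s t, edist_dist, edist_dist, dist_eq_norm, Real.dist_eq,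
      abs_of_nonneg (sub_nonneg.2 hst), ENNReal.ofReal_rpow_of_nonneg (sub_nonneg.2 hst) γ.coe_nonneg,
      ENNReal.ofNNReal_toNNReal, ← ENNReal.ofReal_mul' (Real.rpow_nonneg (sub_nonneg.2 hst) _)]
    exact ENNReal.ofReal_le_ofReal (hf s t hs.1 hst ht.2)
  intro s hs t ht
  rcases le_total s t with h | h
  · exact key s hs t ht h
  · rw [edist_comm, edist_comm s t]; exact key t ht s hs h

lemma holderWith_of_norm_sub_le {F : Type*} [SeminormedAddCommGroup F] {T : ℝ}
    {f : Icc (0 : ℝ) T → F} {C : ℝ} {γ : ℝ≥0}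
    (hf : ∀ s t : Icc (0 : ℝ) T, s ≤ t → ‖f t - f s‖ ≤ C * ((t : ℝ) - s) ^ (γ : ℝ)) :
    HolderWith C.toNNReal γ f := by
  rcases isEmpty_or_nonempty (Icc (0 : ℝ) T) with _ | ⟨⟨a, ha⟩⟩
  · exact HolderWith.of_isEmpty
  have hT : (0 : ℝ) ≤ T := ha.1.trans ha.2
  have := holderOnWith_of_norm_sub_le (f := IccExtend hT f) (C := C) (T := T) (γ := γ)
    fun s t hs hst ht => by
      rw [IccExtend_of_mem hT f ⟨hs.trans hst, ht⟩, IccExtend_of_mem hT f ⟨hs, hst.trans ht⟩]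
      exact hf _ _ hst
  intro s t
  have h := this s s.2 t t.2
  rw [IccExtend_val, IccExtend_val] at h
  exact h

namespace HolderSpace

lemma norm_def {r : ℝ≥0} {T : ℝ} (f : HolderSpace r T E) :
    ‖f‖ = ‖f.1‖ + (nnHolderNorm r (f : Icc (0 : ℝ) T → E) : ℝ) := rfl

lemma norm_le {r : ℝ≥0} {T A B : ℝ} (hA : 0 ≤ A) (hB : 0 ≤ B) (f : HolderSpace r T E)
    (hfA : ∀ t, ‖f t‖ ≤ A)
    (hfB : ∀ s t : Icc (0 : ℝ) T, s ≤ t → ‖f t - f s‖ ≤ B * ((t : ℝ) - s) ^ (r : ℝ)) :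
    ‖f‖ ≤ A + B := by
  rw [norm_def]
  refine add_le_add ((ContinuousMap.norm_le _ hA).2 hfA) ?_
  have h := (holderWith_of_norm_sub_le hfB).nnholderNorm_le
  calc (nnHolderNorm r (f : Icc (0 : ℝ) T → E) : ℝ) ≤ (B.toNNReal : ℝ) := by exact_mod_cast h
    _ = B := Real.coe_toNNReal B hB

end HolderSpace

/-- The clamped sequence `v 0, …, v N, v N, v N, …`. -/
def clampSeq {N : ℕ} (v : Fin (N + 1) → E) (k : ℕ) : E :=
  v ⟨min k N, Nat.lt_succ_of_le (min_le_right k N)⟩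

lemma clampSeq_holder {N : ℕ} {h C γ : ℝ} (hh : 0 < h) (hC : 0 ≤ C) (hγ : 0 ≤ γ) {v : ℕ → E}
    (hv : ∀ k l : ℕ, k ≤ l → l ≤ N → ‖v l - v k‖ ≤ C * (h * (l - k)) ^ γ) {k l : ℕ} (hkl : k ≤ l) :
    ‖clampSeq (fun i : Fin (N + 1) => v i) l - clampSeq (fun i : Fin (N + 1) => v i) k‖
      ≤ C * (h * (l - k)) ^ γ := by
  refine (hv (min k N) (min l N) (min_le_min_right N hkl) (min_le_right _ _)).trans ?_
  have h1 : min l N - min k N ≤ l - k := by omega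
  have h2 : ((min l N : ℕ) : ℝ) - (min k N : ℕ) ≤ l - k := by
    rw [← Nat.cast_sub (min_le_min_right N hkl), ← Nat.cast_sub hkl]; exact_mod_cast h1
  have h3 : (0 : ℝ) ≤ ((min l N : ℕ) : ℝ) - (min k N : ℕ) :=
    sub_nonneg.2 (by exact_mod_cast min_le_min_right N hkl)
  gcongr

/-- Distinct indices differ by at least one, so arbitrary grid values are Hölder with a
mesh-dependent constant. This places every interpolation in the Hölder space before any uniform
bound is available. -/
lemma clampSeq_bounded_holder {N : ℕ} {h γ : ℝ} (hh : 0 < h) (hγ : 0 < γ) (v : Fin (N + 1) → E)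
    {k l : ℕ} (hkl : k ≤ l) :
    ‖clampSeq v l - clampSeq v k‖ ≤ 2 * ‖v‖ / h ^ γ * (h * (l - k)) ^ γ := by
  rcases hkl.eq_or_lt with rfl | hlt
  · simp [Real.zero_rpow hγ.ne']
  have h1 : (1 : ℝ) ≤ (l : ℝ) - k := by
    rw [← Nat.cast_sub hkl]; exact_mod_cast (by omega : 1 ≤ l - k)
  have h2 : 1 ≤ ((l : ℝ) - k) ^ γ := Real.one_le_rpow h1 hγ.le
  rw [Real.mul_rpow hh.le (by linarith), ← mul_assoc, div_mul_cancel₀ _ (by positivity)]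
  calc ‖clampSeq v l - clampSeq v k‖ ≤ ‖v‖ + ‖v‖ :=
        (norm_sub_le _ _).trans (add_le_add (norm_le_pi_norm v _) (norm_le_pi_norm v _))
    _ = 2 * ‖v‖ * 1 := by ring
    _ ≤ _ := by gcongr

variable [NormedSpace ℝ E]

/-- Piecewise linear interpolation of the sequence `v` on the grid `{h * k}`. -/
noncomputable def gridInterp (h : ℝ) (v : ℕ → E) (t : ℝ) : E :=
  v ⌊t / h⌋₊ + (t / h - ⌊t / h⌋₊) • (v (⌊t / h⌋₊ + 1) - v ⌊t / h⌋₊)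

lemma gridInterp_grid {h : ℝ} (hh : 0 < h) (v : ℕ → E) (k : ℕ) : gridInterp h v (h * k) = v k := by
  have : h * k / h = k := by field_simp
  simp [gridInterp, this]

lemma gridInterp_sub (h : ℝ) (v v' : ℕ → E) (t : ℝ) :
    gridInterp h (v - v') t = gridInterp h v t - gridInterp h v' t := by
  simp only [gridInterp, Pi.sub_apply, smul_sub]; abel

lemma norm_gridInterp_le {h : ℝ} (hh : 0 < h) {v : ℕ → E} {A : ℝ} (hv : ∀ k, ‖v k‖ ≤ A) {t : ℝ}
    (ht : 0 ≤ t) : ‖gridInterp h v t‖ ≤ A := by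
  have h0 : 0 ≤ t / h := by positivity
  have h1 := Nat.floor_le h0
  have h2 := Nat.lt_floor_add_one (t / h)
  have he : gridInterp h v t = (1 - (t / h - ⌊t / h⌋₊)) • v ⌊t / h⌋₊
      + (t / h - ⌊t / h⌋₊) • v (⌊t / h⌋₊ + 1) := by
    rw [gridInterp, smul_sub, sub_smul (1 : ℝ), one_smul]; abel
  rw [he]
  refine (norm_add_le _ _).trans ?_
  rw [norm_smul, norm_smul, Real.norm_of_nonneg (by linarith), Real.norm_of_nonneg (by linarith)]
  nlinarith [hv ⌊t / h⌋₊, hv (⌊t / h⌋₊ + 1), norm_nonneg (v ⌊t / h⌋₊)]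

/-- Unless both times share a cell, the increment splits at the first grid point after `s` and the
last one before `t`. Each of the three pieces costs `C * (t - s) ^ γ`; on the partial cells this
uses `θ ≤ θ ^ γ` for `0 ≤ θ ≤ 1`. -/
lemma norm_gridInterp_sub_le {h C γ : ℝ} (hh : 0 < h) (hγ : 0 < γ) (hγ1 : γ ≤ 1) {v : ℕ → E}
    (hv : ∀ k l : ℕ, k ≤ l → ‖v l - v k‖ ≤ C * (h * (l - k)) ^ γ) {s t : ℝ} (hs : 0 ≤ s)
    (hst : s ≤ t) : ‖gridInterp h v t - gridInterp h v s‖ ≤ 3 * C * (t - s) ^ γ := by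
  have hhγ : 0 < h ^ γ := by positivity
  have hstep : ∀ k, ‖v (k + 1) - v k‖ ≤ C * h ^ γ := fun k => by
    have := hv k (k + 1) k.le_succ
    push_cast at this
    rwa [add_sub_cancel_left, mul_one] at this
  have hC : 0 ≤ C := by
    have := (norm_nonneg _).trans (hstep 0)
    exact nonneg_of_mul_nonneg_left this hhγ
  obtain ⟨a, ha⟩ : ∃ a, a = s / h := ⟨_, rfl⟩
  obtain ⟨b, hb⟩ : ∃ b, b = t / h := ⟨_, rfl⟩
  have ha0 : 0 ≤ a := by rw [ha]; positivity
  have hab : a ≤ b := by rw [ha, hb]; gcongr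
  have hts : t - s = h * (b - a) := by rw [ha, hb]; field_simp
  rw [hts, Real.mul_rpow hh.le (sub_nonneg.2 hab)]
  simp only [gridInterp, ← ha, ← hb]
  have ka := Nat.floor_le ha0
  have ka' := Nat.lt_floor_add_one a
  have kb := Nat.floor_le (ha0.trans hab)
  have kb' := Nat.lt_floor_add_one b
  have hkl : ⌊a⌋₊ ≤ ⌊b⌋₊ := Nat.floor_le_floor hab
  generalize ⌊a⌋₊ = k at *
  generalize ⌊b⌋₊ = l at *
  have hfrac : ∀ θ : ℝ, 0 ≤ θ → θ ≤ 1 → θ ≤ b - a → ∀ j, ‖θ • (v (j + 1) - v j)‖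
      ≤ C * (h ^ γ * (b - a) ^ γ) := fun θ h0 h1 h2 j => by
    rw [norm_smul, Real.norm_of_nonneg h0]
    calc θ * ‖v (j + 1) - v j‖ ≤ θ ^ γ * (C * h ^ γ) := by
          gcongr
          · exact Real.self_le_rpow_of_le_one h0 h1 hγ1
          · exact hstep j
      _ ≤ (b - a) ^ γ * (C * h ^ γ) := by gcongr
      _ = _ := by ring
  have hnn : 0 ≤ C * (h ^ γ * (b - a) ^ γ) := by
    have := Real.rpow_nonneg (sub_nonneg.2 hab) γ
    positivity
  rcases hkl.eq_or_lt with rfl | hlt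
  · have he : v k + (b - k) • (v (k + 1) - v k) - (v k + (a - k) • (v (k + 1) - v k))
        = (b - a) • (v (k + 1) - v k) := by
      rw [add_sub_add_left_eq_sub, ← sub_smul]; congr 1; ring
    rw [he]
    refine (hfrac (b - a) (by linarith) (by linarith) le_rfl k).trans ?_
    linarith
  · have hk1l : ((k : ℝ) + 1) ≤ l := by exact_mod_cast hlt
    have he : v l + (b - l) • (v (l + 1) - v l) - (v k + (a - k) • (v (k + 1) - v k))
        = (b - l) • (v (l + 1) - v l) + (v l - v (k + 1))
          + (1 - (a - k)) • (v (k + 1) - v k) := by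
      rw [sub_smul (1 : ℝ), one_smul]; abel
    have hmid : ‖v l - v (k + 1)‖ ≤ C * (h ^ γ * (b - a) ^ γ) := by
      refine (hv (k + 1) l hlt).trans ?_
      push_cast
      rw [Real.mul_rpow hh.le (by linarith)]
      have : (0 : ℝ) ≤ (l : ℝ) - (k + 1) := by linarith
      gcongr
    rw [he]
    refine (norm_add₃_le.trans (add_le_add (add_le_add
      (hfrac (b - l) (by linarith) (by linarith) (by linarith) l) hmid)
      (hfrac (1 - (a - k)) (by linarith) (by linarith) (by linarith) k))).trans_eq ?_
    ring

/-- The piecewise linear path through the grid values `v`, as an element of the Hölder space. -/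
noncomputable def gridHolder (r : ℝ≥0) (hr : 0 < r) (hr1 : r ≤ 1) (T h : ℝ) (hh : 0 < h) {N : ℕ}
    (v : Fin (N + 1) → E) : HolderSpace r T E :=
  have hw := holderWith_of_norm_sub_le (f := fun t : Icc (0 : ℝ) T => gridInterp h (clampSeq v) t)
    fun s _ hst => norm_gridInterp_sub_le hh (NNReal.coe_pos.2 hr) (by exact_mod_cast hr1)
      (fun _ _ hkl => clampSeq_bounded_holder hh (NNReal.coe_pos.2 hr) v hkl) s.2.1 hst
  ⟨⟨fun t => gridInterp h (clampSeq v) t, hw.continuous hr⟩, hw.memHolder⟩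

section GridHolder

variable {r : ℝ≥0} {hr : 0 < r} {hr1 : r ≤ 1} {T h : ℝ} {hh : 0 < h} {N : ℕ}

lemma gridHolder_sub (v v' : Fin (N + 1) → E) :
    gridHolder r hr hr1 T h hh v - gridHolder r hr hr1 T h hh v'
      = gridHolder r hr hr1 T h hh (v - v') :=
  Subtype.ext (ContinuousMap.ext fun t => (gridInterp_sub h (clampSeq v) (clampSeq v') t).symm)

lemma norm_gridHolder_le (v : Fin (N + 1) → E) :
    ‖gridHolder r hr hr1 T h hh v‖ ≤ (1 + 3 * (2 / h ^ (r : ℝ))) * ‖v‖ := by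
  refine (HolderSpace.norm_le (A := ‖v‖) (B := 3 * (2 * ‖v‖ / h ^ (r : ℝ))) (by positivity)
    (by positivity) _
    (fun t => norm_gridInterp_le (v := clampSeq v) hh (fun k => norm_le_pi_norm v _) t.2.1)
    (fun s t hst => norm_gridInterp_sub_le hh (NNReal.coe_pos.2 hr) (by exact_mod_cast hr1)
      (fun _ _ hkl => clampSeq_bounded_holder hh (NNReal.coe_pos.2 hr) v hkl) s.2.1 hst)).trans_eq ?_
  ring

/-- Interpolation is additive and bounded for a fixed mesh. It therefore transports strong
measurability from finitely many grid values to the Hölder space, which is in general not separable.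
-/
lemma continuous_gridHolder :
    Continuous fun v : Fin (N + 1) → E => gridHolder r hr hr1 T h hh v := by
  refine (LipschitzWith.of_dist_le_mul (K := (1 + 3 * (2 / h ^ (r : ℝ))).toNNReal)
    fun v v' => ?_).continuous
  rw [dist_eq_norm, dist_eq_norm, gridHolder_sub, Real.coe_toNNReal _ (by positivity)]
  exact norm_gridHolder_le _

end GridHolder

/-- The error `e` vanishes at grid points and is `γ`-Hölder with constant `3 * C + C`, so its
supremum is at most `4 * C * h ^ γ`. For the `r`-seminorm, increments over times at most `h` trade
`(t - s) ^ (γ - r)` for `h ^ (γ - r)`, and longer ones are bounded by twice the supremum. -/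
lemma HolderSpace.norm_sub_gridHolder_le {r : ℝ≥0} {hr : 0 < r} {hr1 : r ≤ 1} {T h : ℝ} {hh : 0 < h}
    {N : ℕ} (hN : h * N = T) {γ C : ℝ} (hrγ : r ≤ γ) (hγ1 : γ ≤ 1) (hC : 0 ≤ C)
    (f : HolderSpace r T E)
    (hf : ∀ s t : Icc (0 : ℝ) T, s ≤ t → ‖f t - f s‖ ≤ C * ((t : ℝ) - s) ^ γ) (hT : 0 ≤ T) :
    ‖gridHolder r hr hr1 T h hh (fun i : Fin (N + 1) => IccExtend hT f (h * i)) - f‖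
      ≤ 4 * C * h ^ γ + 8 * C * h ^ (γ - r) := by
  have hr' : (0 : ℝ) < r := NNReal.coe_pos.2 hr
  have hγ : 0 < γ := hr'.trans_le hrγ
  obtain ⟨g, hg⟩ : ∃ g : ℝ → E, g = IccExtend hT f := ⟨_, rfl⟩
  have hgf : ∀ t : Icc (0 : ℝ) T, g t = f t := fun t => by rw [hg, IccExtend_val]
  have hgH : ∀ s t : ℝ, 0 ≤ s → s ≤ t → t ≤ T → ‖g t - g s‖ ≤ C * (t - s) ^ γ :=
    fun s t hs hst ht => by
      have := hf ⟨s, hs, hst.trans ht⟩ ⟨t, hs.trans hst, ht⟩ hst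
      rwa [← hgf, ← hgf] at this
  rw [← hg]
  obtain ⟨v, hv⟩ : ∃ v : ℕ → E, v = clampSeq (fun i : Fin (N + 1) => g (h * i)) := ⟨_, rfl⟩
  have hgrid : ∀ k : ℕ, k ≤ N → v k = g (h * k) := fun k hk => by
    rw [hv]; simp [clampSeq, min_eq_left hk]
  have hvH : ∀ s t : ℝ, 0 ≤ s → s ≤ t →
      ‖gridInterp h v t - gridInterp h v s‖ ≤ 3 * C * (t - s) ^ γ := fun s t hs hst => by
    refine norm_gridInterp_sub_le hh hγ hγ1 (fun k l hkl => ?_) hs hst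
    rw [hv]
    refine clampSeq_holder (v := fun k => g (h * k)) hh hC hγ.le (fun k l hkl hl => ?_) hkl
    have h1 : (k : ℝ) ≤ l := by exact_mod_cast hkl
    have h2 : (l : ℝ) ≤ N := by exact_mod_cast hl
    refine (hgH (h * k) (h * l) (by positivity) (by gcongr) (by rw [← hN]; gcongr)).trans_eq ?_
    rw [← mul_sub]
  obtain ⟨e, he⟩ : ∃ e : ℝ → E, e = fun t => gridInterp h v t - g t := ⟨_, rfl⟩
  have heH : ∀ s t : ℝ, 0 ≤ s → s ≤ t → t ≤ T → ‖e t - e s‖ ≤ 4 * C * (t - s) ^ γ :=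
    fun s t hs hst ht => by
      rw [he]
      calc ‖gridInterp h v t - g t - (gridInterp h v s - g s)‖
          = ‖(gridInterp h v t - gridInterp h v s) - (g t - g s)‖ := by congr 1; abel
        _ ≤ 3 * C * (t - s) ^ γ + C * (t - s) ^ γ :=
          (norm_sub_le _ _).trans (add_le_add (hvH s t hs hst) (hgH s t hs hst ht))
        _ = _ := by ring
  have heA : ∀ t : ℝ, 0 ≤ t → t ≤ T → ‖e t‖ ≤ 4 * C * h ^ γ := fun t ht0 htT => by
    have h0 : 0 ≤ t / h := by positivity
    have h1 := Nat.floor_le h0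
    have h2 := Nat.lt_floor_add_one (t / h)
    have h3 : ⌊t / h⌋₊ ≤ N := by
      have : (⌊t / h⌋₊ : ℝ) ≤ N := h1.trans (by rw [div_le_iff₀ hh, mul_comm, hN]; exact htT)
      exact_mod_cast this
    generalize ⌊t / h⌋₊ = k at *
    rw [le_div_iff₀ hh, mul_comm] at h1
    rw [div_lt_iff₀ hh] at h2
    have hz : e (h * k) = 0 := by
      rw [he]; simp only [gridInterp_grid hh, hgrid k h3, sub_self]
    have := heH (h * k) t (by positivity) h1 htT
    rw [hz, sub_zero] at this
    refine this.trans ?_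
    have : 0 ≤ t - h * k := by linarith
    gcongr
    linarith
  refine HolderSpace.norm_le (by positivity) (by positivity) _ (fun t => ?_) fun s t hst => ?_
  · have := heA t t.2.1 t.2.2
    rw [he] at this
    simp only [hgf] at this
    rw [hv] at this
    exact this
  · have h0 : (0 : ℝ) ≤ (t : ℝ) - s := sub_nonneg.2 hst
    have key : ‖e t - e s‖ ≤ 8 * C * h ^ (γ - r) * ((t : ℝ) - s) ^ (r : ℝ) := by
      rcases le_total ((t : ℝ) - s) h with hle | hle
      · refine (heH s t s.2.1 hst t.2.2).trans ?_
        have : ((t : ℝ) - s) ^ γ ≤ h ^ (γ - r) * ((t : ℝ) - s) ^ (r : ℝ) := by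
          calc ((t : ℝ) - s) ^ γ = ((t : ℝ) - s) ^ (γ - r) * ((t : ℝ) - s) ^ (r : ℝ) := by
                rw [← Real.rpow_add_of_nonneg h0 (by linarith) hr'.le]; congr 1; ring
            _ ≤ _ := by gcongr
        calc 4 * C * ((t : ℝ) - s) ^ γ ≤ 4 * C * (h ^ (γ - r) * ((t : ℝ) - s) ^ (r : ℝ)) := by
              gcongr
          _ ≤ 8 * C * (h ^ (γ - r) * ((t : ℝ) - s) ^ (r : ℝ)) := by gcongr; norm_num
          _ = _ := by ring
      · have : h ^ γ ≤ h ^ (γ - r) * ((t : ℝ) - s) ^ (r : ℝ) := by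
          calc h ^ γ = h ^ (γ - r) * h ^ (r : ℝ) := by
                rw [← Real.rpow_add_of_nonneg hh.le (by linarith) hr'.le]; congr 1; ring
            _ ≤ _ := by gcongr
        calc ‖e t - e s‖ ≤ 4 * C * h ^ γ + 4 * C * h ^ γ :=
              (norm_sub_le _ _).trans (add_le_add (heA t t.2.1 t.2.2) (heA s s.2.1 s.2.2))
          _ = 8 * C * h ^ γ := by ring
          _ ≤ 8 * C * (h ^ (γ - r) * ((t : ℝ) - s) ^ (r : ℝ)) := by gcongr
          _ = _ := by ring
    rw [he] at key
    simp only [hgf] at key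
    rw [hv] at key
    exact key

/-- A random element of `C^r` with measurable marginals and paths of higher Hölder regularity is
strongly measurable. -/
theorem HolderSpace.aestronglyMeasurable_of_holder [MeasurableSpace E] [BorelSpace E]
    [SecondCountableTopology E] {Ω : Type*} [MeasurableSpace Ω] {P : Measure Ω}
    {r : ℝ≥0} (hr : 0 < r) {T γ : ℝ} (hT : 0 < T) (hrγ : r < γ) (hγ1 : γ ≤ 1)
    {X : Ω → HolderSpace r T E} (hX : ∀ t, AEMeasurable (fun ω => X ω t) P)
    (hXγ : ∀ᵐ ω ∂P, ∃ C : ℝ, 0 ≤ C ∧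
      ∀ s t : Icc (0 : ℝ) T, s ≤ t → ‖X ω t - X ω s‖ ≤ C * ((t : ℝ) - s) ^ γ) :
    AEStronglyMeasurable X P := by
  have hr1 : r ≤ 1 := by exact_mod_cast (hrγ.le.trans hγ1)
  have hh : ∀ N : ℕ, 0 < T / (N + 1) := fun N => by positivity
  refine aestronglyMeasurable_of_tendsto_ae Filter.atTop
    (f := fun (N : ℕ) ω => gridHolder r hr hr1 T (T / (N + 1)) (hh N)
      (fun i : Fin (N + 1 + 1) => IccExtend hT.le (X ω) (T / (N + 1) * i))) (fun N => ?_) ?_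
  · exact continuous_gridHolder.comp_aestronglyMeasurable
      (aemeasurable_pi_iff.2 fun i => hX _).aestronglyMeasurable
  · filter_upwards [hXγ] with ω ⟨C, hC, hH⟩
    rw [tendsto_iff_norm_sub_tendsto_zero]
    have hlim0 : Filter.Tendsto (fun N : ℕ => T / ((N : ℝ) + 1)) Filter.atTop (nhds 0) :=
by
      simpa [div_eq_mul_inv] using tendsto_one_div_add_atTop_nhds_zero_nat (𝕜 := ℝ).const_mul T
    have hpow : ∀ p : ℝ, 0 < p →
        Filter.Tendsto (fun N : ℕ => (T / ((N : ℝ) + 1)) ^ p) Filter.atTop (nhds 0) :=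
      fun p hp => by
        have := hlim0.rpow_const (p := p) (Or.inr hp.le)
        rwa [Real.zero_rpow hp.ne'] at this
    have hlim : Filter.Tendsto (fun N : ℕ => 4 * C * (T / ((N : ℝ) + 1)) ^ γ
        + 8 * C * (T / ((N : ℝ) + 1)) ^ (γ - r)) Filter.atTop (nhds 0) := by
      have := ((hpow γ (r.2.trans_lt hrγ)).const_mul (4 * C)).add
        ((hpow (γ - r) (sub_pos.2 hrγ)).const_mul (8 * C))
      simpa using this
    refine squeeze_zero (fun _ => norm_nonneg _) (fun N => ?_) hlim
    refine HolderSpace.norm_sub_gridHolder_le ?_ hrγ.le hγ1 hC (X ω) hH hT.le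
    push_cast
    field_simp

end Interpolation

/-! ### Measurable selection of cluster points -/

section ClusterPoint

open Filter Topology

variable {Ω S : Type*} [MeasurableSpace Ω]

lemma measurableSet_frequently_atTop {p : ℕ → Ω → Prop} (hp : ∀ n, MeasurableSet {ω | p n ω}) :
    MeasurableSet {ω | ∃ᶠ n in atTop, p n ω} := by
  have h : {ω | ∃ᶠ n in atTop, p n ω} = ⋂ a : ℕ, ⋃ b : ℕ, ⋃ _ : a ≤ b, {ω | p b ω} := by
    ext ω
    simp only [mem_ofPred_eq, frequently_atTop, mem_iInter, mem_iUnion, exists_prop]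
  rw [h]
  exact MeasurableSet.iInter fun a => MeasurableSet.iUnion fun b => MeasurableSet.iUnion fun _ => hp b

lemma measurable_nat_sInf {s : Ω → Set ℕ} (hs : ∀ i, MeasurableSet {ω | i ∈ s ω}) :
    Measurable fun ω => sInf (s ω) := by
  refine measurable_to_countable' fun i => ?_
  -- The second set accounts for the convention `sInf ∅ = 0`.
  have h : (fun ω => sInf (s ω)) ⁻¹' {i} =
      ({ω | i ∈ s ω} ∩ ⋂ j : ℕ, ⋂ _ : j < i, {ω | j ∈ s ω}ᶜ) ∪
      ({_ω | i = 0} ∩ ⋂ j : ℕ, {ω | j ∈ s ω}ᶜ) := by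
    ext ω
    simp only [mem_preimage, mem_singleton_iff, mem_union, mem_inter_iff, mem_iInter, mem_compl_iff,
      mem_ofPred_eq]
    constructor
    · intro h
      rcases (s ω).eq_empty_or_nonempty with he | hne
      · right; rw [he, Nat.sInf_empty] at h; exact ⟨h.symm, fun j => by simp [he]⟩
      · left
        exact ⟨h ▸ Nat.sInf_mem hne, fun j hj => Nat.notMem_of_lt_sInf (h ▸ hj)⟩
    · rintro (⟨h1, h2⟩ | ⟨rfl, h2⟩)
      · exact le_antisymm (Nat.sInf_le h1)
          (not_lt.1 fun hlt => h2 _ hlt (Nat.sInf_mem ⟨i, h1⟩))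
      · rw [eq_empty_of_forall_notMem h2, Nat.sInf_empty]
  rw [h]
  exact ((hs i).inter (MeasurableSet.iInter fun j => MeasurableSet.iInter fun _ => (hs j).compl)).union
    ((MeasurableSet.const _).inter (MeasurableSet.iInter fun j => (hs j).compl))

variable [MetricSpace S] [SecondCountableTopology S] [Nonempty S]

/-- The times at which the sequence `u` visits the first `k` balls that it visits infinitely
often; the `k`-th ball has radius `2⁻ᵏ` and the smallest possible index of a centre among a dense
sequence. -/
noncomputable def visitTimes (u : ℕ → S) : ℕ → Set ℕ
  | 0 => univ
  | k + 1 => {n | n ∈ visitTimes u k ∧ dist (u n) (TopologicalSpace.denseSeq S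
      (sInf {i | ∃ᶠ n in atTop, n ∈ visitTimes u k ∧
        dist (u n) (TopologicalSpace.denseSeq S i) < (1 / 2) ^ k})) < (1 / 2) ^ k}

/-- The index of the `k`-th ball in `visitTimes`. -/
noncomputable def visitIndex (u : ℕ → S) (k : ℕ) : ℕ :=
  sInf {i | ∃ᶠ n in atTop, n ∈ visitTimes u k ∧
    dist (u n) (TopologicalSpace.denseSeq S i) < (1 / 2) ^ k}

lemma mem_visitTimes_succ {u : ℕ → S} {k n : ℕ} : n ∈ visitTimes u (k + 1) ↔
    n ∈ visitTimes u k ∧ dist (u n) (TopologicalSpace.denseSeq S (visitIndex u k)) < (1 / 2) ^ k :=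
  Iff.rfl

/-- Along the infinitely many times already retained, compactness provides a cluster point, and some
member of the dense sequence lies within `(1 / 2) ^ k` of it. The set of admissible indices is thus
nonempty and contains its infimum. -/
lemma frequently_mem_visitTimes {u : ℕ → S} {K : Set S} (hK : IsCompact K)
    (hu : ∀ᶠ n in atTop, u n ∈ K) (k : ℕ) : ∃ᶠ n in atTop, n ∈ visitTimes u k := by
  induction k with
  | zero => exact Frequently.of_forall fun _ => mem_univ _
  | succ k ih =>
    have hne : {i | ∃ᶠ n in atTop, n ∈ visitTimes u k ∧
        dist (u n) (TopologicalSpace.denseSeq S i) < (1 / 2) ^ k}.Nonempty := by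
      have : (atTop ⊓ 𝓟 (visitTimes u k)).NeBot := frequently_mem_iff_neBot.1 ih
      have hle : map u (atTop ⊓ 𝓟 (visitTimes u k)) ≤ 𝓟 K :=
        le_principal_iff.2 (mem_map.2 (mem_inf_of_left hu))
      obtain ⟨x, -, hx⟩ := hK hle
      obtain ⟨i, hi⟩ := (TopologicalSpace.denseRange_denseSeq S).exists_dist_lt x
        (show (0 : ℝ) < (1 / 2) ^ k by positivity)
      refine ⟨i, ?_⟩
      have hfr : ∃ᶠ n in atTop ⊓ 𝓟 (visitTimes u k),
          dist (u n) (TopologicalSpace.denseSeq S i) < (1 / 2) ^ k :=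
        (show MapClusterPt x _ u from hx).frequently
          ((isOpen_lt (continuous_id.dist continuous_const) continuous_const).mem_nhds hi)
      rw [frequently_inf_principal] at hfr
      exact hfr
    exact Nat.sInf_mem hne

lemma exists_tendsto_visitIndex [CompleteSpace S] {u : ℕ → S} {K : Set S} (hK : IsCompact K)
    (hu : ∀ᶠ n in atTop, u n ∈ K) :
    ∃ x, Tendsto (fun k => TopologicalSpace.denseSeq S (visitIndex u k)) atTop (𝓝 x) ∧
      MapClusterPt x atTop u := by
  have hcau : CauchySeq fun k => TopologicalSpace.denseSeq S (visitIndex u k) := by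
    refine cauchySeq_of_le_geometric (1 / 2) 2 (by norm_num) fun k => ?_
    -- A time in the family of level `k + 2` visits both ball `k` and ball `k + 1`, so their centres
    -- are within `(1 / 2) ^ k + (1 / 2) ^ (k + 1)` of each other.
    obtain ⟨n, hn⟩ := (frequently_mem_visitTimes hK hu (k + 2)).exists
    rw [mem_visitTimes_succ, mem_visitTimes_succ] at hn
    have h1 := hn.1.2
    have h2 := hn.2
    rw [pow_succ] at h2
    have h3 := dist_triangle_left (TopologicalSpace.denseSeq S (visitIndex u k))
      (TopologicalSpace.denseSeq S (visitIndex u (k + 1))) (u n)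
    have h4 : (0 : ℝ) < (1 / 2) ^ k := by positivity
    linarith
  obtain ⟨x, hx⟩ := cauchySeq_tendsto_of_complete hcau
  refine ⟨x, hx, ?_⟩
  rw [Metric.nhds_basis_ball.mapClusterPt_iff_frequently]
  intro ε hε
  have e1 : ∀ᶠ k in atTop, dist (TopologicalSpace.denseSeq S (visitIndex u k)) x < ε / 2 :=
    Metric.tendsto_nhds.1 hx _ (half_pos hε)
  have e2 : ∀ᶠ k : ℕ in atTop, (1 / 2 : ℝ) ^ k < ε / 2 :=
    (tendsto_pow_atTop_nhds_zero_of_lt_one (by norm_num) (by norm_num)).eventually_lt_const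
      (half_pos hε)
  obtain ⟨k, hk1, hk2⟩ := (e1.and e2).exists
  refine (frequently_mem_visitTimes hK hu (k + 1)).mono fun n hn => ?_
  have h1 := (mem_visitTimes_succ.1 hn).2
  have h2 := dist_triangle (u n) (TopologicalSpace.denseSeq S (visitIndex u k)) x
  rw [Metric.mem_ball]
  linarith

variable [MeasurableSpace S] [BorelSpace S]

/-- Visit times determine the next index and that index determines the next visit times, so
measurability propagates by induction. Indices are natural numbers, hence composing with the dense
sequence is harmless. -/
lemma measurable_visitIndex {f : ℕ → Ω → S} (hf : ∀ n, Measurable (f n)) (k : ℕ) :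
    (∀ n, MeasurableSet {ω | n ∈ visitTimes (fun n => f n ω) k}) ∧
      Measurable fun ω => visitIndex (fun n => f n ω) k := by
  have key : ∀ k, (∀ n, MeasurableSet {ω | n ∈ visitTimes (fun n => f n ω) k}) →
      Measurable fun ω => visitIndex (fun n => f n ω) k := fun k hk =>
    measurable_nat_sInf fun i => measurableSet_frequently_atTop fun n =>
      (hk n).inter (measurableSet_lt ((hf n).dist measurable_const) measurable_const)
  have hA : ∀ n, MeasurableSet {ω | n ∈ visitTimes (fun n => f n ω) k} := by
    induction k with
    | zero => exact fun n => MeasurableSet.univ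
    | succ k ih =>
      exact fun n => (ih n).inter (measurableSet_lt
        ((hf n).dist ((measurable_from_top (f := TopologicalSpace.denseSeq S)).comp (key k ih)))
        measurable_const)
  exact ⟨hA, key k hA⟩

/-- A sequence of random variables which is almost surely eventually in a compact set has a
measurable cluster point. -/
theorem exists_aemeasurable_mapClusterPt [CompleteSpace S] {P : Measure Ω} {f : ℕ → Ω → S}
    (hf : ∀ n, AEMeasurable (f n) P)
    (hK : ∀ᵐ ω ∂P, ∃ K, IsCompact K ∧ ∀ᶠ n in atTop, f n ω ∈ K) :
    ∃ g : Ω → S, AEMeasurable g P ∧ ∀ᵐ ω ∂P, MapClusterPt (g ω) atTop fun n => f n ω := by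
  have hlim : ∀ᵐ ω ∂P, ∃ x, Tendsto (fun k => TopologicalSpace.denseSeq S
      (visitIndex (fun n => f n ω) k)) atTop (𝓝 x) ∧ MapClusterPt x atTop fun n => f n ω := by
    filter_upwards [hK] with ω ⟨K, hK, hu⟩
    exact exists_tendsto_visitIndex hK hu
  have hmeas : ∀ k, AEMeasurable (fun ω => TopologicalSpace.denseSeq S
      (visitIndex (fun n => f n ω) k)) P := fun k => by
    -- Countably many measurable modifications agree with the original sequence simultaneously
    -- almost surely, and the index depends only on the sequence.
    refine ⟨fun ω => TopologicalSpace.denseSeq S (visitIndex (fun n => (hf n).mk (f n) ω) k),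
      measurable_from_top.comp (measurable_visitIndex (fun n => (hf n).measurable_mk) k).2, ?_⟩
    filter_upwards [ae_all_iff.2 fun n => (hf n).ae_eq_mk] with ω hω
    simp only [hω]
  obtain ⟨g, hg, hgl⟩ := measurable_limit_of_tendsto_metrizable_ae hmeas
    (hlim.mono fun ω ⟨x, hx, _⟩ => ⟨x, hx⟩)
  refine ⟨g, hg.aemeasurable, ?_⟩
  filter_upwards [hlim, hgl] with ω ⟨x, hx, hcl⟩ hgω
  rwa [tendsto_nhds_unique hgω hx]

end ClusterPoint

/-! ### Hölder regularity of fractional Brownian motion -/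

section FractionalBrownianMotion

/-- The dyadic approximations of `t` from below at levels `n` and `n + 1` are equal or adjacent at
level `n + 1`. Their images thus form a sequence with geometrically decaying steps, and its limit is
`u t` by continuity. -/
lemma abs_sub_dyadic_le {u : ℝ → ℝ} (hu : ContinuousOn u (Icc 0 1)) {A a : ℝ} (hA : 0 ≤ A)
    (ha0 : 0 < a) (ha1 : a < 1)
    (hinc : ∀ n k : ℕ, k < 2 ^ n →
      |u (((k + 1 : ℕ) : ℝ) / 2 ^ n) - u ((k : ℝ) / 2 ^ n)| ≤ A * a ^ n)
    {t : ℝ} (ht : t ∈ Icc (0 : ℝ) 1) (n : ℕ) :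
    |u ((⌊t * 2 ^ n⌋₊ : ℝ) / 2 ^ n) - u t| ≤ A * a ^ n / (1 - a) := by
  have hfl : ∀ n : ℕ, (⌊t * 2 ^ n⌋₊ : ℝ) ≤ t * 2 ^ n := fun n =>
    Nat.floor_le (mul_nonneg ht.1 (by positivity))
  have hfl' : ∀ n : ℕ, t * 2 ^ n < ⌊t * 2 ^ n⌋₊ + 1 := fun n => Nat.lt_floor_add_one _
  have hmem : ∀ n : ℕ, (⌊t * 2 ^ n⌋₊ : ℝ) / 2 ^ n ∈ Icc (0 : ℝ) 1 := fun n => by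
    refine ⟨by positivity, ?_⟩
    rw [div_le_one (by positivity)]
    refine (hfl n).trans (mul_le_of_le_one_left (by positivity) ht.2)
  have hlim : Filter.Tendsto (fun n : ℕ => (⌊t * 2 ^ n⌋₊ : ℝ) / 2 ^ n) Filter.atTop (nhds t) := by
    rw [tendsto_iff_dist_tendsto_zero]
    refine squeeze_zero (fun _ => dist_nonneg) (fun n => ?_)
      (tendsto_pow_atTop_nhds_zero_of_lt_one (r := (1 / 2 : ℝ)) (by norm_num) (by norm_num))
    have h2 : (0 : ℝ) < 2 ^ n := by positivity
    rw [Real.dist_eq, abs_sub_comm, abs_of_nonneg (by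
      rw [sub_nonneg, div_le_iff₀ h2]; exact hfl n), sub_le_iff_le_add, one_div, inv_pow,
      ← one_div, ← add_div, le_div_iff₀ h2]
    linarith [hfl' n]
  have hulim : Filter.Tendsto (fun n : ℕ => u ((⌊t * 2 ^ n⌋₊ : ℝ) / 2 ^ n)) Filter.atTop
      (nhds (u t)) :=
    (hu t ht).tendsto.comp (tendsto_nhdsWithin_iff.2 ⟨hlim, Filter.Eventually.of_forall hmem⟩)
  refine dist_le_of_le_geometric_of_tendsto a A ha1 (fun n => ?_) hulim n
  have h2n : ((2 : ℝ) ^ (n + 1)) = 2 * 2 ^ n := by ring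
  have hcases : ⌊t * 2 ^ (n + 1)⌋₊ = 2 * ⌊t * 2 ^ n⌋₊ ∨
      ⌊t * 2 ^ (n + 1)⌋₊ = 2 * ⌊t * 2 ^ n⌋₊ + 1 := by
    have a1 := hfl n
    have a2 := hfl' n
    have a3 := hfl (n + 1)
    have a4 := hfl' (n + 1)
    rw [h2n] at a3 a4 ⊢
    have b1 : ((2 * ⌊t * 2 ^ n⌋₊ : ℕ) : ℝ) < (⌊t * (2 * 2 ^ n)⌋₊ + 1 : ℕ) := by push_cast; linarith
    have b2 : ((⌊t * (2 * 2 ^ n)⌋₊ : ℕ) : ℝ) < (2 * ⌊t * 2 ^ n⌋₊ + 2 : ℕ) := by push_cast; linarith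
    have b1 := Nat.cast_lt.1 b1
    have b2 := Nat.cast_lt.1 b2
    omega
  have hpt : (⌊t * 2 ^ n⌋₊ : ℝ) / 2 ^ n = ((2 * ⌊t * 2 ^ n⌋₊ : ℕ) : ℝ) / 2 ^ (n + 1) := by
    push_cast; field_simp; ring
  have hmono : A * a ^ (n + 1) ≤ A * a ^ n := by
    gcongr ?_ * ?_
    exact pow_le_pow_of_le_one ha0.le ha1.le n.le_succ
  rw [Real.dist_eq, abs_sub_comm, hpt]
  rcases hcases with h | h
  · rw [h]; simp; positivity
  · rw [h]
    refine (hinc (n + 1) _ ?_).trans hmono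
    have := (hmem (n + 1)).2
    rw [div_le_one (by positivity), h] at this
    have : 2 * ⌊t * 2 ^ n⌋₊ + 1 ≤ 2 ^ (n + 1) := by exact_mod_cast this
    omega

/-- Dyadic chaining. -/
lemma exists_holder_of_dyadic {u : ℝ → ℝ} (hu : ContinuousOn u (Icc 0 1)) {A γ : ℝ} (hA : 0 ≤ A)
    (hγ : 0 < γ)
    (hinc : ∀ n k : ℕ, k < 2 ^ n →
      |u (((k + 1 : ℕ) : ℝ) / 2 ^ n) - u ((k : ℝ) / 2 ^ n)| ≤ A * ((1 / 2 : ℝ) ^ γ) ^ n) :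
    ∃ C : ℝ, 0 ≤ C ∧ ∀ s t : ℝ, 0 ≤ s → s ≤ t → t ≤ 1 → |u t - u s| ≤ C * (t - s) ^ γ := by
  obtain ⟨a, ha⟩ : ∃ a : ℝ, a = (1 / 2 : ℝ) ^ γ := ⟨_, rfl⟩
  rw [← ha] at hinc
  have ha0 : 0 < a := by rw [ha]; positivity
  have ha1 : a < 1 := by rw [ha]; exact Real.rpow_lt_one (by norm_num) (by norm_num) hγ
  have h1a : 0 < 1 - a := sub_pos.2 ha1
  refine ⟨(A + 2 * (A / (1 - a))) / a, by positivity, fun s t hs hst ht => ?_⟩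
  rcases hst.eq_or_lt with rfl | hlt
  · simp [Real.zero_rpow hγ.ne']
  -- With `(1 / 2) ^ (n + 1) < t - s ≤ (1 / 2) ^ n`, the level-`n` approximations of `s` and `t` are
  -- equal or adjacent. The mismatch between `n` and `n + 1` accounts for the division by `a` in the
  -- constant.
  obtain ⟨n, hn1, hn2⟩ := exists_nat_pow_near_of_lt_one (sub_pos.2 hlt) (by linarith : t - s ≤ 1)
    (by norm_num : (0 : ℝ) < 1 / 2) (by norm_num)
  have hs' : s ∈ Icc (0 : ℝ) 1 := ⟨hs, by linarith⟩
  have ht' : t ∈ Icc (0 : ℝ) 1 := ⟨by linarith, ht⟩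
  have h1 := abs_sub_dyadic_le hu hA ha0 ha1 hinc hs' n
  have h2 := abs_sub_dyadic_le hu hA ha0 ha1 hinc ht' n
  have h3 : |u ((⌊t * 2 ^ n⌋₊ : ℝ) / 2 ^ n) - u ((⌊s * 2 ^ n⌋₊ : ℝ) / 2 ^ n)| ≤ A * a ^ n := by
    have c1 := Nat.floor_le (mul_nonneg ht'.1 (by positivity : (0 : ℝ) ≤ 2 ^ n))
    have c2 := Nat.lt_floor_add_one (s * 2 ^ n)
    have c3 : (t - s) * 2 ^ n ≤ 1 := by
      rw [one_div, inv_pow] at hn2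
      calc (t - s) * 2 ^ n ≤ (2 ^ n)⁻¹ * 2 ^ n := by gcongr
        _ = 1 := inv_mul_cancel₀ (by positivity)
    have c4 : ⌊s * 2 ^ n⌋₊ ≤ ⌊t * 2 ^ n⌋₊ := Nat.floor_le_floor (by gcongr)
    have c5 : ((⌊t * 2 ^ n⌋₊ : ℕ) : ℝ) < (⌊s * 2 ^ n⌋₊ + 2 : ℕ) := by push_cast; linarith
    have c5 := Nat.cast_lt.1 c5
    rcases (by omega : ⌊t * 2 ^ n⌋₊ = ⌊s * 2 ^ n⌋₊ ∨ ⌊t * 2 ^ n⌋₊ = ⌊s * 2 ^ n⌋₊ + 1) with h | h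
    · rw [h]; simp; positivity
    · rw [h]
      refine hinc n _ ?_
      have c6 : ((⌊s * 2 ^ n⌋₊ + 1 : ℕ) : ℝ) ≤ (2 ^ n : ℕ) := by
        rw [← h]; push_cast
        exact c1.trans (mul_le_of_le_one_left (by positivity) ht)
      have c6 := Nat.cast_le.1 c6
      omega
  have h4 : a ^ n ≤ (t - s) ^ γ / a := by
    rw [le_div_iff₀ ha0, ← pow_succ, ha, ← Real.rpow_natCast, ← Real.rpow_mul (by norm_num),
      mul_comm γ, Real.rpow_mul (by norm_num), Real.rpow_natCast]
    gcongr
  calc |u t - u s| = |-(u ((⌊t * 2 ^ n⌋₊ : ℝ) / 2 ^ n) - u t)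
        + (u ((⌊t * 2 ^ n⌋₊ : ℝ) / 2 ^ n) - u ((⌊s * 2 ^ n⌋₊ : ℝ) / 2 ^ n))
        + (u ((⌊s * 2 ^ n⌋₊ : ℝ) / 2 ^ n) - u s)| := by congr 1; ring
    _ ≤ A * a ^ n / (1 - a) + A * a ^ n + A * a ^ n / (1 - a) := by
        refine (abs_add_three _ _ _).trans (add_le_add (add_le_add ?_ h3) h1)
        rwa [abs_neg]
    _ = (A + 2 * (A / (1 - a))) * a ^ n := by ring
    _ ≤ (A + 2 * (A / (1 - a))) * ((t - s) ^ γ / a) := by gcongr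
    _ = _ := by ring

/-! ### Moments of Gaussian increments and path regularity. -/

variable {Ω : Type*} [MeasurableSpace Ω] {P : Measure Ω}

lemma ProbabilityTheory.HasGaussianLaw.lintegral_enorm_rpow {Y : Ω → ℝ} (hY : HasGaussianLaw Y P)
    (h0 : ∫ ω, Y ω ∂P = 0) {c : ℝ} (hc : 0 ≤ c) (hv : Var[Y; P] = c ^ 2) {p : ℝ} (hp : 0 ≤ p) :
    ∫⁻ ω, ‖Y ω‖ₑ ^ p ∂P
      = ENNReal.ofReal (c ^ p) * ∫⁻ x : ℝ, ‖x‖ₑ ^ p ∂(gaussianReal 0 1) := by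
  have hmap : P.map Y = (gaussianReal 0 1).map (c * ·) := by
    rw [hY.map_eq_gaussianReal, gaussianReal_map_const_mul]
    congr 1
    · simpa using h0
    · rw [hv]; ext; simp; positivity
  have hm : Measurable fun x : ℝ => ‖x‖ₑ ^ p := by fun_prop
  rw [← lintegral_map' (f := fun x : ℝ => ‖x‖ₑ ^ p) hm.aemeasurable hY.aemeasurable, hmap,
    lintegral_map hm (measurable_const_mul c), ← lintegral_const_mul _ hm]
  refine lintegral_congr fun x => ?_
  rw [enorm_mul, ENNReal.mul_rpow_of_nonneg _ _ hp, Real.enorm_of_nonneg hc,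
    ENNReal.ofReal_rpow_of_nonneg hc hp]

lemma lintegral_enorm_rpow_gaussianReal_lt_top {p : ℝ} (hp : 0 < p) :
    ∫⁻ x : ℝ, ‖x‖ₑ ^ p ∂(gaussianReal 0 1) < ∞ := by
  have h := memLp_id_gaussianReal' (μ := 0) (v := 1) (ENNReal.ofReal p) ENNReal.ofReal_ne_top
  have := lintegral_rpow_enorm_lt_top_of_eLpNorm_lt_top (by simpa using hp) ENNReal.ofReal_ne_top
    h.2
  simpa [ENNReal.toReal_ofReal hp.le] using this

variable {H : ℝ} {B : ℝ≥0 → Ω → ℝ}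

/-- The covariance formula makes the increment centred Gaussian with variance `|t - s| ^ (2 * H)`,
that is, a standard Gaussian scaled by `|t - s| ^ H`. -/
lemma IsFractionalBrownianMotion.lintegral_enorm_sub_rpow (hB : IsFractionalBrownianMotion H B P)
    (hH : 0 < H) (s t : ℝ≥0) {p : ℝ} (hp : 0 ≤ p) :
    ∫⁻ ω, ‖B t ω - B s ω‖ₑ ^ p ∂P
      = ENNReal.ofReal ((|(t : ℝ) - s| ^ H) ^ p) * ∫⁻ x : ℝ, ‖x‖ₑ ^ p ∂(gaussianReal 0 1) := by
  have := hB.gaussian.isProbabilityMeasure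
  have hs := hB.gaussian.hasGaussianLaw_eval s
  have ht := hB.gaussian.hasGaussianLaw_eval t
  have hvar : ∀ t, Var[B t; P] = (t : ℝ) ^ (2 * H) := fun t => by
    rw [← covariance_self (hB.gaussian.aemeasurable t), hB.covariance_eq]
    simp [Real.zero_rpow (by positivity : 2 * H ≠ 0)]
  refine (hB.gaussian.hasGaussianLaw_fun_sub (s := t) (t := s)).lintegral_enorm_rpow ?_
    (by positivity) ?_ hp
  · rw [integral_sub ht.integrable hs.integrable, hB.centered, hB.centered, sub_zero]
  · rw [variance_fun_sub ht.memLp_two hs.memLp_two, hvar, hvar, hB.covariance_eq,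
      ← Real.rpow_natCast, ← Real.rpow_mul (abs_nonneg _), abs_sub_comm (s : ℝ)]
    rw [mul_comm H]; push_cast; ring

/-- The paths of a fractional Brownian motion are Hölder continuous of every order `γ < H`. -/
theorem IsFractionalBrownianMotion.ae_holder (hB : IsFractionalBrownianMotion H B P) {γ T : ℝ}
    (hγ : 0 < γ) (hγH : γ < H) (hT : 0 < T) :
    ∀ᵐ ω ∂P, ∃ C : ℝ, 0 ≤ C ∧ ∀ s t : ℝ, 0 ≤ s → s ≤ t → t ≤ T →
      |B t.toNNReal ω - B s.toNNReal ω| ≤ C * (t - s) ^ γ := by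
  have hH : 0 < H := hγ.trans hγH
  have hd : 0 < H - γ := sub_pos.2 hγH
  -- This moment order gives `1 + γ * p - H * p = -1`: the `2 ^ n` increments of level `n`, weighted
  -- by `2 ^ (n * γ * p)`, have total expected `p`-th power of order `2 ^ (-n)`.
  obtain ⟨p, hpdef⟩ : ∃ p, p = 2 / (H - γ) := ⟨_, rfl⟩
  have hp : 0 < p := by rw [hpdef]; positivity
  let τ : ℕ → ℕ → ℝ≥0 := fun n k => (T * ((k : ℝ) / 2 ^ n)).toNNReal
  let Y : ℕ → Ω → ℝ≥0∞ := fun n ω =>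
    ∑ k ∈ Finset.range (2 ^ n), ENNReal.ofReal (((2 : ℝ) ^ n) ^ (γ * p)) *
      ‖B (τ n (k + 1)) ω - B (τ n k) ω‖ₑ ^ p
  have hYm : ∀ n k, AEMeasurable (fun ω => ENNReal.ofReal (((2 : ℝ) ^ n) ^ (γ * p)) *
      ‖B (τ n (k + 1)) ω - B (τ n k) ω‖ₑ ^ p) P := fun n k =>
    ((((hB.gaussian.aemeasurable _).sub (hB.gaussian.aemeasurable _)).enorm).pow_const p).const_mul _
  have hYE : ∀ n, ∫⁻ ω, Y n ω ∂P = ENNReal.ofReal (T ^ (H * p) * (1 / 2) ^ n) *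
      ∫⁻ x : ℝ, ‖x‖ₑ ^ p ∂(gaussianReal 0 1) := fun n => by
    have hterm : ∀ k, ∫⁻ ω, ENNReal.ofReal (((2 : ℝ) ^ n) ^ (γ * p)) *
        ‖B (τ n (k + 1)) ω - B (τ n k) ω‖ₑ ^ p ∂P
        = ENNReal.ofReal (((2 : ℝ) ^ n) ^ (γ * p) * (T / 2 ^ n) ^ (H * p)) *
          ∫⁻ x : ℝ, ‖x‖ₑ ^ p ∂(gaussianReal 0 1) := fun k => by
      rw [lintegral_const_mul' _ _ ENNReal.ofReal_ne_top,
        hB.lintegral_enorm_sub_rpow hH _ _ hp.le, ← mul_assoc,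
        ← ENNReal.ofReal_mul (by positivity), Real.rpow_mul (by positivity) H p]
      congr 4
      simp only [τ]
      rw [Real.coe_toNNReal _ (by positivity), Real.coe_toNNReal _ (by positivity), ← mul_sub,
        ← sub_div]
      push_cast
      rw [add_sub_cancel_left, mul_one_div, abs_of_pos (by positivity)]
    simp only [Y]
    rw [lintegral_finsetSum' _ fun k _ => hYm n k]
    simp only [hterm]
    rw [Finset.sum_const, Finset.card_range, nsmul_eq_mul, ← mul_assoc]
    congr 1
    rw [← ENNReal.ofReal_natCast, ← ENNReal.ofReal_mul (by positivity)]
    congr 1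
    have hexp : (1 : ℝ) + γ * p - H * p = -1 := by rw [hpdef]; field_simp; ring
    push_cast
    have h2 : (0 : ℝ) < 2 ^ n := by positivity
    rw [Real.div_rpow hT.le h2.le, one_div, inv_pow]
    calc (2 : ℝ) ^ n * ((2 ^ n) ^ (γ * p) * (T ^ (H * p) / (2 ^ n) ^ (H * p)))
        = T ^ (H * p) * (((2 : ℝ) ^ n) ^ (1 : ℝ) * (2 ^ n) ^ (γ * p) / (2 ^ n) ^ (H * p)) := by
          rw [Real.rpow_one]; ring
      _ = T ^ (H * p) * (2 ^ n)⁻¹ := by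
          rw [← Real.rpow_add h2, ← Real.rpow_sub h2, hexp, Real.rpow_neg_one]
  -- The level expectations are summable, so the whole random series is almost surely finite; its
  -- value then dominates each weighted increment, as in `hle`.
  have hfin : ∫⁻ ω, ∑' n, Y n ω ∂P < ∞ := by
    have hsum : ∫⁻ ω, ∑' n, Y n ω ∂P = ∑' n, ∫⁻ ω, Y n ω ∂P :=
      lintegral_tsum fun n => Finset.aemeasurable_fun_sum _ fun k _ => hYm n k
    rw [hsum, tsum_congr hYE, ENNReal.tsum_mul_right, ← ENNReal.ofReal_tsum_of_nonneg (fun n => by positivity)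
      (summable_geometric_two.mul_left _)]
    exact ENNReal.mul_lt_top ENNReal.ofReal_lt_top (lintegral_enorm_rpow_gaussianReal_lt_top hp)
  have hae := ae_lt_top' (AEMeasurable.tsum fun n =>
    Finset.aemeasurable_fun_sum _ fun k _ => hYm n k) hfin.ne
  filter_upwards [hae, hB.continuous_paths] with ω hω hcont
  obtain ⟨Q, hQ⟩ : ∃ Q : ℝ, Q = (∑' n, Y n ω).toReal := ⟨_, rfl⟩
  have hQ0 : 0 ≤ Q := by rw [hQ]; positivity
  have hle : ∀ n k : ℕ, k < 2 ^ n →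
      ((2 : ℝ) ^ n) ^ (γ * p) * |B (τ n (k + 1)) ω - B (τ n k) ω| ^ p ≤ Q := fun n k hk => by
    have h1 : ENNReal.ofReal (((2 : ℝ) ^ n) ^ (γ * p)) * ‖B (τ n (k + 1)) ω - B (τ n k) ω‖ₑ ^ p
        ≤ ∑' n, Y n ω :=
      (Finset.single_le_sum (f := fun k => ENNReal.ofReal (((2 : ℝ) ^ n) ^ (γ * p)) *
        ‖B (τ n (k + 1)) ω - B (τ n k) ω‖ₑ ^ p) (fun _ _ => zero_le) (Finset.mem_range.2 hk)).trans
        (ENNReal.le_tsum n)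
    rw [← ofReal_norm, ENNReal.ofReal_rpow_of_nonneg (norm_nonneg _) hp.le,
      ← ENNReal.ofReal_mul (by positivity), ENNReal.ofReal_le_iff_le_toReal hω.ne] at h1
    rw [hQ]; exact h1
  have hu : ContinuousOn (fun t : ℝ => B (T * t).toNNReal ω) (Icc 0 1) :=
    (hcont.comp (continuous_real_toNNReal.comp (continuous_const.mul continuous_id))).continuousOn
  obtain ⟨C, hC, hCH⟩ := exists_holder_of_dyadic (A := Q ^ p⁻¹) (γ := γ) hu (by positivity) hγ
    (fun n k hk => by
      have h1 := hle n k hk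
      have h2 : (0 : ℝ) < 2 ^ n := by positivity
      change |B (τ n (k + 1)) ω - B (τ n k) ω| ≤ _
      rw [Real.rpow_mul h2.le, ← Real.mul_rpow (by positivity) (abs_nonneg _)] at h1
      have h3 := Real.rpow_le_rpow (by positivity) h1 (inv_nonneg.2 hp.le)
      rw [Real.rpow_rpow_inv (by positivity) hp.ne'] at h3
      have h4 : ((1 / 2 : ℝ) ^ γ) ^ n = (((2 : ℝ) ^ n) ^ γ)⁻¹ := by
        rw [one_div, Real.inv_rpow (by norm_num), inv_pow, ← Real.rpow_natCast, ← Real.rpow_natCast,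
          ← Real.rpow_mul (by norm_num), ← Real.rpow_mul (by norm_num), mul_comm]
      rw [h4, ← div_eq_mul_inv, le_div_iff₀ (by positivity), mul_comm]
      exact h3)
  refine ⟨C / T ^ γ, by positivity, fun s t hs hst ht => ?_⟩
  have h := hCH (s / T) (t / T) (by positivity) (by gcongr) (by rw [div_le_one hT]; exact ht)
  rw [mul_div_cancel₀ _ hT.ne', mul_div_cancel₀ _ hT.ne', ← sub_div,
    Real.div_rpow (by linarith) hT.le] at h
  refine h.trans_eq ?_
  ring

end FractionalBrownianMotion

/-! ### Compactness of Hölder balls -/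

section Compactness

/-- Arzelà–Ascoli: the ball is a closed subset of a product of compact balls for pointwise
convergence, and the common Hölder modulus gives equicontinuity. -/
lemma isCompact_holderBall {E : Type*} [NormedAddCommGroup E] [ProperSpace E] (T C R : ℝ) {γ : ℝ}
    (hγ : 0 < γ) :
    IsCompact {f : C(Icc (0 : ℝ) T, E) | (∀ t, ‖f t‖ ≤ R) ∧
      ∀ s t : Icc (0 : ℝ) T, s ≤ t → ‖f t - f s‖ ≤ C * ((t : ℝ) - s) ^ γ} := by
  lift γ to ℝ≥0 using hγ.le
  have hγ' : 0 < γ := by exact_mod_cast hγ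
  have hhol : ∀ φ : Icc (0 : ℝ) T → E,
      (∀ s t : Icc (0 : ℝ) T, s ≤ t → ‖φ t - φ s‖ ≤ C * ((t : ℝ) - s) ^ (γ : ℝ)) →
      HolderWith C.toNNReal γ φ := fun φ h => holderWith_of_norm_sub_le h
  refine ArzelaAscoli.isCompact_of_equicontinuous _ ?_ ?_
  · have himage : ContinuousMap.toFun '' {f : C(Icc (0 : ℝ) T, E) | (∀ t, ‖f t‖ ≤ R) ∧
        ∀ s t : Icc (0 : ℝ) T, s ≤ t → ‖f t - f s‖ ≤ C * ((t : ℝ) - s) ^ (γ : ℝ)}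
        = (Set.pi univ fun _ => Metric.closedBall (0 : E) R) ∩
          ⋂ s : Icc (0 : ℝ) T, ⋂ t : Icc (0 : ℝ) T, ⋂ _ : s ≤ t,
            {φ : Icc (0 : ℝ) T → E | ‖φ t - φ s‖ ≤ C * ((t : ℝ) - s) ^ (γ : ℝ)} := by
      ext φ
      simp only [mem_image, mem_ofPred_eq, mem_inter_iff, mem_univ_pi, mem_closedBall_zero_iff,
        mem_iInter]
      constructor
      · rintro ⟨f, hf, rfl⟩
        exact hf
      · intro h
        exact ⟨⟨φ, (hhol φ h.2).continuous hγ'⟩, h, rfl⟩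
    rw [himage]
    refine (isCompact_univ_pi fun _ => isCompact_closedBall 0 R).inter_right ?_
    refine isClosed_iInter fun s => isClosed_iInter fun t => isClosed_iInter fun _ => ?_
    exact isClosed_le ((continuous_apply t).sub (continuous_apply s)).norm continuous_const
  · have hue : UniformEquicontinuous (fun f : {f : C(Icc (0 : ℝ) T, E) | (∀ t, ‖f t‖ ≤ R) ∧
        ∀ s t : Icc (0 : ℝ) T, s ≤ t → ‖f t - f s‖ ≤ C * ((t : ℝ) - s) ^ (γ : ℝ)} =>
        (f.1 : Icc (0 : ℝ) T → E)) := by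
      refine Metric.uniformEquicontinuous_of_continuity_modulus
        (fun δ => C.toNNReal * δ ^ (γ : ℝ)) ?_ _ fun x y f => (hhol f.1 f.2.2).dist_le x y
      have : Continuous fun δ : ℝ => (C.toNNReal : ℝ) * δ ^ (γ : ℝ) :=
        continuous_const.mul (continuous_id.rpow_const fun _ => Or.inr γ.coe_nonneg)
      have h := this.tendsto 0
      simpa [Real.zero_rpow hγ.ne'] using h
    exact hue.equicontinuous

end Compactness

/-! ### Coefficients -/

section Coefficients

open scoped Matrix.Norms.Frobenius

variable {d m : ℕ}

/-- A matrix as a continuous linear map between Euclidean spaces. -/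
noncomputable def matrixCLM (A : Matrix (Fin d) (Fin m) ℝ) :
    EuclideanSpace ℝ (Fin m) →L[ℝ] EuclideanSpace ℝ (Fin d) :=
  LinearMap.toContinuousLinearMap (Matrix.toEuclideanLin A)

lemma matrixCLM_apply (A : Matrix (Fin d) (Fin m) ℝ) (v : EuclideanSpace ℝ (Fin m)) :
    matrixCLM A v = Matrix.toEuclideanLin A v := rfl

lemma matrixCLM_sub (A B : Matrix (Fin d) (Fin m) ℝ) :
    matrixCLM (A - B) = matrixCLM A - matrixCLM B := by
  simp [matrixCLM]

/-- Submultiplicativity of the Frobenius norm, with the vector viewed as a one-column matrix. -/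
lemma norm_matrixCLM_le (A : Matrix (Fin d) (Fin m) ℝ) : ‖matrixCLM A‖ ≤ ‖A‖ := by
  refine ContinuousLinearMap.opNorm_le_bound _ (norm_nonneg _) fun v => ?_
  have h := Matrix.frobenius_norm_mul A (Matrix.replicateCol (Fin 1) v.ofLp)
  have e (k : ℕ) (u : Fin k → ℝ) : ‖Matrix.replicateCol (Fin 1) u‖ = ‖WithLp.toLp 2 u‖ :=
    Matrix.frobenius_norm_replicateCol u
  rw [← Matrix.replicateCol_mulVec, e, e] at h
  exact h

/-- Uniform bounds for the coefficients of the equation. -/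
structure CoefficientBounds (T γ M K : ℝ)
    (b : ℝ → EuclideanSpace ℝ (Fin d) → EuclideanSpace ℝ (Fin d))
    (σ : ℝ → EuclideanSpace ℝ (Fin d) → Matrix (Fin d) (Fin m) ℝ) : Prop where
  nonneg_M : 0 ≤ M
  nonneg_K : 0 ≤ K
  drift_measurable : ∀ x, AEStronglyMeasurable (fun t => b t x) (volume.restrict (Icc 0 T))
  drift_le : ∀ t ∈ Icc 0 T, ∀ x, ‖b t x‖ ≤ M
  drift_lipschitz : ∀ t ∈ Icc 0 T, ∀ x y, ‖b t x - b t y‖ ≤ K * ‖x - y‖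
  diffusion_le : ∀ t ∈ Icc 0 T, ∀ x, ‖σ t x‖ ≤ M
  diffusion_lipschitz : ∀ t ∈ Icc 0 T, ∀ x y, ‖σ t x - σ t y‖ ≤ K * ‖x - y‖
  diffusion_holder : ∀ x s t, 0 ≤ s → s ≤ t → t ≤ T → ‖σ t x - σ s x‖ ≤ K * (t - s) ^ γ

/-- On a bounded time interval the exponent `ν` can be lowered to `γ` at the cost of a factor `T ^
(ν - γ)`; all constants are then merged into two. -/
lemma exists_coefficientBounds {T γ ν : ℝ} (hT : 0 < T) (hγ : 0 < γ) (hγν : γ ≤ ν)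
    {b : ℝ → EuclideanSpace ℝ (Fin d) → EuclideanSpace ℝ (Fin d)}
    {σ : ℝ → EuclideanSpace ℝ (Fin d) → Matrix (Fin d) (Fin m) ℝ}
    (hb : DriftHypothesis T b) (hσ : DiffusionHypothesis T ν σ) :
    ∃ M K, CoefficientBounds T γ M K b σ := by
  obtain ⟨M₁, hM₁⟩ := hb.bounded
  obtain ⟨M₂, hM₂⟩ := hσ.bounded
  obtain ⟨K₁, hK₁⟩ := hb.lipschitz
  obtain ⟨K₂, hK₂, hK₂'⟩ := hσ.regular
  have hTp : 0 < T ^ (ν - γ) := by positivity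
  have e1 : K₁ ≤ |K₁| + |K₂| + |K₂| * T ^ (ν - γ) := by
    have := le_abs_self K₁; have : 0 ≤ |K₂| := abs_nonneg _
    have : 0 ≤ |K₂| * T ^ (ν - γ) := by positivity
    linarith
  have e2 : K₂ ≤ |K₁| + |K₂| + |K₂| * T ^ (ν - γ) := by
    have := le_abs_self K₂; have : 0 ≤ |K₁| := abs_nonneg _
    have : 0 ≤ |K₂| * T ^ (ν - γ) := by positivity
    linarith
  have e3 : |K₂| * T ^ (ν - γ) ≤ |K₁| + |K₂| + |K₂| * T ^ (ν - γ) := by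
    have : 0 ≤ |K₁| + |K₂| := by positivity
    linarith
  refine ⟨|M₁| + |M₂|, |K₁| + |K₂| + |K₂| * T ^ (ν - γ), by positivity, by positivity,
    hb.measurable, fun t ht x => ?_, fun t ht x y => (hK₁ t ht x y).trans (by gcongr),
    fun t ht x => ?_, fun t ht x y => (hK₂ t ht x y).trans (by gcongr), ?_⟩
  · exact (hM₁ t ht x).trans ((le_abs_self _).trans (le_add_of_nonneg_right (abs_nonneg _)))
  · exact (hM₂ t ht x).trans ((le_abs_self _).trans (le_add_of_nonneg_left (abs_nonneg _)))
  · intro x s t hs hst ht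
    have h0 : 0 ≤ t - s := sub_nonneg.2 hst
    have h1 := hK₂' x t ⟨hs.trans hst, ht⟩ s ⟨hs, hst.trans ht⟩
    rw [abs_of_nonneg h0] at h1
    calc ‖σ t x - σ s x‖ ≤ K₂ * (t - s) ^ ν := h1
      _ ≤ |K₂| * ((t - s) ^ (ν - γ) * (t - s) ^ γ) := by
          rw [← Real.rpow_add_of_nonneg h0 (by linarith) hγ.le, sub_add_cancel]
          gcongr
          exact le_abs_self _
      _ ≤ |K₂| * (T ^ (ν - γ) * (t - s) ^ γ) := by
          gcongr
          linarith
      _ = (|K₂| * T ^ (ν - γ)) * (t - s) ^ γ := by ring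
      _ ≤ _ := by gcongr

namespace CoefficientBounds

variable {T γ M K : ℝ} {b : ℝ → EuclideanSpace ℝ (Fin d) → EuclideanSpace ℝ (Fin d)}
  {σ : ℝ → EuclideanSpace ℝ (Fin d) → Matrix (Fin d) (Fin m) ℝ}

lemma continuous_drift (h : CoefficientBounds T γ M K b σ) {t : ℝ} (ht : t ∈ Icc 0 T) :
    Continuous (b t) :=
  (LipschitzWith.of_dist_le_mul (K := K.toNNReal) fun x y => by
    rw [dist_eq_norm, dist_eq_norm, Real.coe_toNNReal _ h.nonneg_K]
    exact h.drift_lipschitz t ht x y).continuous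

lemma norm_diffusion_sub_le (h : CoefficientBounds T γ M K b σ) {s t : ℝ} (hs : 0 ≤ s)
    (hst : s ≤ t) (ht : t ≤ T) (x y : EuclideanSpace ℝ (Fin d)) :
    ‖σ t y - σ s x‖ ≤ K * (t - s) ^ γ + K * ‖y - x‖ := by
  calc ‖σ t y - σ s x‖ ≤ ‖σ t y - σ s y‖ + ‖σ s y - σ s x‖ := norm_sub_le_norm_sub_add_norm_sub _ _ _
    _ ≤ _ := add_le_add (h.diffusion_holder y s t hs hst ht)
        (h.diffusion_lipschitz s ⟨hs, hst.trans ht⟩ y x)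

lemma norm_matrixCLM_diffusion_sub_le (h : CoefficientBounds T γ M K b σ) {s t : ℝ} (hs : 0 ≤ s)
    (hst : s ≤ t) (ht : t ≤ T) (x y : EuclideanSpace ℝ (Fin d)) :
    ‖matrixCLM (σ t y) - matrixCLM (σ s x)‖ ≤ K * (t - s) ^ γ + K * ‖y - x‖ := by
  rw [← matrixCLM_sub]
  exact (norm_matrixCLM_le _).trans (h.norm_diffusion_sub_le hs hst ht x y)

lemma continuous_matrixCLM_diffusion (h : CoefficientBounds T γ M K b σ) {t : ℝ}
    (ht : t ∈ Icc 0 T) : Continuous fun x => matrixCLM (σ t x) :=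
  (LipschitzWith.of_dist_le_mul (K := K.toNNReal) fun x y => by
    rw [dist_eq_norm, dist_eq_norm, Real.coe_toNNReal _ h.nonneg_K, ← matrixCLM_sub]
    exact (norm_matrixCLM_le _).trans (h.diffusion_lipschitz t ht x y)).continuous

/-- Carathéodory argument: along simple approximations of `x` the composition is a finite sum of
sections `b · c` cut by indicators, and continuity of `b` in space yields the limit. -/
lemma aestronglyMeasurable_drift_comp (h : CoefficientBounds T γ M K b σ) (hT : 0 ≤ T)
    {x : ℝ → EuclideanSpace ℝ (Fin d)} (hx : ContinuousOn x (Icc 0 T)) :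
    AEStronglyMeasurable (fun s => b s (x s)) (volume.restrict (Icc 0 T)) := by
  have hx' : Continuous (IccExtend hT (fun t : Icc 0 T => x t)) :=
    (continuousOn_iff_continuous_domRestrict.1 hx).Icc_extend'
  have hsm := hx'.stronglyMeasurable
  refine aestronglyMeasurable_of_tendsto_ae Filter.atTop (f := fun n s => b s (hsm.approx n s))
    (fun n => ?_) ?_
  · have he : (fun s => b s (hsm.approx n s)) = fun s => ∑ c ∈ (hsm.approx n).range,
        (hsm.approx n ⁻¹' {c}).indicator (fun s => b s c) s := by
      funext s
      rw [Finset.sum_eq_single (hsm.approx n s)]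
      · rw [indicator_of_mem (by simp)]
      · intro c _ hc
        rw [indicator_of_notMem]
        exact fun hmem => hc hmem.symm
      · intro hn
        exact absurd (SimpleFunc.mem_range_self _ s) hn
    rw [he]
    exact Finset.aestronglyMeasurable_fun_sum _ fun c _ =>
      (h.drift_measurable c).indicator ((hsm.approx n).measurableSet_fiber c)
  · filter_upwards [ae_restrict_mem measurableSet_Icc] with s hs
    have h1 := hsm.tendsto_approx s
    rw [IccExtend_of_mem hT _ hs] at h1
    exact ((h.continuous_drift hs).tendsto _).comp h1

lemma intervalIntegrable_drift_comp (h : CoefficientBounds T γ M K b σ)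
    {x : ℝ → EuclideanSpace ℝ (Fin d)} (hx : ContinuousOn x (Icc 0 T)) {s t : ℝ} (hs : s ∈ Icc 0 T)
    (ht : t ∈ Icc 0 T) : IntervalIntegrable (fun u => b u (x u)) volume s t := by
  have hT : 0 ≤ T := hs.1.trans hs.2
  have hFint : IntegrableOn (fun u => b u (x u)) (Icc 0 T) := by
    refine Integrable.of_bound (h.aestronglyMeasurable_drift_comp hT hx) M ?_
    filter_upwards [ae_restrict_mem measurableSet_Icc] with u hu
    exact h.drift_le u hu _
  rw [← uIcc_of_le hT] at hFint
  exact hFint.intervalIntegrable.mono_set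
    (uIcc_subset_uIcc (by rwa [uIcc_of_le hT]) (by rwa [uIcc_of_le hT]))

lemma norm_integral_drift_sub_le (h : CoefficientBounds T γ M K b σ)
    {x x' : ℝ → EuclideanSpace ℝ (Fin d)} (hx : ContinuousOn x (Icc 0 T))
    (hx' : ContinuousOn x' (Icc 0 T)) {s t B : ℝ} (hs : 0 ≤ s) (hst : s ≤ t) (ht : t ≤ T)
    (hB : ∀ u ∈ Icc s t, ‖x u - x' u‖ ≤ B) :
    ‖(∫ u in s..t, b u (x u)) - ∫ u in s..t, b u (x' u)‖ ≤ K * B * (t - s) := by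
  have hs' : s ∈ Icc 0 T := ⟨hs, hst.trans ht⟩
  have ht' : t ∈ Icc 0 T := ⟨hs.trans hst, ht⟩
  rw [← intervalIntegral.integral_sub (h.intervalIntegrable_drift_comp hx hs' ht')
    (h.intervalIntegrable_drift_comp hx' hs' ht')]
  refine (intervalIntegral.norm_integral_le_of_norm_le_const (C := K * B) fun u hu => ?_).trans_eq
    (by rw [abs_of_nonneg (sub_nonneg.2 hst)])
  rw [uIoc_of_le hst] at hu
  exact (h.drift_lipschitz u ⟨hs.trans hu.1.le, hu.2.trans ht⟩ _ _).trans
    (mul_le_mul_of_nonneg_left (hB u ⟨hu.1.le, hu.2⟩) h.nonneg_K)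

lemma norm_integral_drift_le (h : CoefficientBounds T γ M K b σ)
    (x : ℝ → EuclideanSpace ℝ (Fin d)) {s t : ℝ} (hs : 0 ≤ s) (hst : s ≤ t) (ht : t ≤ T) :
    ‖∫ u in s..t, b u (x u)‖ ≤ M * (t - s) := by
  refine (intervalIntegral.norm_integral_le_of_norm_le_const (C := M) fun u hu => ?_).trans_eq
    (by rw [abs_of_nonneg (sub_nonneg.2 hst)])
  rw [uIoc_of_le hst] at hu
  exact h.drift_le u ⟨hs.trans hu.1.le, hu.2.trans ht⟩ _

lemma continuous_integral_drift (h : CoefficientBounds T γ M K b σ) {s t : ℝ} (hs : 0 ≤ s)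
    (hst : s ≤ t) (ht : t ≤ T) : Continuous fun x => ∫ u in s..t, b u x :=
  (LipschitzWith.of_dist_le_mul (K := (K * (t - s)).toNNReal) fun x y => by
    rw [dist_eq_norm, dist_eq_norm, Real.coe_toNNReal _
      (mul_nonneg h.nonneg_K (sub_nonneg.2 hst))]
    refine (h.norm_integral_drift_sub_le (x := fun _ => x) (x' := fun _ => y) continuousOn_const
      continuousOn_const hs hst ht fun u _ => le_rfl).trans_eq ?_
    ring).continuous

end CoefficientBounds

end Coefficients

/-! ### The reflected Euler scheme -/

section EulerScheme

variable {d m : ℕ}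

/-- One step of the reflected Euler scheme with mesh `h` from the `k`-th grid point: `p` is the pair
of the unreflected path and the regulator, `v` the increment of the driver. -/
noncomputable def eulerStep (b : ℝ → EuclideanSpace ℝ (Fin d) → EuclideanSpace ℝ (Fin d))
    (σ : ℝ → EuclideanSpace ℝ (Fin d) → Matrix (Fin d) (Fin m) ℝ) (h : ℝ) (k : ℕ)
    (p : EuclideanSpace ℝ (Fin d) × EuclideanSpace ℝ (Fin d)) (v : EuclideanSpace ℝ (Fin m)) :
    EuclideanSpace ℝ (Fin d) × EuclideanSpace ℝ (Fin d) :=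
  let z' := p.1 + (∫ s in (h * k)..(h * ((k + 1 : ℕ) : ℝ)), b s (p.1 + p.2))
    + matrixCLM (σ (h * k) (p.1 + p.2)) v
  (z', WithLp.toLp 2 fun i => max (p.2 i) (z' i)⁻)

/-- The reflected Euler scheme with mesh `h` driven by the grid values `w`: the pair of the
unreflected path and the regulator at the grid points. -/
noncomputable def eulerState (b : ℝ → EuclideanSpace ℝ (Fin d) → EuclideanSpace ℝ (Fin d))
    (σ : ℝ → EuclideanSpace ℝ (Fin d) → Matrix (Fin d) (Fin m) ℝ) (x₀ : EuclideanSpace ℝ (Fin d))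
    (h : ℝ) (w : ℕ → EuclideanSpace ℝ (Fin m)) :
    ℕ → EuclideanSpace ℝ (Fin d) × EuclideanSpace ℝ (Fin d)
  | 0 => (x₀, 0)
  | k + 1 => eulerStep b σ h k (eulerState b σ x₀ h w k) (w (k + 1) - w k)

variable {b : ℝ → EuclideanSpace ℝ (Fin d) → EuclideanSpace ℝ (Fin d)}
  {σ : ℝ → EuclideanSpace ℝ (Fin d) → Matrix (Fin d) (Fin m) ℝ} {x₀ : EuclideanSpace ℝ (Fin d)}
  {h : ℝ} {w : ℕ → EuclideanSpace ℝ (Fin m)}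

lemma eulerState_succ_fst (k : ℕ) : (eulerState b σ x₀ h w (k + 1)).1
    = (eulerState b σ x₀ h w k).1
      + (∫ s in (h * k)..(h * ((k + 1 : ℕ) : ℝ)),
          b s ((eulerState b σ x₀ h w k).1 + (eulerState b σ x₀ h w k).2))
      + matrixCLM (σ (h * k) ((eulerState b σ x₀ h w k).1 + (eulerState b σ x₀ h w k).2))
          (w (k + 1) - w k) := rfl

lemma eulerState_succ_snd (k : ℕ) (i : Fin d) : (eulerState b σ x₀ h w (k + 1)).2 i
    = max ((eulerState b σ x₀ h w k).2 i) ((eulerState b σ x₀ h w (k + 1)).1 i)⁻ := rfl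

lemma eulerState_snd_mono (i : Fin d) : Monotone fun k => (eulerState b σ x₀ h w k).2 i :=
  monotone_nat_of_le_succ fun k => by rw [eulerState_succ_snd]; exact le_max_left _ _

lemma negPart_le_eulerState_snd (hx₀ : ∀ i, 0 ≤ x₀ i) (k : ℕ) (i : Fin d) :
    ((eulerState b σ x₀ h w k).1 i)⁻ ≤ (eulerState b σ x₀ h w k).2 i := by
  cases k with
  | zero => exact (negPart_eq_zero.2 (hx₀ i)).le
  | succ k => rw [eulerState_succ_snd]; exact le_max_right _ _

/-- Discrete counterpart of `abs_regulator_sub_le`. -/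
lemma abs_eulerState_snd_sub_le (hx₀ : ∀ i, 0 ≤ x₀ i) {k l : ℕ} (hkl : k ≤ l) {B : ℝ} (i : Fin d)
    (hB : ∀ j, k ≤ j → j ≤ l →
      |(eulerState b σ x₀ h w j).1 i - (eulerState b σ x₀ h w k).1 i| ≤ B) :
    |(eulerState b σ x₀ h w l).2 i - (eulerState b σ x₀ h w k).2 i| ≤ B := by
  have hB0 : 0 ≤ B := (abs_nonneg _).trans (hB k le_rfl hkl)
  rw [abs_of_nonneg (sub_nonneg.2 (eulerState_snd_mono i hkl)), sub_le_iff_le_add]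
  beta_reduce
  induction l, hkl using Nat.le_induction with
  | base => linarith
  | succ l hkl ih =>
    rw [eulerState_succ_snd]
    refine max_le (ih fun j h1 h2 => hB j h1 (by omega)) ?_
    have h1 := negPart_le_negPart_add_abs_sub ((eulerState b σ x₀ h w (l + 1)).1 i)
      ((eulerState b σ x₀ h w k).1 i)
    have h2 := hB (l + 1) (by omega) le_rfl
    have h3 := negPart_le_eulerState_snd (b := b) (σ := σ) (h := h) (w := w) hx₀ k i
    linarith

lemma mul_le_of_le_grid {T : ℝ} {N k : ℕ} (hh : 0 < h) (hN : h * N = T) (hk : k ≤ N) :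
    h * (k : ℝ) ≤ T := by
  rw [← hN]; gcongr

-- The oscillation constant `1 + d` counts the unreflected path once and each of the `d` coordinate
-- regulators once.
open scoped Matrix.Norms.Frobenius in
lemma isGridSolution_eulerState {T γ M K G : ℝ} (hc : CoefficientBounds T γ M K b σ)
    (hx₀ : ∀ i, 0 ≤ x₀ i) (hh : 0 < h) {N : ℕ} (hN : h * N = T)
    {g : ℝ → EuclideanSpace ℝ (Fin m)}
    (hg : ∀ s t, 0 ≤ s → s ≤ t → t ≤ T → ‖g t - g s‖ ≤ G * (t - s) ^ γ) :
    IsGridSolution M K G (1 + d) γ h N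
      (fun k => (eulerState b σ x₀ h (fun k => g (h * k)) k).1)
      (fun k => (eulerState b σ x₀ h (fun k => g (h * k)) k).1
        + (eulerState b σ x₀ h (fun k => g (h * k)) k).2)
      (fun k => matrixCLM (σ (h * k) ((eulerState b σ x₀ h (fun k => g (h * k)) k).1
        + (eulerState b σ x₀ h (fun k => g (h * k)) k).2)))
      (fun k => g (h * k))
      (fun k => ∫ s in (h * k)..(h * ((k + 1 : ℕ) : ℝ)),
        b s ((eulerState b σ x₀ h (fun k => g (h * k)) k).1
          + (eulerState b σ x₀ h (fun k => g (h * k)) k).2)) where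
  step k _ := eulerState_succ_fst k
  drift_le k hk := by
    refine (hc.norm_integral_drift_le (fun _ => _) (by positivity) (by gcongr; simp)
      (mul_le_of_le_grid hh hN hk)).trans_eq ?_
    push_cast; ring
  coeff_le k hk := (norm_matrixCLM_le _).trans
    (hc.diffusion_le _ ⟨by positivity, mul_le_of_le_grid hh hN hk.le⟩ _)
  coeff_sub_le k l hkl hl := by
    rw [mul_sub]
    exact hc.norm_matrixCLM_diffusion_sub_le (by positivity) (by gcongr)
      (mul_le_of_le_grid hh hN hl.le) _ _
  driver_sub_le k l hkl hl := by
    rw [mul_sub]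
    exact hg _ _ (by positivity) (by gcongr) (mul_le_of_le_grid hh hN hl)
  osc_le k l hkl hl B hB := by
    obtain ⟨S, hS⟩ : ∃ S, S = eulerState b σ x₀ h (fun k => g (h * k)) := ⟨_, rfl⟩
    rw [← hS] at hB ⊢
    calc ‖(S l).1 + (S l).2 - ((S k).1 + (S k).2)‖
        = ‖((S l).1 - (S k).1) + ((S l).2 - (S k).2)‖ := by congr 1; abel
      _ ≤ B + d * B := by
          refine (norm_add_le _ _).trans (add_le_add (hB l hkl le_rfl) ?_)
          refine EuclideanSpace.norm_le_of_abs_apply_le fun i => ?_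
          rw [hS] at hB ⊢
          exact abs_eulerState_snd_sub_le hx₀ hkl i fun j h1 h2 =>
            (EuclideanSpace.abs_apply_le_norm (_ - _) i).trans (hB j h1 h2)
      _ = (1 + d) * B := by ring

/-- The piecewise linear path through the unreflected Euler scheme. -/
noncomputable def eulerInterp (b : ℝ → EuclideanSpace ℝ (Fin d) → EuclideanSpace ℝ (Fin d))
    (σ : ℝ → EuclideanSpace ℝ (Fin d) → Matrix (Fin d) (Fin m) ℝ) (x₀ : EuclideanSpace ℝ (Fin d))
    (h : ℝ) (w : ℕ → EuclideanSpace ℝ (Fin m)) (N : ℕ) : ℝ → EuclideanSpace ℝ (Fin d) :=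
  gridInterp h (clampSeq fun i : Fin (N + 1) => (eulerState b σ x₀ h w i).1)

lemma clampSeq_of_le {E : Type*} [NormedAddCommGroup E] {N k : ℕ} (hk : k ≤ N) (v : ℕ → E) :
    clampSeq (fun i : Fin (N + 1) => v i) k = v k := by
  simp [clampSeq, min_eq_left hk]

lemma eulerInterp_grid (hh : 0 < h) {N k : ℕ} (hk : k ≤ N) :
    eulerInterp b σ x₀ h w N (h * k) = (eulerState b σ x₀ h w k).1 := by
  rw [eulerInterp, gridInterp_grid hh]
  exact clampSeq_of_le hk fun k => (eulerState b σ x₀ h w k).1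

lemma continuousOn_eulerInterp (hh : 0 < h) (N : ℕ) (T : ℝ) :
    ContinuousOn (eulerInterp b σ x₀ h w N) (Icc 0 T) :=
  continuousOn_of_holder one_pos fun _ _ hs hst _ =>
    norm_gridInterp_sub_le hh one_pos le_rfl
      (fun _ _ hkl => clampSeq_bounded_holder hh one_pos _ hkl) hs hst

lemma negPart_convex_le {a c θ B : ℝ} (h0 : 0 ≤ θ) (h1 : θ ≤ 1) (ha : a⁻ ≤ B) (hc : c⁻ ≤ B) :
    (a + θ * (c - a))⁻ ≤ B := by
  have hB : 0 ≤ B := (negPart_nonneg a).trans ha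
  have h2 := (neg_le_negPart a).trans ha
  have h3 := (neg_le_negPart c).trans hc
  rw [negPart_def]
  exact sup_le (by nlinarith) hB

/-- The negative part is convex, so on each linear piece it is largest at an endpoint. The discrete
running maximum is therefore the true regulator of the interpolated path, and limits can be taken
through the continuous-time Skorokhod map. -/
lemma regulatorVec_eulerInterp (hx₀ : ∀ i, 0 ≤ x₀ i) (hh : 0 < h) {N k : ℕ} (hk : k ≤ N) :
    regulatorVec (eulerInterp b σ x₀ h w N) (h * k) = (eulerState b σ x₀ h w k).2 := by
  ext i
  change regulator (fun s => eulerInterp b σ x₀ h w N s i) (h * k) = _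
  have hcont : ContinuousOn (fun s => eulerInterp b σ x₀ h w N s i) (Icc 0 (h * N)) :=
    (continuousOn_eulerInterp hh N (h * N)).euclidean_apply i
  have hmem : ∀ k, k ≤ N → h * (k : ℝ) ∈ Icc 0 (h * (N : ℝ)) := fun k hk =>
    ⟨by positivity, by gcongr⟩
  refine le_antisymm (regulator_le hcont (hmem k hk) fun t ht => ?_) ?_
  · have hneg : ∀ j, j ≤ k → ((clampSeq fun i : Fin (N + 1) => (eulerState b σ x₀ h w i).1) j i)⁻
        ≤ (eulerState b σ x₀ h w k).2 i := fun j hj => by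
      rw [clampSeq_of_le (hj.trans hk) fun k => (eulerState b σ x₀ h w k).1]
      exact (negPart_le_eulerState_snd hx₀ j i).trans (eulerState_snd_mono i hj)
    -- The final time is treated apart: there the interpolation formula mentions the value at `k +
    -- 1`, which the regulator at `k` does not control.
    rcases ht.2.eq_or_lt with rfl | hlt
    · rw [eulerInterp, gridInterp_grid hh]; exact hneg k le_rfl
    have h0 : 0 ≤ t / h := div_nonneg ht.1 hh.le
    have h1 := Nat.floor_le h0
    have h2 := Nat.lt_floor_add_one (t / h)
    have h3 : ⌊t / h⌋₊ < k := by
      rw [Nat.floor_lt h0, div_lt_iff₀ hh, mul_comm]; exact hlt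
    exact negPart_convex_le (by linarith) (by linarith) (hneg _ h3.le) (hneg _ h3)
  · have key : ∀ j, j ≤ k → ((eulerState b σ x₀ h w j).1 i)⁻
        ≤ regulator (fun s => eulerInterp b σ x₀ h w N s i) (h * k) := fun j hj => by
      have := negPart_le_regulator hcont (hmem k hk) (s := h * j) ⟨by positivity, by gcongr⟩
      rwa [eulerInterp_grid hh (hj.trans hk)] at this
    have hind : ∀ j, j ≤ k → (eulerState b σ x₀ h w j).2 i
        ≤ regulator (fun s => eulerInterp b σ x₀ h w N s i) (h * k) := fun j => by
      induction j with
      | zero => exact fun _ => regulator_nonneg hcont (hmem k hk)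
      | succ j ih =>
        intro hj
        rw [eulerState_succ_snd]
        exact max_le (ih (by omega)) (key _ hj)
    exact hind k le_rfl

lemma continuous_eulerStep {T γ M K : ℝ} (hc : CoefficientBounds T γ M K b σ) (hh : 0 < h) {k : ℕ}
    (hk : h * ((k + 1 : ℕ) : ℝ) ≤ T) :
    Continuous fun q : (EuclideanSpace ℝ (Fin d) × EuclideanSpace ℝ (Fin d)) ×
      EuclideanSpace ℝ (Fin m) => eulerStep b σ h k q.1 q.2 := by
  have hle : h * (k : ℝ) ≤ h * ((k + 1 : ℕ) : ℝ) := by gcongr; simp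
  have hk' : h * (k : ℝ) ∈ Icc 0 T := ⟨by positivity, hle.trans hk⟩
  have hz : Continuous fun q : (EuclideanSpace ℝ (Fin d) × EuclideanSpace ℝ (Fin d)) ×
      EuclideanSpace ℝ (Fin m) => q.1.1
        + (∫ s in (h * k)..(h * ((k + 1 : ℕ) : ℝ)), b s (q.1.1 + q.1.2))
        + matrixCLM (σ (h * k) (q.1.1 + q.1.2)) q.2 := by
    have h1 := hc.continuous_integral_drift hk'.1 hle hk
    have h2 := hc.continuous_matrixCLM_diffusion hk'
    have hx : Continuous fun q : (EuclideanSpace ℝ (Fin d) × EuclideanSpace ℝ (Fin d)) ×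
      EuclideanSpace ℝ (Fin m) => q.1.1 + q.1.2 := by fun_prop
    exact (continuous_fst.fst.add (h1.comp hx)).add ((h2.comp hx).clm_apply continuous_snd)
  refine hz.prodMk ?_
  simp only [negPart_def]
  refine (PiLp.continuous_toLp 2 _).comp (continuous_pi fun i => ?_)
  have hi := (EuclideanSpace.proj (𝕜 := ℝ) i : EuclideanSpace ℝ (Fin d) →L[ℝ] ℝ).continuous
  exact (hi.comp continuous_fst.snd).max ((hi.comp hz).neg.max continuous_const)

lemma aemeasurable_eulerState {Ω : Type*} [MeasurableSpace Ω] {P : Measure Ω} {T γ M K : ℝ}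
    (hc : CoefficientBounds T γ M K b σ) (hh : 0 < h) {N : ℕ} (hN : h * N = T)
    {w : Ω → ℕ → EuclideanSpace ℝ (Fin m)} (hw : ∀ k, AEMeasurable (fun ω => w ω k) P) {k : ℕ}
    (hk : k ≤ N) : AEMeasurable (fun ω => eulerState b σ x₀ h (w ω) k) P := by
  induction k with
  | zero => exact aemeasurable_const
  | succ k ih =>
    have hq : AEMeasurable (fun ω => (eulerState b σ x₀ h (w ω) k, w ω (k + 1) - w ω k)) P :=
      (ih (by omega)).prodMk ((hw (k + 1)).sub (hw k))
    have hm := (continuous_eulerStep hc hh (mul_le_of_le_grid hh hN hk)).measurable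
    have := hm.comp_aemeasurable hq
    exact this

end EulerScheme

/-! ### Limits of the Euler scheme -/

section EulerLimit

open Filter Topology

variable {d m : ℕ}

/-- The reflected Euler scheme with `n + 1` steps on `[0,T]` driven by the path `g`. -/
noncomputable def eulerGrid (b : ℝ → EuclideanSpace ℝ (Fin d) → EuclideanSpace ℝ (Fin d))
    (σ : ℝ → EuclideanSpace ℝ (Fin d) → Matrix (Fin d) (Fin m) ℝ) (x₀ : EuclideanSpace ℝ (Fin d))
    (T : ℝ) (g : ℝ → EuclideanSpace ℝ (Fin m)) (n k : ℕ) :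
    EuclideanSpace ℝ (Fin d) × EuclideanSpace ℝ (Fin d) :=
  eulerState b σ x₀ (T / (n + 1)) (fun k => g (T / (n + 1) * k)) k

/-- The piecewise linear path through the unreflected Euler scheme with `n + 1` steps. -/
noncomputable def eulerApprox (b : ℝ → EuclideanSpace ℝ (Fin d) → EuclideanSpace ℝ (Fin d))
    (σ : ℝ → EuclideanSpace ℝ (Fin d) → Matrix (Fin d) (Fin m) ℝ) (x₀ : EuclideanSpace ℝ (Fin d))
    (T : ℝ) (g : ℝ → EuclideanSpace ℝ (Fin m)) (n : ℕ) : ℝ → EuclideanSpace ℝ (Fin d) :=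
  eulerInterp b σ x₀ (T / (n + 1)) (fun k => g (T / (n + 1) * k)) (n + 1)

variable {b : ℝ → EuclideanSpace ℝ (Fin d) → EuclideanSpace ℝ (Fin d)}
  {σ : ℝ → EuclideanSpace ℝ (Fin d) → Matrix (Fin d) (Fin m) ℝ} {x₀ : EuclideanSpace ℝ (Fin d)}
  {T γ M K G : ℝ} {g : ℝ → EuclideanSpace ℝ (Fin m)}

lemma mesh_mul (T : ℝ) (n : ℕ) : T / ((n : ℝ) + 1) * ((n + 1 : ℕ) : ℝ) = T := by
  push_cast; field_simp

lemma tendsto_mesh (T : ℝ) : Tendsto (fun n : ℕ => T / ((n : ℝ) + 1)) atTop (𝓝 0) := by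
  simpa [div_eq_mul_inv] using tendsto_one_div_add_atTop_nhds_zero_nat (𝕜 := ℝ).const_mul T

lemma eulerApprox_grid (hT : 0 < T) {n k : ℕ} (hk : k ≤ n + 1) :
    eulerApprox b σ x₀ T g n (T / (n + 1) * k) = (eulerGrid b σ x₀ T g n k).1 :=
  eulerInterp_grid (by positivity) hk

lemma eulerApprox_zero (hT : 0 < T) (n : ℕ) : eulerApprox b σ x₀ T g n 0 = x₀ := by
  have := eulerApprox_grid (b := b) (σ := σ) (x₀ := x₀) (g := g) hT (Nat.zero_le (n + 1))
  simpa [eulerGrid, eulerState] using this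

lemma continuousOn_eulerApprox (hT : 0 < T) (n : ℕ) :
    ContinuousOn (eulerApprox b σ x₀ T g n) (Icc 0 T) :=
  continuousOn_eulerInterp (by positivity) _ _

lemma regulatorVec_eulerApprox (hx₀ : ∀ i, 0 ≤ x₀ i) (hT : 0 < T) {n k : ℕ} (hk : k ≤ n + 1) :
    regulatorVec (eulerApprox b σ x₀ T g n) (T / (n + 1) * k) = (eulerGrid b σ x₀ T g n k).2 :=
  regulatorVec_eulerInterp hx₀ (by positivity) hk

/-- Uniform Hölder bound and uniform Young remainder bound for the Euler scheme. -/
lemma exists_eulerApprox_bounds (hc : CoefficientBounds T γ M K b σ) (hT : 0 < T) (hγ : 1 / 2 < γ)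
    (hγ1 : γ ≤ 1) (hx₀ : ∀ i, 0 ≤ x₀ i) (hG : 0 ≤ G)
    (hg : ∀ s t, 0 ≤ s → s ≤ t → t ≤ T → ‖g t - g s‖ ≤ G * (t - s) ^ γ) :
    ∃ A : ℝ, 0 ≤ A ∧ ∀ᶠ n : ℕ in atTop,
      (∀ s t, 0 ≤ s → s ≤ t →
        ‖eulerApprox b σ x₀ T g n t - eulerApprox b σ x₀ T g n s‖ ≤ A * (t - s) ^ γ) ∧
      ∀ k l : ℕ, k ≤ l → l ≤ n + 1 →
        ‖(eulerGrid b σ x₀ T g n l).1 - (eulerGrid b σ x₀ T g n k).1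
          - (∑ j ∈ Finset.range l, (∫ s in (T / (n + 1) * j)..(T / (n + 1) * ((j + 1 : ℕ) : ℝ)),
              b s ((eulerGrid b σ x₀ T g n j).1 + (eulerGrid b σ x₀ T g n j).2))
            - ∑ j ∈ Finset.range k, (∫ s in (T / (n + 1) * j)..(T / (n + 1) * ((j + 1 : ℕ) : ℝ)),
              b s ((eulerGrid b σ x₀ T g n j).1 + (eulerGrid b σ x₀ T g n j).2)))
          - matrixCLM (σ (T / (n + 1) * k)
              ((eulerGrid b σ x₀ T g n k).1 + (eulerGrid b σ x₀ T g n k).2))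
              (g (T / (n + 1) * l) - g (T / (n + 1) * k))‖
          ≤ A * (T / (n + 1) * l - T / (n + 1) * k) ^ (2 * γ) := by
  obtain ⟨C, ε, hC, hε, hbound⟩ := exists_holder_bound_of_isGridSolution
    (U := EuclideanSpace ℝ (Fin m)) (V := EuclideanSpace ℝ (Fin d)) hc.nonneg_M hc.nonneg_K hG
    (by positivity : (0 : ℝ) ≤ 1 + d) hγ hγ1 hT
  have hY := youngConst_pos hγ
  have hK := hc.nonneg_K
  -- The first summand is the Hölder constant of the interpolation, the second the Young remainder
  -- constant.
  refine ⟨3 * C + youngConst γ * (K * (1 + (1 + d) * C) * G), by positivity, ?_⟩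
  filter_upwards [(tendsto_mesh T).eventually_le_const hε] with n hn
  have hh : 0 < T / ((n : ℝ) + 1) := by positivity
  have hsol := isGridSolution_eulerState hc hx₀ hh (mesh_mul T n) hg
  have hH := hbound _ _ _ _ _ _ _ hsol hh hn (mesh_mul T n).le
  constructor
  · intro s t hs hst
    have h0 : 0 ≤ (t - s) ^ γ := Real.rpow_nonneg (sub_nonneg.2 hst) γ
    calc ‖eulerApprox b σ x₀ T g n t - eulerApprox b σ x₀ T g n s‖ ≤ 3 * C * (t - s) ^ γ :=
          norm_gridInterp_sub_le hh (by linarith) hγ1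
            (fun k l hkl => clampSeq_holder hh hC (by linarith) hH hkl) hs hst
      _ ≤ _ := by
          gcongr
          exact le_add_of_nonneg_right (by positivity)
  · intro k l hkl hl
    have hrem := hsol.norm_sum_sub_le hh hK hG (by positivity) hγ hC hkl hl
      fun i j _ h2 h3 => hH i j h2 (by omega)
    have hsub := hsol.sub_eq hkl hl
    -- The drift is written as a difference of sums from `0`, so that each has its own limit.
    rw [Finset.sum_Ico_eq_sub _ hkl] at hsub
    rw [← mul_sub]
    refine le_trans (le_of_eq ?_) (hrem.trans ?_)
    · congr 1
      congr 1
      rw [← sub_eq_iff_eq_add'] at hsub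
      exact hsub
    · have : (0 : ℝ) ≤ (l : ℝ) - k := sub_nonneg.2 (by exact_mod_cast hkl)
      gcongr
      exact le_add_of_nonneg_left (by positivity)

lemma tendsto_clm_apply {α U V : Type*} [NormedAddCommGroup U] [NormedSpace ℝ U]
    [NormedAddCommGroup V] [NormedSpace ℝ V] {l : Filter α} {f : α → U →L[ℝ] V} {f₀ : U →L[ℝ] V}
    {u : α → U} {u₀ : U} (hf : Tendsto f l (𝓝 f₀)) (hu : Tendsto u l (𝓝 u₀)) :
    Tendsto (fun a => f a (u a)) l (𝓝 (f₀ u₀)) :=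
  ((continuous_fst.clm_apply continuous_snd).tendsto (f₀, u₀)).comp (hf.prodMk_nhds hu)

lemma floor_mesh (hT : 0 < T) (n : ℕ) {s : ℝ} (hs : s ∈ Icc 0 T) :
    ⌊s / (T / ((n : ℝ) + 1))⌋₊ ≤ n + 1 ∧ T / ((n : ℝ) + 1) * ⌊s / (T / ((n : ℝ) + 1))⌋₊ ≤ s ∧
      s ≤ T / ((n : ℝ) + 1) * ⌊s / (T / ((n : ℝ) + 1))⌋₊ + T / ((n : ℝ) + 1) := by
  have hh : 0 < T / ((n : ℝ) + 1) := by positivity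
  have hN := mesh_mul T n
  generalize T / ((n : ℝ) + 1) = h at *
  have h0 : 0 ≤ s / h := div_nonneg hs.1 hh.le
  have h1 := Nat.floor_le h0
  have h2 := (Nat.lt_floor_add_one (s / h)).le
  rw [div_le_iff₀ hh] at h2
  refine ⟨?_, ?_, by linarith⟩
  · have : (⌊s / h⌋₊ : ℝ) ≤ ((n + 1 : ℕ) : ℝ) := h1.trans (by
      rw [div_le_iff₀ hh, mul_comm, hN]; exact hs.2)
    exact_mod_cast this
  · rw [le_div_iff₀ hh] at h1; linarith

lemma norm_sub_le_of_abs_le {E : Type*} [SeminormedAddCommGroup E] {x : ℝ → E} {A h : ℝ}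
    (hA : 0 ≤ A) (hγ : 0 ≤ γ)
    (hx : ∀ s t, 0 ≤ s → s ≤ t → t ≤ T → ‖x t - x s‖ ≤ A * (t - s) ^ γ) {u v : ℝ}
    (hu : u ∈ Icc 0 T) (hv : v ∈ Icc 0 T) (huv : |u - v| ≤ h) : ‖x u - x v‖ ≤ A * h ^ γ := by
  have key : ∀ u ∈ Icc 0 T, ∀ v ∈ Icc 0 T, v ≤ u → |u - v| ≤ h → ‖x u - x v‖ ≤ A * h ^ γ :=
    fun u hu v hv hvu huv => by
      rw [abs_of_nonneg (sub_nonneg.2 hvu)] at huv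
      have : 0 ≤ u - v := sub_nonneg.2 hvu
      exact (hx v u hv.1 hvu hu.2).trans (by gcongr)
  rcases le_total v u with h | h
  · exact key u hu v hv h huv
  · rw [norm_sub_rev]; exact key v hv u hu h (by rwa [abs_sub_comm])

lemma norm_reflected_sub_le {z : ℝ → EuclideanSpace ℝ (Fin d)} {A : ℝ} (hA : 0 ≤ A) (hγ : 0 < γ)
    (hz : ∀ s t, 0 ≤ s → s ≤ t → t ≤ T → ‖z t - z s‖ ≤ A * (t - s) ^ γ) {s t : ℝ} (hs : 0 ≤ s)
    (hst : s ≤ t) (ht : t ≤ T) :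
    ‖(z t + regulatorVec z t) - (z s + regulatorVec z s)‖ ≤ (1 + d) * A * (t - s) ^ γ := by
  have h1 := norm_regulatorVec_sub_le (continuousOn_of_holder hγ hz) hs hst ht
    (B := A * (t - s) ^ γ) fun u hu => by
      refine (hz s u hs hu.1 (hu.2.trans ht)).trans ?_
      have : 0 ≤ u - s := sub_nonneg.2 hu.1
      have := hu.2
      gcongr
  calc _ = ‖(z t - z s) + (regulatorVec z t - regulatorVec z s)‖ := by congr 1; abel
    _ ≤ A * (t - s) ^ γ + d * (A * (t - s) ^ γ) :=
        (norm_add_le _ _).trans (add_le_add (hz s t hs hst ht) h1)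
    _ = _ := by ring

/-- A uniform limit `z` of Euler schemes satisfies the Young remainder estimate for the integral of
`σ(s,x(s))` against the driver, where `x` is the reflection of `z`. -/
theorem exists_young_remainder_bound (hc : CoefficientBounds T γ M K b σ) (hT : 0 < T)
    (hγ : 1 / 2 < γ) (hγ1 : γ ≤ 1) (hx₀ : ∀ i, 0 ≤ x₀ i) (hG : 0 ≤ G)
    (hg : ∀ s t, 0 ≤ s → s ≤ t → t ≤ T → ‖g t - g s‖ ≤ G * (t - s) ^ γ)
    {φ : ℕ → ℕ} (hφ : Tendsto φ atTop atTop) {z x : ℝ → EuclideanSpace ℝ (Fin d)} {δ : ℕ → ℝ}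
    (hδ : Tendsto δ atTop (𝓝 0))
    (hz : ∀ j, ∀ t ∈ Icc 0 T, ‖eulerApprox b σ x₀ T g (φ j) t - z t‖ ≤ δ j)
    (hx : ∀ t ∈ Icc 0 T, x t = z t + regulatorVec z t) :
    ∃ A : ℝ, 0 ≤ A ∧ (∀ s t, 0 ≤ s → s ≤ t → t ≤ T → ‖z t - z s‖ ≤ A * (t - s) ^ γ) ∧
      (∀ s t, 0 ≤ s → s ≤ t → t ≤ T → ‖x t - x s‖ ≤ A * (t - s) ^ γ) ∧
      ∀ s t, 0 ≤ s → s ≤ t → t ≤ T →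
        ‖(z t - ∫ u in (0 : ℝ)..t, b u (x u)) - (z s - ∫ u in (0 : ℝ)..s, b u (x u))
          - matrixCLM (σ s (x s)) (g t - g s)‖ ≤ A * (t - s) ^ (2 * γ) := by
  obtain ⟨A, hA, hev⟩ := exists_eulerApprox_bounds hc hT hγ hγ1 hx₀ hG hg
  have hevφ := hφ.eventually hev
  have hγ0 : 0 < γ := by linarith
  have hpt : ∀ t ∈ Icc 0 T, Tendsto (fun j => eulerApprox b σ x₀ T g (φ j) t) atTop (𝓝 (z t)) :=
    fun t ht => by
      rw [tendsto_iff_norm_sub_tendsto_zero]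
      exact squeeze_zero (fun _ => norm_nonneg _) (fun j => hz j t ht) hδ
  have hzH : ∀ s t, 0 ≤ s → s ≤ t → t ≤ T → ‖z t - z s‖ ≤ A * (t - s) ^ γ :=
    fun s t hs hst ht => le_of_tendsto
      ((hpt t ⟨hs.trans hst, ht⟩).sub (hpt s ⟨hs, hst.trans ht⟩)).norm
      (hevφ.mono fun j hj => hj.1 s t hs hst)
  have hzc := continuousOn_of_holder hγ0 hzH
  have hxH : ∀ s t, 0 ≤ s → s ≤ t → t ≤ T → ‖x t - x s‖ ≤ (1 + d) * A * (t - s) ^ γ :=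
    fun s t hs hst ht => by
      rw [hx t ⟨hs.trans hst, ht⟩, hx s ⟨hs, hst.trans ht⟩]
      exact norm_reflected_sub_le hA hγ0 hzH hs hst ht
  have hxc := continuousOn_of_holder hγ0 hxH
  have hA' : A ≤ (1 + d) * A := by nlinarith [(Nat.cast_nonneg d : (0 : ℝ) ≤ d)]
  have hA0 : 0 ≤ (1 + (d : ℝ)) * A := by positivity
  let h : ℕ → ℝ := fun j => T / ((φ j : ℝ) + 1)
  have hh : ∀ j, 0 < h j := fun j => by positivity
  have hhlim : Tendsto h atTop (𝓝 0) := (tendsto_mesh T).comp hφ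
  have hhpow : Tendsto (fun j => h j ^ γ) atTop (𝓝 0) := by
    have := hhlim.rpow_const (p := γ) (Or.inr hγ0.le)
    rwa [Real.zero_rpow hγ0.ne'] at this
  have hgrid : ∀ j k, k ≤ φ j + 1 → h j * (k : ℝ) ∈ Icc 0 T := fun j k hk =>
    ⟨by positivity, mul_le_of_le_grid (hh j) (mesh_mul T (φ j)) hk⟩
  -- The reflected scheme is uniformly close to `x`.
  let X : ℕ → ℕ → EuclideanSpace ℝ (Fin d) := fun j k =>
    (eulerGrid b σ x₀ T g (φ j) k).1 + (eulerGrid b σ x₀ T g (φ j) k).2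
  -- The term in `δ` is the distance of the scheme to `z` together with that of the regulators; the
  -- term in `h` is the variation of `x` over one mesh length.
  let η : ℕ → ℝ := fun j => (1 + d) * δ j + (1 + d) * A * h j ^ γ
  have hη : Tendsto η atTop (𝓝 0) := by
    simpa using (hδ.const_mul (1 + (d : ℝ))).add (hhpow.const_mul ((1 + (d : ℝ)) * A))
  have hXx : ∀ j k, k ≤ φ j + 1 → ∀ v ∈ Icc 0 T, |h j * k - v| ≤ h j → ‖X j k - x v‖ ≤ η j :=
    fun j k hk v hv hkv => by
      have hu := hgrid j k hk
      have h1 : ‖X j k - x (h j * k)‖ ≤ (1 + d) * δ j := by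
        rw [hx _ hu]
        simp only [X, ← eulerApprox_grid (b := b) (σ := σ) (x₀ := x₀) (g := g) hT hk,
          ← regulatorVec_eulerApprox (b := b) (σ := σ) (g := g) hx₀ hT hk]
        rw [add_sub_add_comm]
        refine (norm_add_le _ _).trans ((add_le_add (hz j _ hu)
          (norm_regulatorVec_sub_regulatorVec_le (continuousOn_eulerApprox hT _) hzc hu
            fun u hu' => hz j u ⟨hu'.1, hu'.2.trans hu.2⟩)).trans_eq ?_)
        ring
      have h2 := norm_sub_le_of_abs_le hA0 hγ0.le hxH hu hv hkv
      calc ‖X j k - x v‖ ≤ ‖X j k - x (h j * k)‖ + ‖x (h j * k) - x v‖ :=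
            norm_sub_le_norm_sub_add_norm_sub _ _ _
        _ ≤ η j := add_le_add h1 h2
  -- Index of the last grid point before `s`. Each ingredient of the discrete remainder estimate
  -- converges when evaluated there.
  let κ : ℕ → ℝ → ℕ := fun j s => ⌊s / h j⌋₊
  have hκ : ∀ j, ∀ s ∈ Icc 0 T, κ j s ≤ φ j + 1 ∧ h j * κ j s ≤ s ∧ s ≤ h j * κ j s + h j :=
    fun j s hs => floor_mesh hT (φ j) hs
  have hκabs : ∀ j, ∀ s ∈ Icc 0 T, |h j * κ j s - s| ≤ h j := fun j s hs => by
    obtain ⟨-, h1, h2⟩ := hκ j s hs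
    rw [abs_le]; constructor <;> linarith
  have hκlim : ∀ s ∈ Icc 0 T, Tendsto (fun j => h j * κ j s) atTop (𝓝 s) := fun s hs => by
    rw [tendsto_iff_dist_tendsto_zero]
    exact squeeze_zero (fun _ => dist_nonneg) (fun j => hκabs j s hs) hhlim
  have hXlim : ∀ s ∈ Icc 0 T, Tendsto (fun j => X j (κ j s)) atTop (𝓝 (x s)) := fun s hs => by
    rw [tendsto_iff_norm_sub_tendsto_zero]
    exact squeeze_zero (fun _ => norm_nonneg _)
      (fun j => hXx j _ (hκ j s hs).1 s hs (hκabs j s hs)) hη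
  have hZlim : ∀ s ∈ Icc 0 T, Tendsto (fun j => (eulerGrid b σ x₀ T g (φ j) (κ j s)).1) atTop
      (𝓝 (z s)) := fun s hs => by
    rw [tendsto_iff_norm_sub_tendsto_zero]
    refine squeeze_zero (g := fun j => δ j + A * h j ^ γ) (fun _ => norm_nonneg _) (fun j => ?_)
      (by simpa using hδ.add (hhpow.const_mul A))
    have hu := hgrid j _ (hκ j s hs).1
    rw [← eulerApprox_grid hT (hκ j s hs).1]
    exact (norm_sub_le_norm_sub_add_norm_sub _ (z (h j * κ j s)) _).trans (add_le_add (hz j _ hu)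
      (norm_sub_le_of_abs_le hA hγ0.le hzH hu hs (hκabs j s hs)))
  have hglim : ∀ s ∈ Icc 0 T, Tendsto (fun j => g (h j * κ j s)) atTop (𝓝 (g s)) := fun s hs => by
    rw [tendsto_iff_norm_sub_tendsto_zero]
    exact squeeze_zero (fun _ => norm_nonneg _) (fun j => norm_sub_le_of_abs_le hG hγ0.le hg
      (hgrid j _ (hκ j s hs).1) hs (hκabs j s hs)) (by simpa using hhpow.const_mul G)
  have hflim : ∀ s ∈ Icc 0 T, Tendsto (fun j => matrixCLM (σ (h j * κ j s) (X j (κ j s)))) atTop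
      (𝓝 (matrixCLM (σ s (x s)))) := fun s hs => by
    rw [tendsto_iff_norm_sub_tendsto_zero]
    refine squeeze_zero (g := fun j => K * h j ^ γ + K * η j) (fun _ => norm_nonneg _) (fun j => ?_)
      (by simpa using (hhpow.const_mul K).add (hη.const_mul K))
    obtain ⟨h1, h2, h3⟩ := hκ j s hs
    rw [norm_sub_rev]
    refine (hc.norm_matrixCLM_diffusion_sub_le (hgrid j _ h1).1 h2 hs.2 _ _).trans ?_
    have h4 := hXx j _ h1 s hs (hκabs j s hs)
    rw [norm_sub_rev] at h4
    have h5 := hc.nonneg_K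
    have h6 : 0 ≤ s - h j * κ j s := sub_nonneg.2 h2
    gcongr
    linarith
  let D : ℕ → ℕ → EuclideanSpace ℝ (Fin d) := fun j l =>
    ∑ i ∈ Finset.range l, ∫ s in (h j * i)..(h j * ((i + 1 : ℕ) : ℝ)), b s (X j i)
  -- The scheme integrates `b` exactly in time and freezes only the state, so spatial Lipschitz
  -- continuity suffices and `b` need not be continuous in time. The incomplete last cell
  -- contributes at most `M * h j`.
  have hDlim : ∀ s ∈ Icc 0 T, Tendsto (fun j => D j (κ j s)) atTop
      (𝓝 (∫ u in (0 : ℝ)..s, b u (x u))) := fun s hs => by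
    rw [tendsto_iff_norm_sub_tendsto_zero]
    refine squeeze_zero (g := fun j => K * η j * T + M * h j) (fun _ => norm_nonneg _) (fun j => ?_)
      (by simpa using ((hη.const_mul K).mul_const T).add (hhlim.const_mul M))
    obtain ⟨h1, h2, h3⟩ := hκ j s hs
    have hη0 : 0 ≤ η j := (norm_nonneg _).trans (hXx j _ h1 s hs (hκabs j s hs))
    have hsplit : ∫ u in (0 : ℝ)..s, b u (x u)
        = (∑ i ∈ Finset.range (κ j s), ∫ u in (h j * i)..(h j * ((i + 1 : ℕ) : ℝ)), b u (x u))
          + ∫ u in (h j * κ j s)..s, b u (x u) := by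
      rw [intervalIntegral.sum_integral_adjacent_intervals (a := fun i : ℕ => h j * (i : ℝ))
        fun i hi => hc.intervalIntegrable_drift_comp hxc (hgrid j i (by omega))
          (hgrid j (i + 1) (by omega))]
      simp only [Nat.cast_zero, mul_zero]
      rw [intervalIntegral.integral_add_adjacent_intervals]
      · exact hc.intervalIntegrable_drift_comp hxc ⟨le_rfl, hT.le⟩ (hgrid j _ h1)
      · exact hc.intervalIntegrable_drift_comp hxc (hgrid j _ h1) hs
    have hcell : ∀ i ∈ Finset.range (κ j s),
        ‖(∫ u in (h j * i)..(h j * ((i + 1 : ℕ) : ℝ)), b u (X j i))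
          - ∫ u in (h j * i)..(h j * ((i + 1 : ℕ) : ℝ)), b u (x u)‖ ≤ K * η j * h j := fun i hi => by
      have hi' := Finset.mem_range.1 hi
      have hle : h j * (i : ℝ) ≤ h j * ((i + 1 : ℕ) : ℝ) := by
        have := hh j
        gcongr
        simp
      refine (hc.norm_integral_drift_sub_le (x := fun _ => X j i) continuousOn_const hxc
        (hgrid j i (by omega)).1 hle (hgrid j (i + 1) (by omega)).2 (B := η j)
        fun u hu => ?_).trans_eq (by push_cast; ring)
      refine hXx j i (by omega) u
        ⟨(hgrid j i (by omega)).1.trans hu.1, hu.2.trans (hgrid j (i + 1) (by omega)).2⟩ ?_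
      have := hu.2
      push_cast at this
      rw [abs_le]; constructor <;> linarith [hu.1, hh j]
    have htail := hc.norm_integral_drift_le x (hgrid j _ h1).1 h2 hs.2
    have hM := hc.nonneg_M
    have hK := hc.nonneg_K
    rw [hsplit]
    calc ‖D j (κ j s) - ((∑ i ∈ Finset.range (κ j s),
            ∫ u in (h j * i)..(h j * ((i + 1 : ℕ) : ℝ)), b u (x u))
            + ∫ u in (h j * κ j s)..s, b u (x u))‖
        = ‖(∑ i ∈ Finset.range (κ j s), ((∫ u in (h j * i)..(h j * ((i + 1 : ℕ) : ℝ)), b u (X j i))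
            - ∫ u in (h j * i)..(h j * ((i + 1 : ℕ) : ℝ)), b u (x u)))
            - ∫ u in (h j * κ j s)..s, b u (x u)‖ := by
          rw [Finset.sum_sub_distrib]; congr 1; abel
      _ ≤ ∑ i ∈ Finset.range (κ j s), K * η j * h j + M * (s - h j * κ j s) :=
          (norm_sub_le _ _).trans (add_le_add (norm_sum_le_of_le _ hcell) htail)
      _ = K * η j * (h j * κ j s) + M * (s - h j * κ j s) := by
          rw [Finset.sum_const, Finset.card_range, nsmul_eq_mul]; ring
      _ ≤ K * η j * T + M * h j := by
          gcongr
          · exact (hgrid j _ h1).2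
          · linarith
  have hzH' : ∀ s t, 0 ≤ s → s ≤ t → t ≤ T → ‖z t - z s‖ ≤ (1 + d) * A * (t - s) ^ γ :=
    fun s t hs hst ht => (hzH s t hs hst ht).trans
      (mul_le_mul_of_nonneg_right hA' (Real.rpow_nonneg (sub_nonneg.2 hst) γ))
  refine ⟨(1 + d) * A, hA0, hzH', hxH, ?_⟩
  intro s t hs hst ht
  have hs' : s ∈ Icc 0 T := ⟨hs, hst.trans ht⟩
  have ht' : t ∈ Icc 0 T := ⟨hs.trans hst, ht⟩
  have hflim' := tendsto_clm_apply (hflim s hs') ((hglim t ht').sub (hglim s hs'))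
  have hlim1 := (((hZlim t ht').sub (hZlim s hs')).sub ((hDlim t ht').sub (hDlim s hs'))).sub
    hflim'
  have hlim2 : Tendsto (fun j => A * (h j * κ j t - h j * κ j s) ^ (2 * γ)) atTop
      (𝓝 (A * (t - s) ^ (2 * γ))) :=
    (((hκlim t ht').sub (hκlim s hs')).rpow_const (Or.inr (by linarith))).const_mul A
  have hle : ‖z t - z s - ((∫ u in (0 : ℝ)..t, b u (x u)) - ∫ u in (0 : ℝ)..s, b u (x u))
      - matrixCLM (σ s (x s)) (g t - g s)‖ ≤ A * (t - s) ^ (2 * γ) :=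
    -- The discrete Young remainder bound between the grid points below `s` and `t` passes to the
    -- limit.
    le_of_tendsto_of_tendsto hlim1.norm hlim2 (hevφ.mono fun j hj =>
      hj.2 (κ j s) (κ j t) (Nat.floor_le_floor (by have := hh j; gcongr)) (hκ j t ht').1)
  have hpow : 0 ≤ (t - s) ^ (2 * γ) := Real.rpow_nonneg (sub_nonneg.2 hst) (2 * γ)
  rw [sub_sub_sub_comm]
  exact hle.trans (mul_le_mul_of_nonneg_right hA' hpow)

end EulerLimit

/-! ### Solutions of the reflected equation -/

section ReflectedEquation

open Filter Topology

variable {d m : ℕ} {b : ℝ → EuclideanSpace ℝ (Fin d) → EuclideanSpace ℝ (Fin d)}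
  {σ : ℝ → EuclideanSpace ℝ (Fin d) → Matrix (Fin d) (Fin m) ℝ} {x₀ : EuclideanSpace ℝ (Fin d)}
  {T M K G : ℝ} {γ : ℝ≥0} {g : ℝ → EuclideanSpace ℝ (Fin m)}

open scoped Matrix.Norms.Frobenius in
/-- A family of increments with the Young remainder estimate is the Young integral. -/
lemma isYoungIntegral_of_remainder_bound (hγ : 1 / 2 < (γ : ℝ))
    {f : ℝ → Matrix (Fin d) (Fin m) ℝ} {F A : ℝ} (hF : 0 ≤ F) (hG : 0 ≤ G)
    (hf : ∀ s t, 0 ≤ s → s ≤ t → t ≤ T → ‖f t - f s‖ ≤ F * (t - s) ^ (γ : ℝ))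
    (hg : ∀ s t, 0 ≤ s → s ≤ t → t ≤ T → ‖g t - g s‖ ≤ G * (t - s) ^ (γ : ℝ))
    {I : ℝ → EuclideanSpace ℝ (Fin d)} (hI : ContinuousOn I (Icc 0 T))
    (hrem : ∀ s t, 0 ≤ s → s ≤ t → t ≤ T →
      ‖I t - I s - matrixCLM (f s) (g t - g s)‖ ≤ A * (t - s) ^ (2 * (γ : ℝ))) :
    IsYoungIntegral T f g fun s t => I t - I s := by
  have hγ0 : (0 : ℝ) < γ := by linarith
  have hγ0' : 0 < γ := NNReal.coe_pos.1 hγ0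
  refine ⟨⟨γ, γ, F.toNNReal, G.toNNReal, hγ0', hγ0', ?_, holderOnWith_of_norm_sub_le hf,
    holderOnWith_of_norm_sub_le hg⟩, fun s t => I t - I s - matrixCLM (f s) (g t - g s), ?_, ?_⟩
  · have : (1 : ℝ) < γ + γ := by linarith
    exact_mod_cast this
  · have hfc : ContinuousOn (fun s => matrixCLM (f s)) (Icc 0 T) :=
      continuousOn_of_holder hγ0 fun s t hs hst ht => by
        rw [← matrixCLM_sub]
        exact (norm_matrixCLM_le _).trans (hf s t hs hst ht)
    have hgc : ContinuousOn g (Icc 0 T) := continuousOn_of_holder hγ0 hg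
    have hfst : MapsTo Prod.fst (Icc (0 : ℝ) T ×ˢ Icc (0 : ℝ) T) (Icc 0 T) := fun p hp => hp.1
    have hsnd : MapsTo Prod.snd (Icc (0 : ℝ) T ×ˢ Icc (0 : ℝ) T) (Icc 0 T) := fun p hp => hp.2
    refine ⟨?_, fun t _ => by simp, ⟨A + F * G, 2 * γ, by linarith, ?_⟩, ?_⟩
    · refine ((hI.comp continuousOn_snd hsnd).sub (hI.comp continuousOn_fst hfst)).sub ?_
      exact (hfc.comp continuousOn_fst hfst).clm_apply
        ((hgc.comp continuousOn_snd hsnd).sub (hgc.comp continuousOn_fst hfst))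
    · intro s hs t ht
      rcases le_total s t with hst | hst
      · rw [abs_of_nonneg (sub_nonneg.2 hst)]
        have := Real.rpow_nonneg (sub_nonneg.2 hst) (2 * (γ : ℝ))
        refine (hrem s t hs.1 hst ht.2).trans ?_
        gcongr
        exact le_add_of_nonneg_right (by positivity)
      · rw [abs_sub_comm, abs_of_nonneg (sub_nonneg.2 hst)]
        -- For reversed times, moving the base point of the leading term from `s` to `t` produces
        -- this cross term; it explains the extra `F * G` in the constant.
        have hcross : ‖matrixCLM (f s - f t) (g s - g t)‖ ≤ F * G * (s - t) ^ (2 * (γ : ℝ)) := by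
          calc ‖matrixCLM (f s - f t) (g s - g t)‖ ≤ ‖matrixCLM (f s - f t)‖ * ‖g s - g t‖ :=
                ContinuousLinearMap.le_opNorm _ _
            _ ≤ (F * (s - t) ^ (γ : ℝ)) * (G * (s - t) ^ (γ : ℝ)) := by
                have := Real.rpow_nonneg (sub_nonneg.2 hst) (γ : ℝ)
                gcongr
                · exact (norm_matrixCLM_le _).trans (hf t s ht.1 hst hs.2)
                · exact hg t s ht.1 hst hs.2
            _ = _ := by
                rw [two_mul, Real.rpow_add_of_nonneg (sub_nonneg.2 hst) hγ0.le hγ0.le]; ring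
        have he : I t - I s - matrixCLM (f s) (g t - g s)
            = -(I s - I t - matrixCLM (f t) (g s - g t)) + matrixCLM (f s - f t) (g s - g t) := by
          rw [matrixCLM_sub, sub_apply, ← neg_sub (g s) (g t), map_neg]; abel
        rw [he, add_mul]
        refine (norm_add_le _ _).trans (add_le_add ?_ hcross)
        rw [norm_neg]
        exact hrem t s ht.1 hst hs.2
    · intro s _ u _ t _
      rw [← matrixCLM_apply, matrixCLM_sub, sub_apply, map_sub, map_sub, map_sub, map_sub]
      abel
  · intro s _ t _
    exact (add_sub_cancel _ _).symm

/-- The candidate integral is by definition the increment of `z` minus the drift, so the equation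
for `z` only needs `z 0 = x₀`. The substance is the remainder bound, which makes this candidate the
Young integral. -/
theorem isReflectedSolution_of_tendsto (hc : CoefficientBounds T γ M K b σ) (hT : 0 < T)
    (hγ : 1 / 2 < (γ : ℝ)) (hγ1 : (γ : ℝ) ≤ 1) (hx₀ : ∀ i, 0 ≤ x₀ i) (hG : 0 ≤ G)
    (hg : ∀ s t, 0 ≤ s → s ≤ t → t ≤ T → ‖g t - g s‖ ≤ G * (t - s) ^ (γ : ℝ))
    {φ : ℕ → ℕ} (hφ : Tendsto φ atTop atTop) {z x : ℝ → EuclideanSpace ℝ (Fin d)} {δ : ℕ → ℝ}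
    (hδ : Tendsto δ atTop (𝓝 0))
    (hz : ∀ j, ∀ t ∈ Icc 0 T, ‖eulerApprox b σ x₀ T g (φ j) t - z t‖ ≤ δ j)
    (hx : ∀ t ∈ Icc 0 T, x t = z t + regulatorVec z t) :
    IsReflectedSolution T b σ x₀ g x := by
  have hγ0 : (0 : ℝ) < γ := by linarith
  obtain ⟨A, hA, hzH, hxH, hrem⟩ :=
    exists_young_remainder_bound hc hT hγ hγ1 hx₀ hG hg hφ hδ hz hx
  have hzc := continuousOn_of_holder hγ0 hzH
  have hxc := continuousOn_of_holder hγ0 hxH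
  have h0T : (0 : ℝ) ∈ Icc 0 T := ⟨le_rfl, hT.le⟩
  have hz0 : z 0 = x₀ := by
    have hle : ‖x₀ - z 0‖ ≤ 0 := ge_of_tendsto' hδ fun j => by
      have := hz j 0 h0T
      rwa [eulerApprox_zero hT] at this
    exact (sub_eq_zero.1 (norm_le_zero_iff.1 hle)).symm
  have hIc : ContinuousOn (fun t => z t - ∫ u in (0 : ℝ)..t, b u (x u)) (Icc 0 T) := by
    refine hzc.sub (continuousOn_of_holder (C := M) one_pos fun s t hs hst ht => ?_)
    have hs' : s ∈ Icc 0 T := ⟨hs, hst.trans ht⟩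
    have ht' : t ∈ Icc 0 T := ⟨hs.trans hst, ht⟩
    rw [intervalIntegral.integral_interval_sub_left (hc.intervalIntegrable_drift_comp hxc h0T ht')
      (hc.intervalIntegrable_drift_comp hxc h0T hs'), Real.rpow_one]
    exact hc.norm_integral_drift_le x hs hst ht
  refine ⟨hc.intervalIntegrable_drift_comp hxc h0T ⟨hT.le, le_rfl⟩,
    fun s t => (z t - ∫ u in (0 : ℝ)..t, b u (x u)) - (z s - ∫ u in (0 : ℝ)..s, b u (x u)),
    z, regulatorVec z, ?_, fun t _ => ?_, fun t ht i => ?_, ?_⟩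
  · have hK := hc.nonneg_K
    refine isYoungIntegral_of_remainder_bound (F := K + K * A) hγ (by positivity) hG
      (fun s t hs hst ht => ?_) hg hIc hrem
    refine (hc.norm_diffusion_sub_le hs hst ht _ _).trans ?_
    rw [add_mul, mul_assoc K A]
    gcongr
    exact hxH s t hs hst ht
  · simp only [intervalIntegral.integral_same, hz0]
    abel
  · exact isGreatest_regulator (hzc.euclidean_apply i) ht
  · exact isSkorokhodSolution_regulatorVec hT.le hzc (fun i => by rw [hz0]; exact hx₀ i) hx

/-- Evaluation at time `t` of the reflection of a continuous path depends continuously on it. -/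
lemma continuous_reflected_eval (hT : 0 ≤ T) (t : Icc (0 : ℝ) T) :
    Continuous fun Z : C(Icc (0 : ℝ) T, EuclideanSpace ℝ (Fin d)) =>
      Z t + regulatorVec (IccExtend hT Z) t := by
  refine (LipschitzWith.of_dist_le_mul (K := 1 + d) fun Z Z' => ?_).continuous
  have hZ : ∀ s, ‖Z s - Z' s‖ ≤ dist Z Z' := fun s => by
    rw [← dist_eq_norm]; exact ContinuousMap.dist_apply_le_dist s
  have hreg : ‖regulatorVec (IccExtend hT Z) t - regulatorVec (IccExtend hT Z') t‖
      ≤ d * dist Z Z' :=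
    norm_regulatorVec_sub_regulatorVec_le Z.continuous.Icc_extend'.continuousOn
      Z'.continuous.Icc_extend'.continuousOn t.2 fun u _ => hZ (projIcc 0 T hT u)
  rw [dist_eq_norm, add_sub_add_comm]
  refine (norm_add_le _ _).trans ((add_le_add (hZ t) hreg).trans_eq ?_)
  push_cast; ring

lemma HolderSpace.continuous_val {r : ℝ≥0} {E : Type*} [NormedAddCommGroup E] :
    Continuous fun f : HolderSpace r T E => (f.1 : C(Icc (0 : ℝ) T, E)) := by
  refine (LipschitzWith.of_dist_le_mul (K := 1) fun f f' => ?_).continuous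
  rw [NNReal.coe_one, one_mul, dist_eq_norm, dist_eq_norm, HolderSpace.norm_def]
  exact le_add_of_nonneg_right (NNReal.coe_nonneg _)

end ReflectedEquation

/-! ### The driving path and the assembly of the theorem. -/

lemma IsFractionalBrownianMotion.ae_holder_drivingPath {Ω : Type*} [MeasurableSpace Ω]
    {P : Measure Ω} {m : ℕ} {H : ℝ} {W : Fin m → ℝ≥0 → Ω → ℝ}
    (hW : ∀ j, IsFractionalBrownianMotion H (W j) P) {γ T : ℝ} (hγ : 0 < γ) (hγH : γ < H)
    (hT : 0 < T) :
    ∀ᵐ ω ∂P, ∃ G : ℝ, 0 ≤ G ∧ ∀ s t, 0 ≤ s → s ≤ t → t ≤ T →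
      ‖drivingPath W ω t - drivingPath W ω s‖ ≤ G * (t - s) ^ γ := by
  filter_upwards [ae_all_iff.2 fun j => (hW j).ae_holder hγ hγH hT] with ω hω
  choose C hC hCH using hω
  refine ⟨∑ j, C j, Finset.sum_nonneg fun j _ => hC j, fun s t hs hst ht => ?_⟩
  rw [Finset.sum_mul]
  exact (EuclideanSpace.norm_le_sum_abs _).trans
    (Finset.sum_le_sum fun j _ => hCH j s t hs hst ht)

theorem mainTheorem1 {Ω : Type*} [MeasurableSpace Ω] (P : Measure Ω) [IsProbabilityMeasure P]
    (d m : ℕ) (T : ℝ) (hT : 0 < T) (H : ℝ) (hH : 1 / 2 < H) (hH1 : H < 1)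
    (W : Fin m → ℝ≥0 → Ω → ℝ)
    (hW : ∀ j, IsFractionalBrownianMotion H (W j) P)
    (hWindep : iIndepFun (fun j ω t => W j t ω) P)
    (ν : ℝ) (hν : H ≤ ν)
    (σ : ℝ → EuclideanSpace ℝ (Fin d) → Matrix (Fin d) (Fin m) ℝ)
    (hσ : DiffusionHypothesis T ν σ)
    (b : ℝ → EuclideanSpace ℝ (Fin d) → EuclideanSpace ℝ (Fin d))
    (hb : DriftHypothesis T b)
    (x₀ : EuclideanSpace ℝ (Fin d)) (hx₀ : ∀ i, 0 < x₀ i)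
    (lam₀ : ℝ≥0) (hlam : 1 / 2 < (lam₀ : ℝ)) (hlamH : (lam₀ : ℝ) < H) :
    ∃ X : Ω →ₘ[P] HolderSpace lam₀ T (EuclideanSpace ℝ (Fin d)),
      ∀ᵐ ω ∂P, IsReflectedSolution T b σ x₀ (drivingPath W ω) (IccExtend hT.le (X ω)) := by
  -- The gap below `H` gives Hölder paths of the driver; the gap above `lam₀` gives strong
  -- measurability in the `lam₀`-norm.
  obtain ⟨γ, hlamγ, hγH⟩ : ∃ γ : ℝ≥0, (lam₀ : ℝ) < γ ∧ (γ : ℝ) < H := by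
    obtain ⟨γ, h1, h2⟩ := exists_between hlamH
    exact ⟨⟨γ, lam₀.coe_nonneg.trans h1.le⟩, h1, h2⟩
  have hγ : 1 / 2 < (γ : ℝ) := hlam.trans hlamγ
  have hγ1 : (γ : ℝ) ≤ 1 := (hγH.trans hH1).le
  have hγ0 : (0 : ℝ) < γ := by linarith
  have hlam0 : 0 < lam₀ := NNReal.coe_pos.1 (by linarith)
  have hlam1 : lam₀ ≤ 1 := by exact_mod_cast (hlamγ.le.trans hγ1)
  have hx₀' : ∀ i, 0 ≤ x₀ i := fun i => (hx₀ i).le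
  obtain ⟨M, K, hc⟩ := exists_coefficientBounds hT hγ0 (hγH.le.trans hν) hb hσ
  have hg := IsFractionalBrownianMotion.ae_holder_drivingPath hW hγ0 hγH hT
  have hWm : ∀ t : ℝ, AEMeasurable (fun ω => drivingPath W ω t) P := fun t =>
    (PiLp.continuous_toLp 2 _).measurable.comp_aemeasurable
      (aemeasurable_pi_iff.2 fun j => (hW j).gaussian.aemeasurable _)
  have hh : ∀ n : ℕ, 0 < T / ((n : ℝ) + 1) := fun n => by positivity
  -- The schemes are viewed as continuous paths with the supremum norm, where the space is separable
  -- and Hölder balls are compact.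
  let f : ℕ → Ω → C(Icc (0 : ℝ) T, EuclideanSpace ℝ (Fin d)) := fun n ω =>
    (gridHolder lam₀ hlam0 hlam1 T (T / (n + 1)) (hh n)
      (fun i : Fin (n + 1 + 1) => (eulerGrid b σ x₀ T (drivingPath W ω) n i).1)).1
  have hf : ∀ n ω (t : Icc (0 : ℝ) T), f n ω t = eulerApprox b σ x₀ T (drivingPath W ω) n t :=
    fun n ω t => rfl
  let _ : MeasurableSpace C(Icc (0 : ℝ) T, EuclideanSpace ℝ (Fin d)) := borel _
  have _ : BorelSpace C(Icc (0 : ℝ) T, EuclideanSpace ℝ (Fin d)) := ⟨rfl⟩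
  have hfm : ∀ n, AEMeasurable (f n) P := fun n => by
    have hv : AEMeasurable (fun ω (i : Fin (n + 1 + 1)) =>
        (eulerGrid b σ x₀ T (drivingPath W ω) n i).1) P :=
      aemeasurable_pi_iff.2 fun i => (aemeasurable_eulerState hc (hh n) (mesh_mul T n)
        (fun k => hWm _) (Nat.lt_succ_iff.1 i.2)).fst
    exact (HolderSpace.continuous_val.comp continuous_gridHolder).measurable.comp_aemeasurable hv
  have hK : ∀ᵐ ω ∂P, ∃ S, IsCompact S ∧ ∀ᶠ n in Filter.atTop, f n ω ∈ S := by
    filter_upwards [hg] with ω ⟨G, hG, hgω⟩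
    obtain ⟨A, hA, hev⟩ := exists_eulerApprox_bounds hc hT hγ hγ1 hx₀' hG hgω
    refine ⟨_, isCompact_holderBall T A (A * T ^ (γ : ℝ) + ‖x₀‖) hγ0, hev.mono fun n hn =>
      ⟨fun t => ?_, fun s t hst => hn.1 s t s.2.1 hst⟩⟩
    have h1 := hn.1 0 t le_rfl t.2.1
    rw [eulerApprox_zero hT, sub_zero] at h1
    rw [hf]
    have h2 : A * (t : ℝ) ^ (γ : ℝ) ≤ A * T ^ (γ : ℝ) := by
      have := t.2.1
      have := t.2.2
      gcongr
    have h3 := norm_sub_norm_le (eulerApprox b σ x₀ T (drivingPath W ω) n t) x₀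
    linarith
  obtain ⟨Z, hZm, hZ⟩ := exists_aemeasurable_mapClusterPt hfm hK
  -- The conclusion is stated for every `x` agreeing with the reflection on `[0,T]`, so that it
  -- applies to any representative chosen later.
  have hsol : ∀ᵐ ω ∂P, ∃ A : ℝ, 0 ≤ A ∧ (∀ s t : Icc (0 : ℝ) T, s ≤ t →
      ‖(Z ω t + regulatorVec (IccExtend hT.le (Z ω)) t)
        - (Z ω s + regulatorVec (IccExtend hT.le (Z ω)) s)‖ ≤ A * ((t : ℝ) - s) ^ (γ : ℝ)) ∧
      ∀ x : ℝ → EuclideanSpace ℝ (Fin d), (∀ t ∈ Icc 0 T, x t = IccExtend hT.le (Z ω) t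
        + regulatorVec (IccExtend hT.le (Z ω)) t) →
        IsReflectedSolution T b σ x₀ (drivingPath W ω) x := by
    filter_upwards [hg, hZ] with ω ⟨G, hG, hgω⟩ hcl
    obtain ⟨φ, hφ, hlim⟩ := hcl.tendsto_subseq
    have hδ := tendsto_iff_dist_tendsto_zero.1 hlim
    have hclose : ∀ j, ∀ t ∈ Icc 0 T, ‖eulerApprox b σ x₀ T (drivingPath W ω) (φ j) t
        - IccExtend hT.le (Z ω) t‖ ≤ dist (f (φ j) ω) (Z ω) := fun j t ht => by
      rw [IccExtend_of_mem hT.le _ ht, ← hf (φ j) ω ⟨t, ht⟩, ← dist_eq_norm]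
      exact ContinuousMap.dist_apply_le_dist _
    obtain ⟨A, hA, -, hxH, -⟩ := exists_young_remainder_bound hc hT hγ hγ1 hx₀' hG hgω
      hφ.tendsto_atTop hδ hclose fun t _ => rfl
    refine ⟨A, hA, fun s t hst => ?_, fun x hx => isReflectedSolution_of_tendsto hc hT hγ hγ1 hx₀'
      hG hgω hφ.tendsto_atTop hδ hclose hx⟩
    simpa only [IccExtend_val] using hxH s t s.2.1 hst t.2.2
  -- The reflected path defines an element of the Hölder space only when it is Hölder; on the
  -- exceptional null set the value `0` is used.
  have hexists : ∀ ω, ∃ F : HolderSpace lam₀ T (EuclideanSpace ℝ (Fin d)),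
      (∃ A : ℝ, ∀ s t : Icc (0 : ℝ) T, s ≤ t →
        ‖(Z ω t + regulatorVec (IccExtend hT.le (Z ω)) t)
          - (Z ω s + regulatorVec (IccExtend hT.le (Z ω)) s)‖ ≤ A * ((t : ℝ) - s) ^ (γ : ℝ)) →
      ∀ t, F t = Z ω t + regulatorVec (IccExtend hT.le (Z ω)) t := fun ω => by
    by_cases hA : ∃ A : ℝ, ∀ s t : Icc (0 : ℝ) T, s ≤ t →
        ‖(Z ω t + regulatorVec (IccExtend hT.le (Z ω)) t)
          - (Z ω s + regulatorVec (IccExtend hT.le (Z ω)) s)‖ ≤ A * ((t : ℝ) - s) ^ (γ : ℝ)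
    · obtain ⟨A, hA⟩ := hA
      have hw := holderWith_of_norm_sub_le
        (f := fun t : Icc (0 : ℝ) T => Z ω t + regulatorVec (IccExtend hT.le (Z ω)) t) hA
      exact ⟨⟨⟨_, hw.continuous (NNReal.coe_pos.1 hγ0)⟩,
        hw.memHolder.of_le (by exact_mod_cast hlamγ.le)⟩, fun _ t => rfl⟩
    · exact ⟨0, fun h => absurd h hA⟩
  choose X hX using hexists
  have hXt : ∀ᵐ ω ∂P, ∀ t, X ω t = Z ω t + regulatorVec (IccExtend hT.le (Z ω)) t := by
    filter_upwards [hsol] with ω ⟨A, _, hA, _⟩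
    exact hX ω ⟨A, hA⟩
  have hXm : AEStronglyMeasurable X P := by
    refine HolderSpace.aestronglyMeasurable_of_holder hlam0 hT hlamγ hγ1 (fun t => ?_) ?_
    · refine ((continuous_reflected_eval hT.le t).measurable.comp_aemeasurable hZm).congr ?_
      filter_upwards [hXt] with ω hω
      exact (hω t).symm
    · filter_upwards [hsol, hXt] with ω ⟨A, hA0, hA, _⟩ hω
      refine ⟨A, hA0, fun s t hst => ?_⟩
      rw [hω, hω]
      exact hA s t hst
  refine ⟨AEEqFun.mk X hXm, ?_⟩
  filter_upwards [AEEqFun.coeFn_mk X hXm, hsol, hXt] with ω hω ⟨_, _, _, hsolω⟩ hXω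
  rw [hω]
  refine hsolω _ fun t ht => ?_
  rw [IccExtend_of_mem hT.le _ ht, IccExtend_of_mem hT.le _ ht]
  exact hXω ⟨t, ht⟩
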